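/- Let $n\ge 1$ be an integer, $1<s<2$, $p>1$, $b:=3-2s$. Write points of $\mathbb R^{n+1}_+=\mathbb R^n\times(0,\infty)$ as $X=(x,y)$ and set $\Delta_b w:=\Delta w+\frac b y\,\partial_y w$. For $\kappa\in\mathbb R$ (the constant $C_{n,s}$ of the boundary condition), let $u_e:\overline{\mathbb R^{n+1}_+}\to\mathbb R$ be a solution of $$\Delta_b^2u_e=0\ \text{ in }\mathbb R^{n+1}_+,\qquad \lim_{y\to0}y^b\partial_yu_e=0,\qquad \lim_{y\to0}y^b\partial_y\Delta_bu_e=\kappa\,|u_e|^{p-1}u_e\ \text{ on }\partial\mathbb R^{n+1}_+,$$ which is classical in the following sense: $u_e$ is $C^4$ in $\mathbb R^{n+1}_+$ and continuous on $\overline{\mathbb R^{n+1}_+}$, and the functions $D_x^\gamma u_e$ ($|\gamma|\le3$), $y^b\partial_yD_x^\gamma u_e$ ($|\gamma|\le2$), $D_x^\gamma\Delta_bu_e$ ($|\gamma|\le1$) and $y^b\partial_y\Delta_bu_e$ extend continuously from $\mathbb R^{n+1}_+$ to $\overline{\mathbb R^{n+1}_+}$. For $x_0\in\mathbb R^n$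 let $B_r$ be the ball of radius $r$ centred at $(x_0,0)$, let $\frac{\partial}{\partial r}$ denote the radial derivative with respect to that centre, let integrals over $\partial B_r$ be taken with respect to surface measure, and define for $r>0$ $$\begin{aligned}E(r,x_0,u_e):=\;& r^{2s\frac{p+1}{p-1}-n}\Big(\int_{\mathbb R^{n+1}_+\cap B_r}\tfrac12y^{3-2s}|\Delta_bu_e|^2-\frac{\kappa}{p+1}\int_{\partial\mathbb R^{n+1}_+\cap B_r}|u_e|^{p+1}\Big)\\ &-\frac s{p-1}\Big(\frac{p+2s-1}{p-1}-n-b\Big)r^{-3+2s+\frac{4s}{p-1}-n}\int_{\mathbb R^{n+1}_+\cap\partial B_r}y^{3-2s}u_e^2\\ &-\frac s{p-1}\Big(\frac{p+2s-1}{p-1}-n-b\Big)\frac{d}{dr}\Big[r^{\frac{4s}{p-1}+2s-2-n}\int_{\mathbb R^{n+1}_+\cap\partial B_r}y^{3-2s}u_e^2\Big]\\ &+\frac12r^3\frac{d}{dr}\Big[r^{\frac{4s}{p-1}+2s-3-n}\int_{\mathbb R^{n+1}_+\cap\partial B_r}y^{3-2s}\Big(\frac{2s}{p-1}r^{-1}u_e+\frac{\partial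 u_e}{\partial r}\Big)^2\Big]\\ &+\frac12\frac{d}{dr}\Big[r^{2s\frac{p+1}{p-1}-n}\int_{\mathbb R^{n+1}_+\cap\partial B_r}y^{3-2s}\Big(|\nabla u_e|^2-\Big|\frac{\partial u_e}{\partial r}\Big|^2\Big)\Big]\\ &+\frac12r^{2s\frac{p+1}{p-1}-n-1}\int_{\mathbb R^{n+1}_+\cap\partial B_r}y^{3-2s}\Big(|\nabla u_e|^2-\Big|\frac{\partial u_e}{\partial r}\Big|^2\Big).\end{aligned}$$ **Theorem 2.1.** Assume $n>\frac{p+4s-1}{p+2s-1}+\frac{2s}{p-1}-b$. There is a constant $C=C(n,s,p)>0$, depending only on $n,s,p$, such that for all $\kappa$, $u_e$ and $x_0$ as above: all integrals and derivatives in the definition of $E(\lambda,x_0,u_e)$ exist for every $\lambda>0$, the function $\lambda\mapsto E(\lambda,x_0,u_e)$ is nondecreasing and differentiable on $(0,\infty)$, and for every $\lambda>0$ $$\frac{dE(\lambda,x_0,u_e)}{d\lambda}\ \ge\ C\,\lambda^{\frac{4s}{p-1}+2s-2-n}\int_{\mathbb R^{n+1}_+\cap\partial B_\lambda}y^{3-2s}\Big(\frac{2s}{p-1}r^{-1}u_e+\frac{\partial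 u_e}{\partial r}\Big)^2 .$$ -/

import Mathlib

open MeasureTheory Set Filter Topology

noncomputable section

namespace FracLaneEmden

/-- The space `ℝⁿ⁺¹ = ℝⁿ × ℝ`. A point `X` is `(x, y)`, where `y` is the last coordinate. -/
abbrev Space (n : ℕ) : Type := EuclideanSpace ℝ (Fin (n + 1))

/-- The point `(x, y)`. -/
def pt {n : ℕ} (x : EuclideanSpace ℝ (Fin n)) (y : ℝ) : Space n :=
  WithLp.toLp 2 (Fin.snoc (α := fun _ => ℝ) (fun i => x i) y)

/-- The vertical coordinate `y` of `X = (x, y)`. -/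
def ht {n : ℕ} (X : Space n) : ℝ := X (Fin.last n)

/-- The open upper half-space `{y > 0}`. -/
def upperHalf (n : ℕ) : Set (Space n) := {X | 0 < ht X}

/-- The closed upper half-space `{y ≥ 0}`. -/
def closedUpperHalf (n : ℕ) : Set (Space n) := {X | 0 ≤ ht X}

/-- The weight exponent `b = 3 - 2 s`. -/
def wexp (s : ℝ) : ℝ := 3 - 2 * s

/-- The vertical derivative `∂_y w`. -/
def dy {n : ℕ} (w : Space n → ℝ) (X : Space n) : ℝ :=
  fderiv ℝ w X (EuclideanSpace.single (Fin.last n) 1)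

/-- The horizontal derivative `∂_{x_i} w`. -/
def dx {n : ℕ} (i : Fin n) (w : Space n → ℝ) (X : Space n) : ℝ :=
  fderiv ℝ w X (EuclideanSpace.single i.castSucc 1)

/-- The iterated horizontal derivative `∂_{x_{i₁}} ⋯ ∂_{x_{i_k}} w` for `γ = [i₁, …, i_k]`. -/
def dxs {n : ℕ} (γ : List (Fin n)) (w : Space n → ℝ) : Space n → ℝ :=
  γ.foldr dx w

/-- The operator `Δ_b w = Δ w + (b / y) ∂_y w`, with `b = 3 - 2 s`. -/
def lapB {n : ℕ} (s : ℝ) (w : Space n → ℝ) (X : Space n) : ℝ :=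
  Laplacian.laplacian w X + wexp s / ht X * dy w X

/-- The weighted vertical derivative `y ^ b ∂_y w`. -/
def conormal {n : ℕ} (s : ℝ) (w : Space n → ℝ) (X : Space n) : ℝ :=
  ht X ^ wexp s * dy w X

/-- The restriction of `w` to the open upper half-space is continuous up to the boundary
`{y = 0}`. -/
def ContUpToBoundary {n : ℕ} (w : Space n → ℝ) : Prop :=
  ∃ g : Space n → ℝ, ContinuousOn g (closedUpperHalf n) ∧ EqOn g w (upperHalf n)

/-- `u` (only its values on `{y ≥ 0}` matter) is a classical solution of the extension problem
`Δ_b² u = 0` in `{y > 0}`, `lim_{y → 0} y ^ b ∂_y u = 0` and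
`lim_{y → 0} y ^ b ∂_y Δ_b u = κ |u| ^ (p - 1) u` on `{y = 0}`. The regularity fields make precise
that `u` is smooth in the interior and regular up to the boundary in the sense adapted to the
weight: derivatives in `y` enter only through `y ^ b ∂_y`. -/
structure IsExtensionSolution (n : ℕ) (s p κ : ℝ) (u : Space n → ℝ) : Prop where
  contDiff : ContDiffOn ℝ 4 u (upperHalf n)
  cont : ContinuousOn u (closedUpperHalf n)
  reg_dx : ∀ γ : List (Fin n), γ.length ≤ 3 → ContUpToBoundary (dxs γ u)
  reg_conormal_dx : ∀ γ : List (Fin n), γ.length ≤ 2 → ContUpToBoundary (conormal s (dxs γ u))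
  reg_lap_dx : ∀ γ : List (Fin n), γ.length ≤ 1 → ContUpToBoundary (dxs γ (lapB s u))
  reg_conormal_lap : ContUpToBoundary (conormal s (lapB s u))
  eqn : ∀ X ∈ upperHalf n, lapB s (lapB s u) X = 0
  neumann : ∀ x : EuclideanSpace ℝ (Fin n),
    Tendsto (fun y : ℝ => conormal s u (pt x y)) (𝓝[>] 0) (𝓝 0)
  nonlinear : ∀ x : EuclideanSpace ℝ (Fin n),
    Tendsto (fun y : ℝ => conormal s (lapB s u) (pt x y)) (𝓝[>] 0)
      (𝓝 (κ * (|u (pt x 0)| ^ (p - 1) * u (pt x 0))))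

/-- The open unit upper half-sphere, as a set of points of the unit sphere. -/
def upperSphere (n : ℕ) : Set (Metric.sphere (0 : Space n) 1) :=
  {ω | 0 < ht (ω : Space n)}

/-- The surface integral `∫_{ℝⁿ⁺¹₊ ∩ ∂B_r(x₀, 0)} f`, written on the unit half-sphere with its
surface measure. -/
def capInt {n : ℕ} (x₀ : EuclideanSpace ℝ (Fin n)) (r : ℝ) (f : Space n → ℝ) : ℝ :=
  r ^ n * ∫ ω in upperSphere n, f (pt x₀ 0 + r • (ω : Space n))
    ∂(volume : Measure (Space n)).toSphere

/-- Integrability of `f` over `ℝⁿ⁺¹₊ ∩ ∂B_r(x₀, 0)` with respect to surface measure. -/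
def CapIntegrable {n : ℕ} (x₀ : EuclideanSpace ℝ (Fin n)) (r : ℝ) (f : Space n → ℝ) : Prop :=
  IntegrableOn (fun ω : Metric.sphere (0 : Space n) 1 => f (pt x₀ 0 + r • (ω : Space n)))
    (upperSphere n) (volume : Measure (Space n)).toSphere

/-- The distance `r = |X - (x₀, 0)|`. -/
def rad {n : ℕ} (x₀ : EuclideanSpace ℝ (Fin n)) (X : Space n) : ℝ := ‖X - pt x₀ 0‖

/-- The radial derivative `∂u/∂r` with respect to the centre `(x₀, 0)`. -/
def dr {n : ℕ} (x₀ : EuclideanSpace ℝ (Fin n)) (u : Space n → ℝ) (X : Space n) : ℝ :=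
  fderiv ℝ u X ((rad x₀ X)⁻¹ • (X - pt x₀ 0))

/-- `½ y^{3-2s} |Δ_b u|²`. -/
def bulkDensity {n : ℕ} (s : ℝ) (u : Space n → ℝ) (X : Space n) : ℝ :=
  1 / 2 * ht X ^ (3 - 2 * s) * |lapB s u X| ^ 2

/-- `|u(x, 0)|^{p+1}`. -/
def traceDensity {n : ℕ} (p : ℝ) (u : Space n → ℝ) (x : EuclideanSpace ℝ (Fin n)) : ℝ :=
  |u (pt x 0)| ^ (p + 1)

/-- `y^{3-2s} u²`. -/
def massDensity {n : ℕ} (s : ℝ) (u : Space n → ℝ) (X : Space n) : ℝ :=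
  ht X ^ (3 - 2 * s) * u X ^ 2

/-- `y^{3-2s} (2s/(p-1) r⁻¹ u + ∂u/∂r)²`. -/
def homDensity {n : ℕ} (s p : ℝ) (x₀ : EuclideanSpace ℝ (Fin n)) (u : Space n → ℝ)
    (X : Space n) : ℝ :=
  ht X ^ (3 - 2 * s) * (2 * s / (p - 1) * (rad x₀ X)⁻¹ * u X + dr x₀ u X) ^ 2

/-- `y^{3-2s} (|∇u|² - |∂u/∂r|²)`. -/
def tanDensity {n : ℕ} (s : ℝ) (x₀ : EuclideanSpace ℝ (Fin n)) (u : Space n → ℝ)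
    (X : Space n) : ℝ :=
  ht X ^ (3 - 2 * s) * (‖gradient u X‖ ^ 2 - |dr x₀ u X| ^ 2)

/-- The first of the three functions of the radius that are differentiated in the energy. -/
def massTerm {n : ℕ} (s p : ℝ) (x₀ : EuclideanSpace ℝ (Fin n)) (u : Space n → ℝ) (r : ℝ) : ℝ :=
  r ^ (4 * s / (p - 1) + 2 * s - 2 - (n : ℝ)) * capInt x₀ r (massDensity s u)

/-- The second of the three functions of the radius that are differentiated in the energy. -/
def homTerm {n : ℕ} (s p : ℝ) (x₀ : EuclideanSpace ℝ (Fin n)) (u : Space n → ℝ) (r : ℝ) : ℝ :=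
  r ^ (4 * s / (p - 1) + 2 * s - 3 - (n : ℝ)) * capInt x₀ r (homDensity s p x₀ u)

/-- The third of the three functions of the radius that are differentiated in the energy. -/
def tanTerm {n : ℕ} (s p : ℝ) (x₀ : EuclideanSpace ℝ (Fin n)) (u : Space n → ℝ) (r : ℝ) : ℝ :=
  r ^ (2 * s * ((p + 1) / (p - 1)) - (n : ℝ)) * capInt x₀ r (tanDensity s x₀ u)

/-- The energy `E(r, x₀, u)`; `κ` is the constant of the nonlinear boundary condition. -/
def energy {n : ℕ} (s p κ : ℝ) (r : ℝ) (x₀ : EuclideanSpace ℝ (Fin n)) (u : Space n → ℝ) : ℝ :=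
  r ^ (2 * s * ((p + 1) / (p - 1)) - (n : ℝ)) *
      ((∫ X in upperHalf n ∩ Metric.ball (pt x₀ 0) r, bulkDensity s u X)
        - κ / (p + 1) * ∫ x in Metric.ball x₀ r, traceDensity p u x)
    - s / (p - 1) * ((p + 2 * s - 1) / (p - 1) - (n : ℝ) - wexp s)
        * r ^ (-3 + 2 * s + 4 * s / (p - 1) - (n : ℝ)) * capInt x₀ r (massDensity s u)
    - s / (p - 1) * ((p + 2 * s - 1) / (p - 1) - (n : ℝ) - wexp s) * deriv (massTerm s p x₀ u) r
    + 1 / 2 * r ^ 3 * deriv (homTerm s p x₀ u) r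
    + 1 / 2 * deriv (tanTerm s p x₀ u) r
    + 1 / 2 * r ^ (2 * s * ((p + 1) / (p - 1)) - (n : ℝ) - 1) * capInt x₀ r (tanDensity s x₀ u)

/-- Every integral that occurs in `E(r, x₀, u)` converges and every derivative in it exists. -/
structure EnergyDefined {n : ℕ} (s p : ℝ) (r : ℝ) (x₀ : EuclideanSpace ℝ (Fin n))
    (u : Space n → ℝ) : Prop where
  bulk : IntegrableOn (bulkDensity s u) (upperHalf n ∩ Metric.ball (pt x₀ 0) r)
  trace : IntegrableOn (traceDensity p u) (Metric.ball x₀ r)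
  mass : CapIntegrable x₀ r (massDensity s u)
  hom : CapIntegrable x₀ r (homDensity s p x₀ u)
  tan : CapIntegrable x₀ r (tanDensity s x₀ u)
  diff_mass : DifferentiableAt ℝ (massTerm s p x₀ u) r
  diff_hom : DifferentiableAt ℝ (homTerm s p x₀ u) r
  diff_tan : DifferentiableAt ℝ (tanTerm s p x₀ u) r

end FracLaneEmden

end

/-! Put a = 2s/(p-1), D w = a w + (X - (x₀,0))·∇w and L = r²Δ_b. The operator D generates the
dilations λ^a u(λ·) that preserve the problem. It commutes with L, since L is homogeneous of degree
zero. Let ⟨f,h⟩ be r^(2a) times the integral of f h over the half-sphere of radius r, pulled back to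
the unit sphere with weight y^b (`scaledAvg`). Then r d/dr ⟨f,h⟩ = ⟨Df,h⟩ + ⟨f,Dh⟩, and the same
rule holds for the tangential Dirichlet form T (`scaledDirichlet`). Monotonicity thus becomes
bilinear algebra in u, Du, D²u, D³u.

Two identities feed the algebra. The volume part of E satisfies r d/dr = ⟨D²u,Lu⟩ + 2⟨Du,Lu⟩ -
⟨Du,LDu⟩ (`hasDerivAt_volume_energy`): this is Green's second identity for Δ_b u and Du, where Δ_b²u
= 0, Du keeps the zero Neumann datum, and the nonlinear flux matches the derivative of the trace
integral. Integration by parts on half-spheres gives, for h with zero Neumann datum, ⟨f,Lh⟩ =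
⟨f,D²h⟩ + (n+b-1-2a)⟨f,Dh⟩ - a(n+b-1-a)⟨f,h⟩ - T(f,h) (`scaledAvg_lapR`). The surface terms of E are
exactly those that cancel every term without a sign, which leaves r E' = 2⟨D²u,D²u⟩ + 2((n+b-1)(1+a)
- 2a - a²)⟨Du,Du⟩ + 2T(Du,Du). Here T(Du,Du) ≥ 0 by Cauchy-Schwarz. The middle coefficient equals
2((1+a)(n+b-a) - (1+2a)), whose positivity is the hypothesis on n, and it serves as C.

The analytic difficulty is the boundary, where only y^b∂_y is controlled. The classes `RegOne`,
`RegTwo`, `RegThree` lose one order under D, because ∂_y² can be traded for Δ_b and horizontal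
derivatives. The range -1 < b < 1 makes both y^b and y^(-b) integrable. Green's formula in
half-balls (`green_halfBall`) comes from radial cutoffs on the half-space, and its derivative in the
radius is the formula on half-spheres, so no calculus on the sphere is needed. -/

noncomputable section

namespace FracLaneEmden

variable {n : ℕ} {s : ℝ}

/-! ### The half-space -/

lemma continuous_ht : Continuous (ht : Space n → ℝ) := by
  unfold ht; fun_prop

lemma isOpen_upperHalf : IsOpen (upperHalf n) :=
  isOpen_lt continuous_const continuous_ht

lemma isClosed_closedUpperHalf : IsClosed (closedUpperHalf n) :=
  isClosed_le continuous_const continuous_ht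

lemma upperHalf_subset_closedUpperHalf : upperHalf n ⊆ closedUpperHalf n :=
  fun X (hX : 0 < ht X) => hX.le

@[simp] lemma ht_pt (x : EuclideanSpace ℝ (Fin n)) (y : ℝ) : ht (pt x y) = y := by
  simp [ht, pt]

@[simp] lemma pt_castSucc (x : EuclideanSpace ℝ (Fin n)) (y : ℝ) (i : Fin n) :
    pt x y i.castSucc = x i := by
  simp [pt]

@[simp] lemma pt_last (x : EuclideanSpace ℝ (Fin n)) (y : ℝ) :
    pt x y (Fin.last n) = y := by
  simp [pt]

lemma ht_add (X Y : Space n) : ht (X + Y) = ht X + ht Y := by simp [ht]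

lemma ht_smul (r : ℝ) (X : Space n) : ht (r • X) = r * ht X := by simp [ht]

lemma continuous_pt : Continuous fun z : EuclideanSpace ℝ (Fin n) × ℝ => pt z.1 z.2 := by
  refine (PiLp.continuous_toLp 2 _).comp (continuous_pi fun i => ?_)
  refine Fin.lastCases ?_ (fun j => ?_) i
  · simpa using continuous_snd
  · simp; fun_prop

/-- The vertical unit direction as an approach to the boundary. -/
lemma tendsto_pt_nhdsWithin (x : EuclideanSpace ℝ (Fin n)) :
    Tendsto (fun y : ℝ => pt x y) (𝓝[>] 0) (𝓝[upperHalf n] (pt x 0)) := by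
  refine tendsto_nhdsWithin_iff.2 ⟨?_, ?_⟩
  · have : Continuous fun y : ℝ => pt x y := continuous_pt.comp (continuous_const.prodMk continuous_id)
    exact (this.tendsto 0).mono_left nhdsWithin_le_nhds
  · filter_upwards [self_mem_nhdsWithin] with y hy
    simpa [upperHalf] using hy

/-! ### Continuity up to the boundary -/

namespace ContUpToBoundary

variable {f g : Space n → ℝ}

lemma of_continuousOn (h : ContinuousOn f (closedUpperHalf n)) : ContUpToBoundary f :=
  ⟨f, h, fun _ _ => rfl⟩

lemma of_continuous (h : Continuous f) : ContUpToBoundary f := of_continuousOn h.continuousOn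

lemma congr (hf : ContUpToBoundary f) (h : EqOn g f (upperHalf n)) : ContUpToBoundary g := by
  obtain ⟨F, hF, hFf⟩ := hf
  exact ⟨F, hF, hFf.trans h.symm⟩

lemma add (hf : ContUpToBoundary f) (hg : ContUpToBoundary g) :
    ContUpToBoundary fun X => f X + g X := by
  obtain ⟨F, hF, hFf⟩ := hf
  obtain ⟨G, hG, hGg⟩ := hg
  exact ⟨fun X => F X + G X, hF.add hG, fun X hX => by simp [hFf hX, hGg hX]⟩

lemma mul (hf : ContUpToBoundary f) (hg : ContUpToBoundary g) :
    ContUpToBoundary fun X => f X * g X := by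
  obtain ⟨F, hF, hFf⟩ := hf
  obtain ⟨G, hG, hGg⟩ := hg
  exact ⟨fun X => F X * G X, hF.mul hG, fun X hX => by simp [hFf hX, hGg hX]⟩

lemma const_mul (a : ℝ) (hf : ContUpToBoundary f) : ContUpToBoundary fun X => a * f X :=
  (of_continuous continuous_const).mul hf

lemma sub (hf : ContUpToBoundary f) (hg : ContUpToBoundary g) :
    ContUpToBoundary fun X => f X - g X :=
  (hf.add (hg.const_mul (-1))).congr fun X _ => by ring

lemma sum {ι : Type*} (t : Finset ι) {F : ι → Space n → ℝ}
    (hF : ∀ i ∈ t, ContUpToBoundary (F i)) : ContUpToBoundary fun X => ∑ i ∈ t, F i X := by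
  classical
  induction t using Finset.induction_on with
  | empty => simpa using of_continuous (n := n) continuous_const
  | insert a t ha ih =>
    simp only [Finset.sum_insert ha]
    exact (hF a (by simp)).add (ih fun i hi => hF i (by simp [hi]))

lemma ht_rpow {e : ℝ} (he : 0 ≤ e) : ContUpToBoundary fun X : Space n => ht X ^ e :=
  of_continuous (continuous_ht.rpow_const fun _ => Or.inr he)

lemma continuousOn (hf : ContUpToBoundary f) : ContinuousOn f (upperHalf n) := by
  obtain ⟨F, hF, hFf⟩ := hf
  exact (hF.mono upperHalf_subset_closedUpperHalf).congr hFf.symm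

/-- The extension is continuous on a compact set. This supplies the constants in the domination
arguments below. -/
lemma exists_bound (hf : ContUpToBoundary f) (c : Space n) (R : ℝ) :
    ∃ M : ℝ, 0 ≤ M ∧ ∀ X ∈ upperHalf n ∩ Metric.closedBall c R, |f X| ≤ M := by
  obtain ⟨F, hF, hFf⟩ := hf
  obtain ⟨M, hM⟩ := ((isCompact_closedBall c R).inter_left
    isClosed_closedUpperHalf).exists_bound_of_continuousOn (hF.mono inter_subset_left)
  refine ⟨max M 0, le_max_right _ _, fun X hX => ?_⟩
  rw [← hFf hX.1]
  exact (hM X ⟨upperHalf_subset_closedUpperHalf hX.1, hX.2⟩).trans (le_max_left _ _)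

end ContUpToBoundary

/-! ### Partial derivatives -/

/-- The partial derivative in the `i`-th coordinate direction, horizontal or vertical. -/
def pd (i : Fin (n + 1)) (w : Space n → ℝ) (X : Space n) : ℝ :=
  fderiv ℝ w X (EuclideanSpace.single i 1)

/-- The dilation derivative `(X - (x₀, 0)) · ∇ w`. -/
def euler (x₀ : EuclideanSpace ℝ (Fin n)) (w : Space n → ℝ) (X : Space n) : ℝ :=
  fderiv ℝ w X (X - pt x₀ 0)

lemma dx_eq_pd (i : Fin n) (w : Space n → ℝ) : dx i w = pd i.castSucc w := rfl

lemma dy_eq_pd (w : Space n → ℝ) : dy w = pd (Fin.last n) w := rfl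

lemma clm_apply_eq_sum (L : Space n →L[ℝ] ℝ) (v : Space n) :
    L v = ∑ i, v i * L (EuclideanSpace.single i 1) := by
  conv_lhs => rw [← (EuclideanSpace.basisFun (Fin (n + 1)) ℝ).sum_repr v]
  simp [map_sum]

lemma euler_eq_sum (x₀ : EuclideanSpace ℝ (Fin n)) (w : Space n → ℝ) (X : Space n) :
    euler x₀ w X = ∑ i : Fin n, (X i.castSucc - x₀ i) * dx i w X + ht X * dy w X := by
  rw [euler, clm_apply_eq_sum, Fin.sum_univ_castSucc]
  simp [dx, dy, ht]

section Calculus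

variable {f g h : Space n → ℝ} {X : Space n}

lemma eventuallyEq_of_eqOn (hfg : EqOn f g (upperHalf n)) (hX : X ∈ upperHalf n) :
    f =ᶠ[𝓝 X] g :=
  hfg.eventuallyEq_of_mem (isOpen_upperHalf.mem_nhds hX)

lemma fderiv_congr_of_eqOn (hfg : EqOn f g (upperHalf n)) (hX : X ∈ upperHalf n) :
    fderiv ℝ f X = fderiv ℝ g X :=
  (eventuallyEq_of_eqOn hfg hX).fderiv_eq

lemma pd_congr (hfg : EqOn f g (upperHalf n)) (i : Fin (n + 1)) :
    EqOn (pd i f) (pd i g) (upperHalf n) := fun X hX => by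
  simp only [pd, fderiv_congr_of_eqOn hfg hX]

lemma euler_congr (hfg : EqOn f g (upperHalf n)) (x₀ : EuclideanSpace ℝ (Fin n)) :
    EqOn (euler x₀ f) (euler x₀ g) (upperHalf n) := fun X hX => by
  simp only [euler, fderiv_congr_of_eqOn hfg hX]

lemma conormal_congr (hfg : EqOn f g (upperHalf n)) :
    EqOn (conormal s f) (conormal s g) (upperHalf n) := fun X hX => by
  simp only [conormal, dy, fderiv_congr_of_eqOn hfg hX]

lemma differentiableAt_of_contDiffOn {k : WithTop ℕ∞} (hf : ContDiffOn ℝ k f (upperHalf n))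
    (hk : k ≠ 0) (hX : X ∈ upperHalf n) : DifferentiableAt ℝ f X :=
  (hf.contDiffAt (isOpen_upperHalf.mem_nhds hX)).differentiableAt hk

lemma contDiffOn_fderiv {k l : WithTop ℕ∞} (hf : ContDiffOn ℝ l f (upperHalf n))
    (hk : k + 1 ≤ l) : ContDiffOn ℝ k (fderiv ℝ f) (upperHalf n) :=
  hf.fderiv_of_isOpen isOpen_upperHalf hk

lemma contDiffOn_pd {k l : WithTop ℕ∞} (hf : ContDiffOn ℝ l f (upperHalf n)) (hk : k + 1 ≤ l)
    (i : Fin (n + 1)) : ContDiffOn ℝ k (pd i f) (upperHalf n) :=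
  (contDiffOn_fderiv hf hk).clm_apply contDiffOn_const

lemma contDiffOn_euler {k l : WithTop ℕ∞} (hf : ContDiffOn ℝ l f (upperHalf n)) (hk : k + 1 ≤ l)
    (x₀ : EuclideanSpace ℝ (Fin n)) : ContDiffOn ℝ k (euler x₀ f) (upperHalf n) :=
  (contDiffOn_fderiv hf hk).clm_apply (contDiffOn_id.sub contDiffOn_const)

lemma contDiff_ht {k : WithTop ℕ∞} : ContDiff ℝ k (ht : Space n → ℝ) := by
  unfold ht; fun_prop

lemma contDiffOn_ht_rpow {k : WithTop ℕ∞} (e : ℝ) :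
    ContDiffOn ℝ k (fun X : Space n => ht X ^ e) (upperHalf n) :=
  contDiff_ht.contDiffOn.rpow_const_of_ne fun _ hX => ne_of_gt hX

lemma pd_pd (hf : ContDiffOn ℝ 2 f (upperHalf n)) (hX : X ∈ upperHalf n) (i j : Fin (n + 1)) :
    pd i (pd j f) X = fderiv ℝ (fderiv ℝ f) X (EuclideanSpace.single i 1)
      (EuclideanSpace.single j 1) := by
  have hd : DifferentiableAt ℝ (fderiv ℝ f) X :=
    ((contDiffOn_fderiv hf (k := 1) (by norm_num)).contDiffAt
      (isOpen_upperHalf.mem_nhds hX)).differentiableAt (by norm_num)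
  have : HasFDerivAt (pd j f) _ X := hd.hasFDerivAt.clm_apply (hasFDerivAt_const _ _)
  rw [pd, this.fderiv]
  simp

lemma second_fderiv_symm (hf : ContDiffOn ℝ 2 f (upperHalf n)) (hX : X ∈ upperHalf n)
    (v w : Space n) : fderiv ℝ (fderiv ℝ f) X v w = fderiv ℝ (fderiv ℝ f) X w v :=
  ((hf.contDiffAt (isOpen_upperHalf.mem_nhds hX)).isSymmSndFDerivAt (by simp)) v w

lemma pd_comm (hf : ContDiffOn ℝ 2 f (upperHalf n)) (i j : Fin (n + 1)) :
    EqOn (pd i (pd j f)) (pd j (pd i f)) (upperHalf n) := fun X hX => by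
  rw [pd_pd hf hX, pd_pd hf hX, second_fderiv_symm hf hX]

/-- The Jacobian of the dilation field is the identity, hence the extra `pd i f`; the rest is
symmetry of second derivatives. -/
lemma pd_euler (hf : ContDiffOn ℝ 2 f (upperHalf n)) (x₀ : EuclideanSpace ℝ (Fin n))
    (i : Fin (n + 1)) :
    EqOn (pd i (euler x₀ f)) (fun X => euler x₀ (pd i f) X + pd i f X) (upperHalf n) :=
    fun X hX => by
  have hd : DifferentiableAt ℝ (fderiv ℝ f) X :=
    ((contDiffOn_fderiv hf (k := 1) (by norm_num)).contDiffAt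
      (isOpen_upperHalf.mem_nhds hX)).differentiableAt (by norm_num)
  have h1 : HasFDerivAt (euler x₀ f) _ X :=
    hd.hasFDerivAt.clm_apply ((hasFDerivAt_id X).sub_const (pt x₀ 0))
  have h2 : HasFDerivAt (pd i f) _ X := hd.hasFDerivAt.clm_apply (hasFDerivAt_const _ _)
  rw [pd, h1.fderiv]
  simp only [euler, h2.fderiv]
  simp [pd, second_fderiv_symm hf hX (EuclideanSpace.single i 1)]
  ring

lemma pd_add (hf : DifferentiableAt ℝ f X) (hg : DifferentiableAt ℝ g X) (i : Fin (n + 1)) :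
    pd i (fun X => f X + g X) X = pd i f X + pd i g X := by
  simp [pd, fderiv_fun_add hf hg]

lemma pd_mul (hf : DifferentiableAt ℝ f X) (hg : DifferentiableAt ℝ g X) (i : Fin (n + 1)) :
    pd i (fun X => f X * g X) X = f X * pd i g X + g X * pd i f X := by
  simp [pd, fderiv_fun_mul hf hg]

lemma pd_const_mul (a : ℝ) (hf : DifferentiableAt ℝ f X) (i : Fin (n + 1)) :
    pd i (fun X => a * f X) X = a * pd i f X := by
  simp [pd, fderiv_const_mul hf a]

lemma pd_sum {ι : Type*} (t : Finset ι) {F : ι → Space n → ℝ}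
    (hF : ∀ j ∈ t, DifferentiableAt ℝ (F j) X) (i : Fin (n + 1)) :
    pd i (fun X => ∑ j ∈ t, F j X) X = ∑ j ∈ t, pd i (F j) X := by
  simp [pd, fderiv_fun_sum hF]

lemma euler_add (hf : DifferentiableAt ℝ f X) (hg : DifferentiableAt ℝ g X)
    (x₀ : EuclideanSpace ℝ (Fin n)) :
    euler x₀ (fun X => f X + g X) X = euler x₀ f X + euler x₀ g X := by
  simp [euler, fderiv_fun_add hf hg]

lemma euler_mul (hf : DifferentiableAt ℝ f X) (hg : DifferentiableAt ℝ g X)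
    (x₀ : EuclideanSpace ℝ (Fin n)) :
    euler x₀ (fun X => f X * g X) X = f X * euler x₀ g X + g X * euler x₀ f X := by
  simp [euler, fderiv_fun_mul hf hg]

lemma euler_const_mul (a : ℝ) (hf : DifferentiableAt ℝ f X) (x₀ : EuclideanSpace ℝ (Fin n)) :
    euler x₀ (fun X => a * f X) X = a * euler x₀ f X := by
  simp [euler, fderiv_const_mul hf a]

lemma euler_sum {ι : Type*} (t : Finset ι) {F : ι → Space n → ℝ}
    (hF : ∀ j ∈ t, DifferentiableAt ℝ (F j) X) (x₀ : EuclideanSpace ℝ (Fin n)) :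
    euler x₀ (fun X => ∑ j ∈ t, F j X) X = ∑ j ∈ t, euler x₀ (F j) X := by
  simp [euler, fderiv_fun_sum hF]

lemma hasFDerivAt_ht (X : Space n) :
    HasFDerivAt (ht : Space n → ℝ) (EuclideanSpace.proj (Fin.last n) : Space n →L[ℝ] ℝ) X :=
  (EuclideanSpace.proj (Fin.last n) : Space n →L[ℝ] ℝ).hasFDerivAt

lemma hasFDerivAt_ht_rpow (e : ℝ) (hX : X ∈ upperHalf n) :
    HasFDerivAt (fun X : Space n => ht X ^ e)
      ((e * ht X ^ (e - 1)) • (EuclideanSpace.proj (Fin.last n) : Space n →L[ℝ] ℝ)) X :=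
  (hasFDerivAt_ht X).rpow_const (Or.inl (ne_of_gt hX))

lemma dx_ht_rpow (e : ℝ) (hX : X ∈ upperHalf n) (i : Fin n) :
    dx i (fun X : Space n => ht X ^ e) X = 0 := by
  simp [dx, (hasFDerivAt_ht_rpow e hX).fderiv, (Fin.castSucc_lt_last i).ne']

lemma dy_ht_rpow (e : ℝ) (hX : X ∈ upperHalf n) :
    dy (fun X : Space n => ht X ^ e) X = e * ht X ^ (e - 1) := by
  simp [dy, (hasFDerivAt_ht_rpow e hX).fderiv]

lemma lapB_eq_sum (hf : ContDiffOn ℝ 2 f (upperHalf n)) :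
    EqOn (lapB s f) (fun X => ∑ i, pd i (pd i f) X + wexp s / ht X * dy f X) (upperHalf n) :=
    fun X hX => by
  simp only [lapB]
  congr 1
  rw [InnerProductSpace.laplacian_eq_iteratedFDeriv_orthonormalBasis f
    (EuclideanSpace.basisFun (Fin (n + 1)) ℝ)]
  refine Finset.sum_congr rfl fun i _ => ?_
  rw [pd_pd hf hX, iteratedFDeriv_two_apply]
  simp

lemma lapB_eq_sum' (hf : ContDiffOn ℝ 2 f (upperHalf n)) (hX : X ∈ upperHalf n) :
    lapB s f X = ∑ i : Fin n, dx i (dx i f) X + dy (dy f) X + wexp s / ht X * dy f X := by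
  rw [lapB_eq_sum hf hX]
  simp only [Fin.sum_univ_castSucc]
  rfl

end Calculus

/-! ### Commutation relations -/

/-- Δ_b is homogeneous of degree -2 under dilations about (x₀,0): the centre lies on {y = 0}, so
(b/y)∂_y scales like a second derivative. -/
lemma lapB_euler {h : Space n → ℝ} (hh : ContDiffOn ℝ 3 h (upperHalf n))
    (x₀ : EuclideanSpace ℝ (Fin n)) :
    EqOn (lapB s (euler x₀ h)) (fun X => 2 * lapB s h X + euler x₀ (lapB s h) X)
      (upperHalf n) := fun X hX => by
  have h2 : ContDiffOn ℝ 2 h (upperHalf n) := hh.of_le (by norm_num)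
  have hp : ∀ i, ContDiffOn ℝ 2 (pd i h) (upperHalf n) := fun i =>
    contDiffOn_pd hh (by norm_num) i
  have hpp : ∀ i j, ContDiffOn ℝ 1 (pd i (pd j h)) (upperHalf n) := fun i j =>
    contDiffOn_pd (hp j) (by norm_num) i
  have hd1 : ∀ i, DifferentiableAt ℝ (pd i h) X := fun i =>
    differentiableAt_of_contDiffOn (hp i) (by norm_num) hX
  have hd2 : ∀ i j, DifferentiableAt ℝ (pd i (pd j h)) X := fun i j =>
    differentiableAt_of_contDiffOn (hpp i j) (by norm_num) hX
  have hde : ∀ i, DifferentiableAt ℝ (euler x₀ (pd i h)) X := fun i =>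
    differentiableAt_of_contDiffOn (contDiffOn_euler (hp i) (k := 1) (by norm_num) x₀)
      (by norm_num) hX
  have hy : ht X ≠ 0 := ne_of_gt hX
  have hq : HasFDerivAt (fun X : Space n => wexp s / ht X)
      ((-(wexp s / ht X ^ 2)) • (EuclideanSpace.proj (Fin.last n) : Space n →L[ℝ] ℝ)) X := by
    have := ((hasDerivAt_inv hy).const_mul (wexp s)).comp_hasFDerivAt X (hasFDerivAt_ht X)
    simp only [Function.comp_def] at this
    refine this.congr_fderiv ?_
    congr 1
    field_simp
  have hqe : euler x₀ (fun X : Space n => wexp s / ht X) X = -(wexp s / ht X) := by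
    rw [euler, hq.fderiv]
    have : (EuclideanSpace.proj (Fin.last n) : Space n →L[ℝ] ℝ) (X - pt x₀ 0) = ht X := by
      simp [ht]
    simp only [smul_apply, this, smul_eq_mul]
    field_simp
  rw [lapB_eq_sum (contDiffOn_euler hh (k := 2) (by norm_num) x₀) hX]
  have e1 : ∀ i, pd i (pd i (euler x₀ h)) X
      = euler x₀ (pd i (pd i h)) X + 2 * pd i (pd i h) X := fun i => by
    rw [pd_congr (pd_euler h2 x₀ i) i hX, pd_add (hde i) (hd1 i), pd_euler (hp i) x₀ i hX]
    ring
  have e2 : dy (euler x₀ h) X = euler x₀ (dy h) X + dy h X := pd_euler h2 x₀ _ hX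
  have e3 : euler x₀ (lapB s h) X = ∑ i, euler x₀ (pd i (pd i h)) X
      + (wexp s / ht X * euler x₀ (dy h) X - dy h X * (wexp s / ht X)) := by
    rw [euler_congr (lapB_eq_sum h2) x₀ hX, euler_add, euler_sum, euler_mul, hqe]
    · ring
    · exact hq.differentiableAt
    · exact hd1 _
    · exact fun i _ => hd2 i i
    · exact DifferentiableAt.fun_sum fun i _ => hd2 i i
    · exact hq.differentiableAt.mul (hd1 _)
  simp only [e1, e2, e3, lapB_eq_sum h2 hX, Finset.sum_add_distrib, ← Finset.mul_sum]
  ring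

/-- The coefficients of Δ_b do not depend on x. -/
lemma lapB_dx {h : Space n → ℝ} (hh : ContDiffOn ℝ 3 h (upperHalf n)) (i : Fin n) :
    EqOn (lapB s (dx i h)) (dx i (lapB s h)) (upperHalf n) := fun X hX => by
  have h2 : ContDiffOn ℝ 2 h (upperHalf n) := hh.of_le (by norm_num)
  have hp : ∀ i, ContDiffOn ℝ 2 (pd i h) (upperHalf n) := fun i =>
    contDiffOn_pd hh (by norm_num) i
  have hpp : ∀ i j, ContDiffOn ℝ 1 (pd i (pd j h)) (upperHalf n) := fun i j =>
    contDiffOn_pd (hp j) (by norm_num) i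
  have hd1 : ∀ i, DifferentiableAt ℝ (pd i h) X := fun i =>
    differentiableAt_of_contDiffOn (hp i) (by norm_num) hX
  have hd2 : ∀ i j, DifferentiableAt ℝ (pd i (pd j h)) X := fun i j =>
    differentiableAt_of_contDiffOn (hpp i j) (by norm_num) hX
  have hy : ht X ≠ 0 := ne_of_gt hX
  have hq : HasFDerivAt (fun X : Space n => wexp s / ht X)
      ((-(wexp s / ht X ^ 2)) • (EuclideanSpace.proj (Fin.last n) : Space n →L[ℝ] ℝ)) X := by
    have := ((hasDerivAt_inv hy).const_mul (wexp s)).comp_hasFDerivAt X (hasFDerivAt_ht X)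
    simp only [Function.comp_def] at this
    refine this.congr_fderiv ?_
    congr 1
    field_simp
  have hqe : pd i.castSucc (fun X : Space n => wexp s / ht X) X = 0 := by
    rw [pd, hq.fderiv]
    simp [(Fin.castSucc_lt_last i).ne']
  have e1 : ∀ j, pd j (pd j (pd i.castSucc h)) X = pd i.castSucc (pd j (pd j h)) X := fun j => by
    rw [pd_congr (pd_comm h2 j i.castSucc) j hX, pd_comm (hp j) _ _ hX]
  have e2 : dy (pd i.castSucc h) X = pd i.castSucc (dy h) X := pd_comm h2 _ _ hX
  rw [dx_eq_pd, dx_eq_pd, lapB_eq_sum (hp _) hX, pd_congr (lapB_eq_sum h2) _ hX, pd_add, pd_sum,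
    pd_mul, hqe]
  · simp only [e1, e2]
    ring
  · exact hq.differentiableAt
  · exact hd1 _
  · exact fun i _ => hd2 i i
  · exact DifferentiableAt.fun_sum fun i _ => hd2 i i
  · exact hq.differentiableAt.mul (hd1 _)

lemma ht_rpow_mul_ht_rpow {X : Space n} (hX : X ∈ upperHalf n) (a b : ℝ) :
    ht X ^ a * ht X ^ b = ht X ^ (a + b) :=
  (Real.rpow_add hX a b).symm

/-- The term y^b∂_y(y∂_y h) involves ∂_y²h, which is not controlled near {y = 0}. The definition of
Δ_b trades it for Δ_b h, horizontal second derivatives and y^b∂_y h, all of which are. -/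
lemma conormal_euler {h : Space n → ℝ} (hh : ContDiffOn ℝ 2 h (upperHalf n))
    (x₀ : EuclideanSpace ℝ (Fin n)) :
    EqOn (conormal s (euler x₀ h)) (fun X => ∑ i : Fin n, (X i.castSucc - x₀ i)
        * conormal s (dx i h) X + ht X ^ (1 + wexp s) * (lapB s h X - ∑ i : Fin n, dx i (dx i h) X)
        + (1 - wexp s) * conormal s h X) (upperHalf n) := fun X hX => by
  have hy : ht X ≠ 0 := ne_of_gt hX
  have e1 : dy (euler x₀ h) X = euler x₀ (dy h) X + dy h X := pd_euler hh x₀ _ hX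
  have e2 : ∀ i : Fin n, dx i (dy h) X = dy (dx i h) X := fun i => pd_comm hh _ _ hX
  have e3 : ht X ^ (1 + wexp s) = ht X * ht X ^ wexp s := by
    rw [Real.rpow_add hX, Real.rpow_one]
  simp only [conormal, e1, euler_eq_sum, e2, lapB_eq_sum' hh hX, e3]
  have e4 : ∑ i : Fin n, (X i.castSucc - x₀ i) * (ht X ^ wexp s * dy (dx i h) X)
      = ht X ^ wexp s * ∑ i : Fin n, (X i.castSucc - x₀ i) * dy (dx i h) X := by
    rw [Finset.mul_sum]
    exact Finset.sum_congr rfl fun i _ => by ring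
  rw [e4]
  field_simp
  ring

lemma dx_euler {h : Space n → ℝ} (hh : ContDiffOn ℝ 2 h (upperHalf n))
    (x₀ : EuclideanSpace ℝ (Fin n)) (i : Fin n) :
    EqOn (dx i (euler x₀ h)) (fun X => euler x₀ (dx i h) X + dx i h X) (upperHalf n) :=
  pd_euler hh x₀ i.castSucc

/-! ### Regularity up to the boundary adapted to the weight -/

/-- `h` and its derivatives of order one, in the weighted sense, extend to the boundary. -/
structure RegOne (s : ℝ) (h : Space n → ℝ) : Prop where
  contDiff : ContDiffOn ℝ 2 h (upperHalf n)
  cont : ContUpToBoundary h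
  dx : ∀ i, ContUpToBoundary (dx i h)
  conormal : ContUpToBoundary (conormal s h)

/-- `h` and its derivatives of order two, in the weighted sense, extend to the boundary. -/
structure RegTwo (s : ℝ) (h : Space n → ℝ) : Prop where
  contDiff : ContDiffOn ℝ 3 h (upperHalf n)
  regOne : RegOne s h
  dx : ∀ i, RegOne s (dx i h)
  lap : ContUpToBoundary (lapB s h)

/-- `h` and its derivatives of order three, in the weighted sense, extend to the boundary. -/
structure RegThree (s : ℝ) (h : Space n → ℝ) : Prop where
  contDiff : ContDiffOn ℝ 4 h (upperHalf n)
  regTwo : RegTwo s h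
  dx : ∀ i, RegTwo s (dx i h)
  lap : RegOne s (lapB s h)

section Reg

variable {f h : Space n → ℝ} {x₀ : EuclideanSpace ℝ (Fin n)}

lemma dx_add_eqOn {k : WithTop ℕ∞} (hf : ContDiffOn ℝ k f (upperHalf n))
    (hh : ContDiffOn ℝ k h (upperHalf n)) (hk : k ≠ 0) (i : Fin (n + 1)) :
    EqOn (pd i fun X => f X + h X) (fun X => pd i f X + pd i h X) (upperHalf n) :=
  fun _ hX => pd_add (differentiableAt_of_contDiffOn hf hk hX)
    (differentiableAt_of_contDiffOn hh hk hX) i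

lemma dx_const_mul_eqOn {k : WithTop ℕ∞} (a : ℝ) (hf : ContDiffOn ℝ k f (upperHalf n))
    (hk : k ≠ 0) (i : Fin (n + 1)) :
    EqOn (pd i fun X => a * f X) (fun X => a * pd i f X) (upperHalf n) :=
  fun _ hX => pd_const_mul a (differentiableAt_of_contDiffOn hf hk hX) i

lemma conormal_add_eqOn {k : WithTop ℕ∞} (hf : ContDiffOn ℝ k f (upperHalf n))
    (hh : ContDiffOn ℝ k h (upperHalf n)) (hk : k ≠ 0) :
    EqOn (conormal s fun X => f X + h X) (fun X => conormal s f X + conormal s h X)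
      (upperHalf n) := fun X hX => by
  have := dx_add_eqOn hf hh hk (Fin.last n) hX
  simp only [conormal, dy_eq_pd] at this ⊢
  rw [this]; ring

lemma conormal_const_mul_eqOn {k : WithTop ℕ∞} (a : ℝ) (hf : ContDiffOn ℝ k f (upperHalf n))
    (hk : k ≠ 0) :
    EqOn (conormal s fun X => a * f X) (fun X => a * conormal s f X) (upperHalf n) :=
    fun X hX => by
  have := dx_const_mul_eqOn a hf hk (Fin.last n) hX
  simp only [conormal, dy_eq_pd] at this ⊢
  rw [this]; ring

lemma lapB_add_eqOn (hf : ContDiffOn ℝ 2 f (upperHalf n)) (hh : ContDiffOn ℝ 2 h (upperHalf n)) :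
    EqOn (lapB s fun X => f X + h X) (fun X => lapB s f X + lapB s h X) (upperHalf n) :=
    fun X hX => by
  have h1 := dx_add_eqOn hf hh (by norm_num) (Fin.last n) hX
  have h2 := (hf.contDiffAt (isOpen_upperHalf.mem_nhds hX)).laplacian_add
    (hh.contDiffAt (isOpen_upperHalf.mem_nhds hX))
  have h3 : Laplacian.laplacian (fun X => f X + h X) X
    = Laplacian.laplacian f X + Laplacian.laplacian h X := h2
  simp only [lapB, dy_eq_pd, h3] at h1 ⊢
  rw [h1]; ring

lemma lapB_const_mul_eqOn (a : ℝ) (hf : ContDiffOn ℝ 2 f (upperHalf n)) :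
    EqOn (lapB s fun X => a * f X) (fun X => a * lapB s f X) (upperHalf n) :=
    fun X hX => by
  have h1 := dx_const_mul_eqOn a hf (by norm_num) (Fin.last n) hX
  have h2 := InnerProductSpace.laplacian_smul a (hf.contDiffAt (isOpen_upperHalf.mem_nhds hX))
  have h3 : Laplacian.laplacian (fun X => a * f X) X = a * Laplacian.laplacian f X := h2
  simp only [lapB, dy_eq_pd, h3] at h1 ⊢
  rw [h1]; ring

namespace RegOne

lemma congr (hf : RegOne s f) (hfh : EqOn h f (upperHalf n)) : RegOne s h where
  contDiff := hf.contDiff.congr hfh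
  cont := hf.cont.congr hfh
  dx i := (hf.dx i).congr (pd_congr hfh i.castSucc)
  conormal := hf.conormal.congr (conormal_congr hfh)

lemma add (hf : RegOne s f) (hh : RegOne s h) : RegOne s fun X => f X + h X where
  contDiff := hf.contDiff.add hh.contDiff
  cont := hf.cont.add hh.cont
  dx i := ((hf.dx i).add (hh.dx i)).congr
    (dx_add_eqOn hf.contDiff hh.contDiff (by norm_num) i.castSucc)
  conormal := (hf.conormal.add hh.conormal).congr
    (conormal_add_eqOn hf.contDiff hh.contDiff (by norm_num))

lemma const_mul (a : ℝ) (hf : RegOne s f) : RegOne s fun X => a * f X where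
  contDiff := contDiffOn_const.mul hf.contDiff
  cont := hf.cont.const_mul a
  dx i := ((hf.dx i).const_mul a).congr
    (dx_const_mul_eqOn a hf.contDiff (by norm_num) i.castSucc)
  conormal := (hf.conormal.const_mul a).congr
    (conormal_const_mul_eqOn a hf.contDiff (by norm_num))

lemma mul (hf : RegOne s f) (hh : RegOne s h) : RegOne s fun X => f X * h X where
  contDiff := hf.contDiff.mul hh.contDiff
  cont := hf.cont.mul hh.cont
  dx i := ((hf.cont.mul (hh.dx i)).add (hh.cont.mul (hf.dx i))).congr fun _ hX =>
    pd_mul (differentiableAt_of_contDiffOn hf.contDiff (by norm_num) hX)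
      (differentiableAt_of_contDiffOn hh.contDiff (by norm_num) hX) i.castSucc
  conormal := ((hf.cont.mul hh.conormal).add (hh.cont.mul hf.conormal)).congr fun X hX => by
    have := pd_mul (differentiableAt_of_contDiffOn hf.contDiff (by norm_num) hX)
      (differentiableAt_of_contDiffOn hh.contDiff (by norm_num) hX) (Fin.last n)
    simp only [FracLaneEmden.conormal, dy_eq_pd, this]
    ring

/-- The vertical part is y∂_y f = y^(1-b) · y^b∂_y f, with a nonnegative exponent 1-b. -/
lemma euler_cont (hs : wexp s ≤ 1) (hf : RegOne s f) (x₀ : EuclideanSpace ℝ (Fin n)) :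
    ContUpToBoundary (euler x₀ f) := by
  have h1 : ContUpToBoundary fun X => ∑ i : Fin n, (X i.castSucc - x₀ i) * FracLaneEmden.dx i f X
      + ht X ^ (1 - wexp s) * FracLaneEmden.conormal s f X :=
    (ContUpToBoundary.sum _ fun i _ =>
      (ContUpToBoundary.of_continuous (by fun_prop)).mul (hf.dx i)).add
      ((ContUpToBoundary.ht_rpow (by linarith)).mul hf.conormal)
  refine h1.congr fun X hX => ?_
  simp only [euler_eq_sum, FracLaneEmden.conormal]
  rw [← mul_assoc, ht_rpow_mul_ht_rpow hX]
  simp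

end RegOne

namespace RegTwo

lemma add (hf : RegTwo s f) (hh : RegTwo s h) : RegTwo s fun X => f X + h X where
  contDiff := hf.contDiff.add hh.contDiff
  regOne := hf.regOne.add hh.regOne
  dx i := ((hf.dx i).add (hh.dx i)).congr
    (dx_add_eqOn hf.contDiff hh.contDiff (by norm_num) i.castSucc)
  lap := (hf.lap.add hh.lap).congr (lapB_add_eqOn hf.regOne.contDiff hh.regOne.contDiff)

lemma const_mul (a : ℝ) (hf : RegTwo s f) : RegTwo s fun X => a * f X where
  contDiff := contDiffOn_const.mul hf.contDiff
  regOne := hf.regOne.const_mul a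
  dx i := ((hf.dx i).const_mul a).congr
    (dx_const_mul_eqOn a hf.contDiff (by norm_num) i.castSucc)
  lap := (hf.lap.const_mul a).congr (lapB_const_mul_eqOn a hf.regOne.contDiff)

lemma euler (hs₁ : -1 ≤ wexp s) (hs₂ : wexp s ≤ 1) (hf : RegTwo s f)
    (x₀ : EuclideanSpace ℝ (Fin n)) : RegOne s (euler x₀ f) where
  contDiff := contDiffOn_euler hf.contDiff (by norm_num) x₀
  cont := hf.regOne.euler_cont hs₂ x₀
  dx i := (((hf.dx i).euler_cont hs₂ x₀).add (hf.dx i).cont).congr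
    (dx_euler hf.regOne.contDiff x₀ i)
  conormal := by
    refine ContUpToBoundary.congr ?_ (conormal_euler hf.regOne.contDiff x₀)
    refine ((ContUpToBoundary.sum _ fun i _ => ?_).add ?_).add (hf.regOne.conormal.const_mul _)
    · exact (ContUpToBoundary.of_continuous (by fun_prop)).mul (hf.dx i).conormal
    · exact (ContUpToBoundary.ht_rpow (by linarith)).mul
        (hf.lap.sub (ContUpToBoundary.sum _ fun i _ => (hf.dx i).dx i))

end RegTwo

/-- Each dilation derivative costs one order. Starting from `RegThree`, three of them are available,
the third being merely continuous up to the boundary; the energy derivative uses all three. -/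
lemma RegThree.euler (hs₁ : -1 ≤ wexp s) (hs₂ : wexp s ≤ 1) (hf : RegThree s f)
    (x₀ : EuclideanSpace ℝ (Fin n)) : RegTwo s (euler x₀ f) where
  contDiff := contDiffOn_euler hf.contDiff (by norm_num) x₀
  regOne := hf.regTwo.euler hs₁ hs₂ x₀
  dx i := (((hf.dx i).euler hs₁ hs₂ x₀).add (hf.dx i).regOne).congr
    (dx_euler hf.regTwo.regOne.contDiff x₀ i)
  lap := ((hf.regTwo.lap.const_mul 2).add (hf.lap.euler_cont hs₂ x₀)).congr
    (lapB_euler hf.regTwo.contDiff x₀)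

lemma contDiffOn_lapB {k l : WithTop ℕ∞} (hf : ContDiffOn ℝ l f (upperHalf n))
    (hk : k + 1 + 1 ≤ l) (h2 : 2 ≤ l) : ContDiffOn ℝ k (lapB s f) (upperHalf n) := by
  have hp : ∀ i, ContDiffOn ℝ (k + 1) (pd i f) (upperHalf n) := fun i => contDiffOn_pd hf hk i
  refine ContDiffOn.congr ?_ (lapB_eq_sum (hf.of_le h2))
  refine (ContDiffOn.sum fun i _ => contDiffOn_pd (hp i) le_rfl i).add ?_
  exact (contDiffOn_const.div contDiff_ht.contDiffOn fun X hX => ne_of_gt hX).mul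
    ((hp (Fin.last n)).of_le le_self_add)

end Reg

lemma IsExtensionSolution.regThree {p κ : ℝ} {u : Space n → ℝ}
    (hu : IsExtensionSolution n s p κ u) : RegThree s u := by
  have hc : ∀ i, ContDiffOn ℝ 3 (dx i u) (upperHalf n) := fun i =>
    contDiffOn_pd hu.contDiff (by norm_num) i.castSucc
  have hcc : ∀ i j, ContDiffOn ℝ 2 (dx i (dx j u)) (upperHalf n) := fun i j =>
    contDiffOn_pd (hc j) (by norm_num) i.castSucc
  have h1 : RegOne s u := ⟨hu.contDiff.of_le (by norm_num), hu.reg_dx [] (by simp),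
    fun i => hu.reg_dx [i] (by simp), hu.reg_conormal_dx [] (by simp)⟩
  have h1' : ∀ i, RegOne s (dx i u) := fun i => ⟨(hc i).of_le (by norm_num),
    hu.reg_dx [i] (by simp), fun j => hu.reg_dx [j, i] (by simp),
    hu.reg_conormal_dx [i] (by simp)⟩
  have h1'' : ∀ i j, RegOne s (dx j (dx i u)) := fun i j => ⟨hcc j i,
    hu.reg_dx [j, i] (by simp), fun k => hu.reg_dx [k, j, i] (by simp),
    hu.reg_conormal_dx [j, i] (by simp)⟩
  have h2 : RegTwo s u := ⟨hu.contDiff.of_le (by norm_num), h1, h1', hu.reg_lap_dx [] (by simp)⟩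
  exact ⟨hu.contDiff, h2, fun i => ⟨hc i, h1' i, h1'' i, (hu.reg_lap_dx [i] (by simp)).congr
    (lapB_dx (hu.contDiff.of_le (by norm_num)) i)⟩,
    contDiffOn_lapB hu.contDiff (by norm_num) (by norm_num), hu.reg_lap_dx [] (by simp),
    fun i => hu.reg_lap_dx [i] (by simp), hu.reg_conormal_lap⟩

/-! ### Polar coordinates -/

section Polar

variable {E : Type*} [NormedAddCommGroup E] [NormedSpace ℝ E] [FiniteDimensional ℝ E]
  [Nontrivial E] [MeasurableSpace E] [BorelSpace E] (μ : Measure E) [μ.IsAddHaarMeasure]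

/-- The origin is a null set, and its complement is measurably the product of the sphere and (0,∞);
a translation moves the centre to c. -/
lemma integrable_polar {F : E → ℝ} (hF : Integrable F μ) (c : E) :
    Integrable (fun z : Metric.sphere (0 : E) 1 × Ioi (0 : ℝ) => F (c + z.2.1 • (z.1 : E)))
      (μ.toSphere.prod (Measure.volumeIoiPow (Module.finrank ℝ E - 1))) := by
  have h1 : Integrable (fun x => F (c + x)) μ := hF.comp_add_left c
  have h2 := (μ.measurePreserving_homeomorphUnitSphereProd.integrable_comp_emb
    (Homeomorph.measurableEmbedding _) (g := fun z => F (c + z.2.1 • (z.1 : E)))).1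
  refine h2 ?_
  rw [← restrict_compl_singleton (μ := μ) 0, ← IntegrableOn,
    integrableOn_iff_comap_subtypeVal (measurableSet_singleton _).compl] at h1
  refine (integrable_congr (Eventually.of_forall fun x => ?_)).1 h1
  have : ‖(x : E)‖ ≠ 0 := norm_ne_zero_iff.2 x.2
  simp [homeomorphUnitSphereProd_apply_snd_coe, homeomorphUnitSphereProd_apply_fst_coe, smul_smul,
    this]

lemma ae_integrable_sphere {F : E → ℝ} (hF : Integrable F μ) (c : E) :
    ∀ᵐ ρ ∂(volume.restrict (Ioi (0 : ℝ))),
      Integrable (fun ω : Metric.sphere (0 : E) 1 => F (c + ρ • (ω : E))) μ.toSphere := by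
  have h := (integrable_polar μ hF c).prod_left_ae
  rw [Measure.volumeIoiPow, ae_withDensity_iff (by fun_prop)] at h
  rw [ae_restrict_iff_subtype measurableSet_Ioi]
  filter_upwards [h] with ρ hρ
  exact hρ (by simpa using pow_pos ρ.2 _)

lemma integrableOn_integral_sphere {F : E → ℝ} (hF : Integrable F μ) (c : E) :
    IntegrableOn (fun ρ : ℝ => ρ ^ (Module.finrank ℝ E - 1)
      * ∫ ω : Metric.sphere (0 : E) 1, F (c + ρ • (ω : E)) ∂μ.toSphere) (Ioi 0) := by
  have h := (integrable_polar μ hF c).integral_prod_right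
  rw [Measure.volumeIoiPow, integrable_withDensity_iff_integrable_smul' (by fun_prop)
    (by simp)] at h
  rw [integrableOn_iff_comap_subtypeVal measurableSet_Ioi]
  refine (integrable_congr (Eventually.of_forall fun ρ => ?_)).1 h
  simp [ENNReal.toReal_ofReal (pow_nonneg (le_of_lt ρ.2) _)]

lemma integral_polar {F : E → ℝ} (hF : Integrable F μ) (c : E) :
    ∫ x, F x ∂μ = ∫ ρ in Ioi (0 : ℝ), ρ ^ (Module.finrank ℝ E - 1)
      * ∫ ω : Metric.sphere (0 : E) 1, F (c + ρ • (ω : E)) ∂μ.toSphere := by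
  rw [← integral_subtype_comap measurableSet_Ioi (fun ρ : ℝ => ρ ^ (Module.finrank ℝ E - 1)
      * ∫ ω : Metric.sphere (0 : E) 1, F (c + ρ • (ω : E)) ∂μ.toSphere)]
  have h := integral_prod_symm _ (integrable_polar μ hF c)
  rw [Measure.volumeIoiPow, integral_withDensity_eq_integral_toReal_smul (by fun_prop)
    (by simp)] at h
  have e1 : ∀ ρ : Ioi (0 : ℝ), (ENNReal.ofReal (ρ.1 ^ (Module.finrank ℝ E - 1))).toReal
      = ρ.1 ^ (Module.finrank ℝ E - 1) := fun ρ =>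
    ENNReal.toReal_ofReal (pow_nonneg (le_of_lt ρ.2) _)
  simp only [e1, smul_eq_mul] at h
  rw [← h, ← Measure.volumeIoiPow, ← μ.measurePreserving_homeomorphUnitSphereProd.integral_comp
    (Homeomorph.measurableEmbedding _), ← integral_add_left_eq_self F c]
  have h' := integral_subtype_comap (μ := μ) (measurableSet_singleton (0 : E)).compl
    fun x => F (c + x)
  rw [restrict_compl_singleton] at h'
  rw [← h']
  refine integral_congr_ae (Eventually.of_forall fun x => ?_)
  have : ‖(x : E)‖ ≠ 0 := norm_ne_zero_iff.2 x.2
  simp [homeomorphUnitSphereProd_apply_snd_coe, homeomorphUnitSphereProd_apply_fst_coe, smul_smul,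
    this]

end Polar

lemma add_smul_mem_upperHalf (x₀ : EuclideanSpace ℝ (Fin n)) {r : ℝ} (hr : 0 < r) (X : Space n) :
    pt x₀ 0 + r • X ∈ upperHalf n ↔ 0 < ht X := by
  simp [upperHalf, ht_add, ht_smul, hr]

lemma isOpen_upperSphere : IsOpen (upperSphere n) :=
  isOpen_lt continuous_const (continuous_ht.comp continuous_subtype_val)

lemma capInt_congr {x₀ : EuclideanSpace ℝ (Fin n)} {r : ℝ} (hr : 0 < r) {f g : Space n → ℝ}
    (h : EqOn f g (upperHalf n)) : capInt x₀ r f = capInt x₀ r g := by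
  unfold capInt
  congr 1
  exact setIntegral_congr_fun isOpen_upperSphere.measurableSet fun ω hω =>
    h ((add_smul_mem_upperHalf x₀ hr _).2 hω)

lemma capIntegrable_congr {x₀ : EuclideanSpace ℝ (Fin n)} {r : ℝ} (hr : 0 < r)
    {f g : Space n → ℝ} (h : EqOn f g (upperHalf n)) :
    CapIntegrable x₀ r f ↔ CapIntegrable x₀ r g :=
  integrableOn_congr_fun (fun _ hω => h ((add_smul_mem_upperHalf x₀ hr _).2 hω))
    isOpen_upperSphere.measurableSet

lemma integral_sphere_indicator (x₀ : EuclideanSpace ℝ (Fin n)) {r : ℝ} (hr : 0 < r)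
    (F : Space n → ℝ) :
    r ^ n * ∫ ω : Metric.sphere (0 : Space n) 1,
      (upperHalf n).indicator F (pt x₀ 0 + r • (ω : Space n)) ∂(volume : Measure (Space n)).toSphere
      = capInt x₀ r F := by
  unfold capInt
  rw [← integral_indicator isOpen_upperSphere.measurableSet]
  congr 2
  ext ω
  by_cases h : 0 < ht (ω : Space n)
  · rw [indicator_of_mem ((add_smul_mem_upperHalf x₀ hr _).2 h), indicator_of_mem (by exact h)]
  · rw [indicator_of_notMem (fun h' => h ((add_smul_mem_upperHalf x₀ hr _).1 h')),
      indicator_of_notMem (by exact h)]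

lemma integrableOn_capInt {F : Space n → ℝ} (hF : IntegrableOn F (upperHalf n))
    (x₀ : EuclideanSpace ℝ (Fin n)) : IntegrableOn (fun ρ => capInt x₀ ρ F) (Ioi 0) := by
  have h := integrableOn_integral_sphere volume
    ((integrable_indicator_iff isOpen_upperHalf.measurableSet).2 hF) (pt x₀ 0)
  refine (integrableOn_congr_fun (fun ρ hρ => ?_) measurableSet_Ioi).1 h
  simpa using integral_sphere_indicator x₀ hρ F

lemma setIntegral_eq_integral_capInt {F : Space n → ℝ} (hF : IntegrableOn F (upperHalf n))
    (x₀ : EuclideanSpace ℝ (Fin n)) :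
    ∫ X in upperHalf n, F X = ∫ ρ in Ioi (0 : ℝ), capInt x₀ ρ F := by
  rw [← integral_indicator isOpen_upperHalf.measurableSet, integral_polar volume
    ((integrable_indicator_iff isOpen_upperHalf.measurableSet).2 hF) (pt x₀ 0)]
  refine setIntegral_congr_fun measurableSet_Ioi fun ρ hρ => ?_
  simpa using integral_sphere_indicator x₀ hρ F

lemma rad_add_smul (x₀ : EuclideanSpace ℝ (Fin n)) {r : ℝ} (hr : 0 < r)
    (ω : Metric.sphere (0 : Space n) 1) : rad x₀ (pt x₀ 0 + r • (ω : Space n)) = r := by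
  simp [rad, norm_smul, abs_of_pos hr]

lemma capInt_mul_rad (x₀ : EuclideanSpace ℝ (Fin n)) {r : ℝ} (hr : 0 < r) (k : ℝ → ℝ)
    (F : Space n → ℝ) : capInt x₀ r (fun X => k (rad x₀ X) * F X) = k r * capInt x₀ r F := by
  simp only [capInt, rad_add_smul x₀ hr]
  rw [integral_const_mul]
  ring

/-- The indicator of the ball depends on the radius alone, so it leaves the spherical integral and
the global polar formula applies. The first component provides the integrability needed to
differentiate in r. -/
lemma setIntegral_ball_eq_integral_capInt {F : Space n → ℝ} {x₀ : EuclideanSpace ℝ (Fin n)}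
    {r : ℝ} (hr : 0 < r) (hF : IntegrableOn F (upperHalf n ∩ Metric.ball (pt x₀ 0) r)) :
    IntegrableOn (fun ρ => capInt x₀ ρ F) (Ioo 0 r) ∧
    ∫ X in upperHalf n ∩ Metric.ball (pt x₀ 0) r, F X = ∫ ρ in (0 : ℝ)..r, capInt x₀ ρ F := by
  have e1 : ∀ X, (Metric.ball (pt x₀ 0) r).indicator F X
      = (Iio r).indicator (fun _ => (1 : ℝ)) (rad x₀ X) * F X := fun X => by
    by_cases h : X ∈ Metric.ball (pt x₀ 0) r
    · have h' : rad x₀ X ∈ Iio r := by simpa [rad, dist_eq_norm] using h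
      rw [indicator_of_mem h, indicator_of_mem h', one_mul]
    · have h' : rad x₀ X ∉ Iio r := by simpa [rad, dist_eq_norm] using h
      rw [indicator_of_notMem h, indicator_of_notMem h', zero_mul]
  have h1 : IntegrableOn ((Metric.ball (pt x₀ 0) r).indicator F) (upperHalf n) := by
    rw [IntegrableOn, integrable_indicator_iff Metric.isOpen_ball.measurableSet, IntegrableOn,
      Measure.restrict_restrict Metric.isOpen_ball.measurableSet, inter_comm]
    exact hF
  have e2 : ∀ ρ ∈ Ioi (0 : ℝ), capInt x₀ ρ ((Metric.ball (pt x₀ 0) r).indicator F)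
      = (Iio r).indicator (fun ρ => capInt x₀ ρ F) ρ := fun ρ hρ => by
    rw [funext e1, capInt_mul_rad x₀ hρ]
    by_cases h : ρ ∈ Iio r
    · rw [indicator_of_mem h, indicator_of_mem h, one_mul]
    · rw [indicator_of_notMem h, indicator_of_notMem h, zero_mul]
  have e3 : Iio r ∩ Ioi (0 : ℝ) = Ioo 0 r := by
    ext; simp [and_comm]
  constructor
  · have h2 := integrableOn_capInt h1 x₀
    rw [integrableOn_congr_fun e2 measurableSet_Ioi, IntegrableOn,
      integrable_indicator_iff measurableSet_Iio, IntegrableOn,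
      Measure.restrict_restrict measurableSet_Iio, e3] at h2
    exact h2
  · have h2 := setIntegral_eq_integral_capInt h1 x₀
    rw [setIntegral_indicator Metric.isOpen_ball.measurableSet,
      setIntegral_congr_fun measurableSet_Ioi e2, setIntegral_indicator measurableSet_Iio,
      inter_comm (Ioi 0), e3] at h2
    rw [h2, intervalIntegral.integral_of_le hr.le, integral_Ioc_eq_integral_Ioo]

/-! ### Integrability of the weight -/

/-- The half-ball lies in a box on which the weight is a product of one-variable functions. Only the
vertical factor is not constant, and y^e is integrable at 0. -/
lemma integrableOn_ht_rpow {e : ℝ} (he : -1 < e) (c : Space n) (R : ℝ) :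
    IntegrableOn (fun X => ht X ^ e) (upperHalf n ∩ Metric.ball c R) := by
  -- M bounds every coordinate on the ball; the maximum with 1 keeps it positive for every R.
  set M : ℝ := max 1 (‖c‖ + R) with hM
  have hM0 : 0 < M := lt_of_lt_of_le one_pos (le_max_left _ _)
  let f : Fin (n + 1) → ℝ → ℝ := fun i =>
    if i = Fin.last n then (Ioc 0 M).indicator (fun y => y ^ e)
    else (Icc (-M) M).indicator (fun _ => 1)
  have hf : ∀ i, Integrable (f i) := fun i => by
    by_cases hi : i = Fin.last n
    · simp only [f, if_pos hi]
      rw [integrable_indicator_iff measurableSet_Ioc, ← intervalIntegrable_iff_integrableOn_Ioc_of_le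
        hM0.le]
      exact intervalIntegral.intervalIntegrable_rpow' he
    · simp only [f, if_neg hi]
      rw [integrable_indicator_iff measurableSet_Icc]
      exact integrableOn_const (by simp)
  have h1 : Integrable (fun x : Fin (n + 1) → ℝ => ∏ i, f i (x i)) := Integrable.fintype_prod hf
  have h2 : Integrable (fun X : Space n => ∏ i, f i (X i)) :=
    ((PiLp.volume_preserving_ofLp (Fin (n + 1))).integrable_comp_emb
      (MeasurableEquiv.toLp 2 _).symm.measurableEmbedding).2 h1
  refine (h2.integrableOn (s := upperHalf n ∩ Metric.ball c R)).congr_fun (fun X hX => ?_)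
    (isOpen_upperHalf.inter Metric.isOpen_ball).measurableSet
  have hXM : ‖X‖ ≤ M := by
    have h3 : ‖X - c‖ < R := by simpa [dist_eq_norm] using hX.2
    have h4 : ‖X‖ ≤ ‖X - c‖ + ‖c‖ := by simpa using norm_add_le (X - c) c
    exact le_trans (by linarith) (le_max_right _ _)
  have hXi : ∀ i, |X i| ≤ M := fun i => (PiLp.norm_apply_le X i).trans hXM
  have hlast : f (Fin.last n) (X (Fin.last n)) = ht X ^ e := by
    simp only [f, if_true]
    rw [indicator_of_mem]
    · rfl
    · exact ⟨hX.1, (le_abs_self _).trans (hXi _)⟩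
  have hother : ∀ i : Fin n, f i.castSucc (X i.castSucc) = 1 := fun i => by
    simp only [f, if_neg (Fin.castSucc_lt_last i).ne]
    rw [indicator_of_mem]
    exact abs_le.1 (hXi _)
  simp only [Fin.prod_univ_castSucc]
  rw [hlast, Finset.prod_congr rfl fun i _ => hother i]
  simp

lemma integrableOn_ht_rpow_mul {e : ℝ} (he : -1 < e) (c : Space n) (R : ℝ) {k : Space n → ℝ}
    (hk : ContUpToBoundary k) :
    IntegrableOn (fun X => ht X ^ e * k X) (upperHalf n ∩ Metric.ball c R) := by
  obtain ⟨M, -, hM⟩ := hk.exists_bound c R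
  have hms := (isOpen_upperHalf.inter (Metric.isOpen_ball (x := c) (ε := R))).measurableSet
  refine Integrable.mul_bdd (c := M) (integrableOn_ht_rpow he c R) ?_ ?_
  · exact (hk.continuousOn.mono inter_subset_left).aestronglyMeasurable hms
  · filter_upwards [ae_restrict_mem hms] with X hX
    exact hM X ⟨hX.1, Metric.ball_subset_closedBall hX.2⟩

/-- The weight is integrable on a solid half-ball, so by Fubini in polar coordinates it is
integrable on some half-sphere of radius ρ; homogeneity carries this to radius one. -/
lemma integrableOn_sphere_ht_rpow {e : ℝ} (he : -1 < e) :
    IntegrableOn (fun ω : Metric.sphere (0 : Space n) 1 => ht (ω : Space n) ^ e) (upperSphere n)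
      (volume : Measure (Space n)).toSphere := by
  have h0 := (integrable_indicator_iff
    (isOpen_upperHalf.inter (Metric.isOpen_ball (x := (pt 0 0 : Space n)) (ε := 2))).measurableSet).2
    (integrableOn_ht_rpow (n := n) he (pt 0 0) 2)
  have h1 := ae_integrable_sphere volume h0 (pt 0 0)
  have h2 : ∃ ρ ∈ Ioo (0 : ℝ) 2, Integrable (fun ω : Metric.sphere (0 : Space n) 1 =>
      (upperHalf n ∩ Metric.ball (pt 0 0) 2).indicator (fun X => ht X ^ e)
        (pt 0 0 + ρ • (ω : Space n))) (volume : Measure (Space n)).toSphere := by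
    have h3 := ae_restrict_of_ae_restrict_of_subset (fun x (hx : x ∈ Ioo (0 : ℝ) 2) => hx.1) h1
    have : NeZero (volume.restrict (Ioo (0 : ℝ) 2)) := ⟨by simp⟩
    obtain ⟨ρ, hρ, hρ'⟩ := (h3.and (ae_restrict_mem measurableSet_Ioo)).exists
    exact ⟨ρ, hρ', hρ⟩
  obtain ⟨ρ, hρ, h3⟩ := h2
  have h4 := (h3.integrableOn (s := upperSphere n)).const_mul (ρ ^ e)⁻¹
  refine IntegrableOn.congr_fun h4 (fun ω hω => ?_) isOpen_upperSphere.measurableSet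
  have hm : pt 0 0 + ρ • (ω : Space n) ∈ upperHalf n ∩ Metric.ball (pt 0 0) 2 :=
    ⟨(add_smul_mem_upperHalf 0 hρ.1 _).2 hω, by
      simp [norm_smul, abs_of_pos hρ.1, hρ.2]⟩
  have hω' : 0 < ht (ω : Space n) := hω
  simp only [indicator_of_mem hm, ht_add, ht_smul, ht_pt, zero_add]
  rw [Real.mul_rpow hρ.1.le hω'.le, inv_mul_cancel_left₀ (Real.rpow_pos_of_pos hρ.1 _).ne']

/-! ### Weighted averages over half-spheres -/

/-- The integral of `k` over the half-sphere of radius `r`, pulled back to the unit sphere and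
weighted by the power `e` of the height there. -/
def capAvg (e : ℝ) (x₀ : EuclideanSpace ℝ (Fin n)) (r : ℝ) (k : Space n → ℝ) : ℝ :=
  ∫ ω in upperSphere n, ht (ω : Space n) ^ e * k (pt x₀ 0 + r • (ω : Space n))
    ∂(volume : Measure (Space n)).toSphere

section Avg

variable {e r : ℝ} {x₀ : EuclideanSpace ℝ (Fin n)} {k l : Space n → ℝ}

lemma add_smul_mem_inter (x₀ : EuclideanSpace ℝ (Fin n)) {R : ℝ} (hr : 0 < r) (hrR : r ≤ R)
    {ω : Metric.sphere (0 : Space n) 1} (hω : ω ∈ upperSphere n) :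
    pt x₀ 0 + r • (ω : Space n) ∈ upperHalf n ∩ Metric.closedBall (pt x₀ 0) R :=
  ⟨(add_smul_mem_upperHalf x₀ hr _).2 hω, by simp [norm_smul, abs_of_pos hr, hrR]⟩

lemma continuousOn_comp_sphere (hk : ContinuousOn k (upperHalf n))
    (x₀ : EuclideanSpace ℝ (Fin n)) (hr : 0 < r) :
    ContinuousOn (fun ω : Metric.sphere (0 : Space n) 1 => k (pt x₀ 0 + r • (ω : Space n)))
      (upperSphere n) :=
  hk.comp (by fun_prop) fun ω hω => (add_smul_mem_upperHalf x₀ hr _).2 hω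

lemma aestronglyMeasurable_weight_mul (e : ℝ) (hk : ContinuousOn k (upperHalf n))
    (x₀ : EuclideanSpace ℝ (Fin n)) (hr : 0 < r) :
    AEStronglyMeasurable (fun ω : Metric.sphere (0 : Space n) 1 =>
      ht (ω : Space n) ^ e * k (pt x₀ 0 + r • (ω : Space n)))
      ((volume : Measure (Space n)).toSphere.restrict (upperSphere n)) := by
  refine ContinuousOn.aestronglyMeasurable ?_ isOpen_upperSphere.measurableSet
  refine ContinuousOn.mul ?_ (continuousOn_comp_sphere hk x₀ hr)
  exact ((continuous_ht.comp continuous_subtype_val).continuousOn).rpow_const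
    fun ω hω => Or.inl (ne_of_gt hω)

lemma integrableOn_weight_mul (he : -1 < e) (hk : ContUpToBoundary k)
    (x₀ : EuclideanSpace ℝ (Fin n)) (hr : 0 < r) :
    IntegrableOn (fun ω : Metric.sphere (0 : Space n) 1 =>
      ht (ω : Space n) ^ e * k (pt x₀ 0 + r • (ω : Space n))) (upperSphere n)
      (volume : Measure (Space n)).toSphere := by
  obtain ⟨M, -, hM⟩ := hk.exists_bound (pt x₀ 0) r
  refine Integrable.mul_bdd (c := M) (integrableOn_sphere_ht_rpow he) ?_ ?_
  · exact (continuousOn_comp_sphere hk.continuousOn x₀ hr).aestronglyMeasurable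
      isOpen_upperSphere.measurableSet
  · filter_upwards [ae_restrict_mem isOpen_upperSphere.measurableSet] with ω hω
    exact hM _ (add_smul_mem_inter x₀ hr le_rfl hω)

lemma weight_add_smul (e : ℝ) (x₀ : EuclideanSpace ℝ (Fin n)) (hr : 0 < r)
    {ω : Metric.sphere (0 : Space n) 1} (hω : ω ∈ upperSphere n) :
    ht (pt x₀ 0 + r • (ω : Space n)) ^ e = r ^ e * ht (ω : Space n) ^ e := by
  simp only [ht_add, ht_pt, ht_smul, zero_add]
  exact Real.mul_rpow hr.le (le_of_lt hω)

lemma capIntegrable_weight_mul (he : -1 < e) (hk : ContUpToBoundary k)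
    (x₀ : EuclideanSpace ℝ (Fin n)) (hr : 0 < r) :
    CapIntegrable x₀ r fun X => ht X ^ e * k X := by
  refine IntegrableOn.congr_fun ((integrableOn_weight_mul he hk x₀ hr).const_mul (r ^ e))
    (fun ω hω => ?_) isOpen_upperSphere.measurableSet
  simp only [weight_add_smul e x₀ hr hω]
  ring

lemma capInt_weight_mul (e : ℝ) (x₀ : EuclideanSpace ℝ (Fin n)) (hr : 0 < r) (k : Space n → ℝ) :
    capInt x₀ r (fun X => ht X ^ e * k X) = r ^ ((n : ℝ) + e) * capAvg e x₀ r k := by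
  rw [Real.rpow_add hr, Real.rpow_natCast, mul_assoc]
  unfold capInt capAvg
  rw [← integral_const_mul (r ^ e)]
  congr 1
  refine setIntegral_congr_fun isOpen_upperSphere.measurableSet fun ω hω => ?_
  simp only [weight_add_smul e x₀ hr hω]
  ring

lemma capAvg_congr (hr : 0 < r) (h : EqOn k l (upperHalf n)) :
    capAvg e x₀ r k = capAvg e x₀ r l :=
  setIntegral_congr_fun isOpen_upperSphere.measurableSet fun ω hω => by
    simp only [h ((add_smul_mem_upperHalf x₀ hr _).2 hω)]

lemma capAvg_add (he : -1 < e) (hr : 0 < r) (hk : ContUpToBoundary k) (hl : ContUpToBoundary l) :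
    capAvg e x₀ r (fun X => k X + l X) = capAvg e x₀ r k + capAvg e x₀ r l := by
  unfold capAvg
  rw [← integral_add (integrableOn_weight_mul he hk x₀ hr) (integrableOn_weight_mul he hl x₀ hr)]
  simp only [mul_add]

lemma capAvg_const_mul (a : ℝ) : capAvg e x₀ r (fun X => a * k X) = a * capAvg e x₀ r k := by
  unfold capAvg
  rw [← integral_const_mul]
  congr 1
  ext ω
  ring

lemma capAvg_mul_rad_sq (hr : 0 < r) :
    capAvg e x₀ r (fun X => rad x₀ X ^ 2 * k X) = r ^ 2 * capAvg e x₀ r k := by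
  rw [← capAvg_const_mul]
  simp only [capAvg, rad_add_smul x₀ hr]

lemma capAvg_nonneg (hr : 0 < r) (hk : ∀ X ∈ upperHalf n, 0 ≤ k X) : 0 ≤ capAvg e x₀ r k :=
  setIntegral_nonneg isOpen_upperSphere.measurableSet fun _ hω =>
    mul_nonneg (Real.rpow_nonneg (le_of_lt hω) _) (hk _ ((add_smul_mem_upperHalf x₀ hr _).2 hω))

lemma eventually_pos_le (hr : 0 < r) : ∀ᶠ t in 𝓝 r, 0 < t ∧ t ≤ 2 * r := by
  filter_upwards [lt_mem_nhds hr, gt_mem_nhds (show r < 2 * r by linarith)] with t h1 h2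
  exact ⟨h1, h2.le⟩

lemma continuousAt_capAvg (he : -1 < e) (hr : 0 < r) (hk : ContUpToBoundary k) :
    ContinuousAt (fun t => capAvg e x₀ t k) r := by
  obtain ⟨M, -, hM⟩ := hk.exists_bound (pt x₀ 0) (2 * r)
  refine continuousAt_of_dominated (bound := fun ω => M * ht (ω : Space n) ^ e) ?_ ?_
    ((integrableOn_sphere_ht_rpow he).const_mul M) ?_
  · filter_upwards [eventually_pos_le hr] with t ht'
    exact aestronglyMeasurable_weight_mul e hk.continuousOn x₀ ht'.1
  · filter_upwards [eventually_pos_le hr] with t ht'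
    filter_upwards [ae_restrict_mem isOpen_upperSphere.measurableSet] with ω hω
    have h1 := hM _ (add_smul_mem_inter x₀ ht'.1 ht'.2 hω)
    have h2 : 0 ≤ ht (ω : Space n) ^ e := Real.rpow_nonneg (le_of_lt hω) _
    rw [norm_mul, Real.norm_eq_abs, Real.norm_eq_abs, abs_of_nonneg h2, mul_comm]
    exact mul_le_mul_of_nonneg_right h1 h2
  · filter_upwards [ae_restrict_mem isOpen_upperSphere.measurableSet] with ω hω
    refine continuousAt_const.mul ?_
    have h1 := hk.continuousOn.continuousAt (isOpen_upperHalf.mem_nhds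
      ((add_smul_mem_upperHalf x₀ hr _).2 hω))
    exact ContinuousAt.comp (f := fun t : ℝ => pt x₀ 0 + t • (ω : Space n)) h1 (by fun_prop)

lemma continuousOn_capInt_weight_mul (he : -1 < e) (hk : ContUpToBoundary k)
    (x₀ : EuclideanSpace ℝ (Fin n)) :
    ContinuousOn (fun t => capInt x₀ t fun X => ht X ^ e * k X) (Ioi 0) := by
  refine ContinuousOn.congr (f := fun t => t ^ ((n : ℝ) + e) * capAvg e x₀ t k) ?_
    fun t ht' => capInt_weight_mul e x₀ ht' k
  refine ContinuousOn.mul ?_ fun t ht' => (continuousAt_capAvg he ht' hk).continuousWithinAt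
  exact continuousOn_id.rpow_const fun t ht' => Or.inl (ne_of_gt ht')

lemma hasDerivAt_comp_ray {ω : Metric.sphere (0 : Space n) 1} (hω : ω ∈ upperSphere n)
    (hr : 0 < r) (hk : ContDiffOn ℝ 1 k (upperHalf n)) :
    HasDerivAt (fun t : ℝ => k (pt x₀ 0 + t • (ω : Space n)))
      (r⁻¹ * euler x₀ k (pt x₀ 0 + r • (ω : Space n))) r := by
  have h1 : HasDerivAt (fun t : ℝ => pt x₀ 0 + t • (ω : Space n)) (ω : Space n) r := by
    simpa using ((hasDerivAt_id r).smul_const (ω : Space n)).const_add (pt x₀ 0)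
  have h2 := (differentiableAt_of_contDiffOn hk one_ne_zero
    ((add_smul_mem_upperHalf x₀ hr _).2 hω)).hasFDerivAt.comp_hasDerivAt r h1
  refine h2.congr_deriv ?_
  simp [euler, hr.ne']

/-- On a ray, d/dt is t⁻¹ times the dilation derivative. The weight sits on the fixed unit sphere
and is never differentiated. -/
lemma hasDerivAt_capAvg (he : -1 < e) (hr : 0 < r) (hk : ContUpToBoundary k)
    (hk1 : ContDiffOn ℝ 1 k (upperHalf n)) (hDk : ContUpToBoundary (euler x₀ k)) :
    HasDerivAt (fun t => capAvg e x₀ t k) (r⁻¹ * capAvg e x₀ r (euler x₀ k)) r := by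
  obtain ⟨M, hM0, hM⟩ := hDk.exists_bound (pt x₀ 0) (2 * r)
  have h := (hasDerivAt_integral_of_dominated_loc_of_deriv_le
    (μ := (volume : Measure (Space n)).toSphere.restrict (upperSphere n))
    (s := Ioo (r / 2) (2 * r)) (x₀ := r)
    (F := fun t ω => ht (ω : Space n) ^ e * k (pt x₀ 0 + t • (ω : Space n)))
    (F' := fun t ω => ht (ω : Space n) ^ e * (t⁻¹ * euler x₀ k (pt x₀ 0 + t • (ω : Space n))))
    -- For t in (r/2, 2r), t⁻¹ is at most (r/2)⁻¹, and M bounds the dilation derivative on the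
    -- half-ball of radius 2r.
    (bound := fun ω => ((r / 2)⁻¹ * M) * ht (ω : Space n) ^ e)
    (Ioo_mem_nhds (by linarith) (by linarith)) ?_ (integrableOn_weight_mul he hk x₀ hr) ?_ ?_
    ((integrableOn_sphere_ht_rpow he).const_mul _) ?_).2
  · refine h.congr_deriv ?_
    unfold capAvg
    rw [← integral_const_mul]
    congr 1
    ext ω
    ring
  · filter_upwards [eventually_pos_le hr] with t ht'
    exact aestronglyMeasurable_weight_mul e hk.continuousOn x₀ ht'.1
  · refine ((aestronglyMeasurable_weight_mul e hDk.continuousOn x₀ hr).const_mul r⁻¹).congr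
      (Eventually.of_forall fun ω => ?_)
    simp only
    ring
  · filter_upwards [ae_restrict_mem isOpen_upperSphere.measurableSet] with ω hω t ht'
    have ht0 : 0 < t := by linarith [ht'.1]
    have h1 := hM _ (add_smul_mem_inter x₀ ht0 ht'.2.le hω)
    have h2 : 0 ≤ ht (ω : Space n) ^ e := Real.rpow_nonneg (le_of_lt hω) _
    rw [norm_mul, norm_mul, Real.norm_eq_abs, Real.norm_eq_abs, Real.norm_eq_abs,
      abs_of_nonneg h2, mul_comm, abs_of_pos (inv_pos.2 ht0)]
    refine mul_le_mul_of_nonneg_right (mul_le_mul ?_ h1 (abs_nonneg _) (by positivity)) h2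
    exact inv_anti₀ (by linarith) ht'.1.le
  · filter_upwards [ae_restrict_mem isOpen_upperSphere.measurableSet] with ω hω t ht'
    exact (hasDerivAt_comp_ray hω (by linarith [ht'.1]) hk1).const_mul _

end Avg

/-! ### Sublevel sets and test functions of the radius -/

section Layer

variable {α : Type*} [MeasurableSpace α] {μ : Measure α} {d : α → ℝ} {q : α → ℝ}

/-- Fubini on {d(x) < t}. It turns an integral against a radial cutoff into a test, in t, of the
integrals over sublevel sets. -/
lemma integral_layer [SFinite μ] (hd : Measurable d) (hq : ∀ R, IntegrableOn q {x | d x < R} μ) {η : ℝ → ℝ}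
    (hη : Continuous η) (hηc : HasCompactSupport η) :
    ∫ x, (∫ t in Ioi (d x), η t) * q x ∂μ = ∫ t, η t * ∫ x in {x | d x < t}, q x ∂μ := by
  -- Since η vanishes beyond R, q may be cut off to {d < R}, where it is integrable; Fubini needs
  -- this because q need not be integrable globally.
  obtain ⟨R, hR⟩ : ∃ R, ∀ t, R ≤ t → η t = 0 := by
    obtain ⟨R, hR⟩ := hηc.isCompact.bddAbove
    exact ⟨R + 1, fun t ht => image_eq_zero_of_notMem_tsupport fun h => by linarith [hR h]⟩
  have hset : ∀ t, MeasurableSet {x | d x < t} := fun t => measurableSet_lt hd measurable_const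
  have hint : Integrable (fun z : α × ℝ => {z : α × ℝ | d z.1 < z.2}.indicator
      (fun z => {x | d x < R}.indicator q z.1 * η z.2) z) (μ.prod volume) := by
    refine (Integrable.mul_prod ((integrable_indicator_iff (hset R)).2 (hq R))
      (hη.integrable_of_hasCompactSupport hηc)).indicator ?_
    exact measurableSet_lt (hd.comp measurable_fst) measurable_snd
  have h := integral_integral_swap (f := fun x t => {z : α × ℝ | d z.1 < z.2}.indicator
      (fun z => {x | d x < R}.indicator q z.1 * η z.2) (x, t)) hint
  have e : ∀ x t, {z : α × ℝ | d z.1 < z.2}.indicator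
      (fun z => {x | d x < R}.indicator q z.1 * η z.2) (x, t)
      = (Ioi (d x)).indicator η t * q x := fun x t => by
    simp only [indicator_apply, mem_ofPred, mem_Ioi]
    by_cases h1 : d x < t
    · by_cases h2 : d x < R
      · simp only [h1, h2, if_true]; ring
      · simp [h1, h2, hR t (by linarith)]
    · simp [h1]
  have e' : ∀ x t, (Ioi (d x)).indicator η t * q x = η t * {x | d x < t}.indicator q x :=
      fun x t => by
    by_cases h1 : d x < t
    · rw [indicator_of_mem (by exact h1), indicator_of_mem (by exact h1)]
    · rw [indicator_of_notMem (by exact h1), indicator_of_notMem (by exact h1)]; ring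
  simp only [e] at h
  simp only [integral_mul_const, integral_indicator measurableSet_Ioi] at h
  rw [h]
  simp only [e', integral_const_mul, integral_indicator (hset _)]

/-- Dominated convergence: at a point x, the indicator of {d < t} jumps only at t = d(x), and level
sets are null. -/
lemma continuous_setIntegral_lt (hd : Measurable d) (hq : ∀ R, IntegrableOn q {x | d x < R} μ)
    (hnull : ∀ t, μ {x | d x = t} = 0) : Continuous fun t => ∫ x in {x | d x < t}, q x ∂μ := by
  have hset : ∀ t, MeasurableSet {x | d x < t} := fun t => measurableSet_lt hd measurable_const
  refine continuous_iff_continuousAt.2 fun t => ?_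
  simp only [← integral_indicator (hset _)]
  refine continuousAt_of_dominated (bound := fun x => ‖{x | d x < t + 1}.indicator q x‖) ?_ ?_
    ((integrable_indicator_iff (hset _)).2 (hq _)).norm ?_
  · exact Eventually.of_forall fun r => ((integrable_indicator_iff (hset _)).2 (hq r)).1
  · filter_upwards [gt_mem_nhds (lt_add_one t)] with r hr
    refine Eventually.of_forall fun x => norm_indicator_le_of_subset (fun x hx => ?_) _ _
    exact lt_trans hx hr
  · have : ∀ᵐ x ∂μ, d x ≠ t := by simpa [ae_iff] using hnull t
    filter_upwards [this] with x hx
    rcases lt_or_gt_of_ne hx with h | h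
    · refine (continuousAt_const (y := q x)).congr ?_
      filter_upwards [lt_mem_nhds h] with r hr
      rw [indicator_of_mem (by exact hr)]
    · refine (continuousAt_const (y := (0 : ℝ))).congr ?_
      filter_upwards [gt_mem_nhds h] with r hr
      rw [indicator_of_notMem (fun h' => lt_asymm (by exact h') hr)]

end Layer

/-- The fundamental lemma of the calculus of variations, with continuity upgrading almost every
radius to every radius. -/
lemma eqOn_zero_of_forall_integral_mul_eq_zero {F : ℝ → ℝ} (hF : ContinuousOn F (Ioi 0))
    (h : ∀ η : ℝ → ℝ, ContDiff ℝ 1 η → HasCompactSupport η → tsupport η ⊆ Ioi 0 →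
      ∫ t, η t * F t = 0) : EqOn F 0 (Ioi 0) := by
  have h1 := isOpen_Ioi.ae_eq_zero_of_integral_contDiff_smul_eq_zero
    (hF.locallyIntegrableOn measurableSet_Ioi (μ := volume)) fun η h1 h2 h3 =>
      h η (h1.of_le (by exact_mod_cast le_top)) h2 h3
  refine Measure.eqOn_open_of_ae_eq (μ := volume) ?_ isOpen_Ioi hF continuousOn_const
  rw [EventuallyEq, ae_restrict_iff' measurableSet_Ioi]
  exact h1

/-! ### The divergence theorem in the half-space -/

/-- The fields vanish on the lateral and top faces of the box, so only the bottom face y = ε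
contributes. Stopping at height ε avoids {y = 0}, where no differentiability is assumed. -/
lemma divergence_box {Φ : Fin (n + 1) → Space n → ℝ}
    (hΦ : ∀ i, ∀ X ∈ upperHalf n, DifferentiableAt ℝ (Φ i) X) {R : ℝ} (hR : 0 < R)
    (hsupp : ∀ i, ∀ X ∈ upperHalf n, R ≤ ‖X‖ → Φ i X = 0)
    (hint : IntegrableOn (fun X => ∑ i, pd i (Φ i) X) (upperHalf n)) {ε : ℝ} (hε : 0 < ε)
    (hεR : ε < R + 1) :
    ∫ X in upperHalf n, {X | ε ≤ ht X}.indicator (fun X => ∑ i, pd i (Φ i) X) X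
      = -∫ x in Icc (fun _ : Fin n => -(R + 1)) (fun _ => R + 1),
          Φ (Fin.last n) (pt (WithLp.toLp 2 x) ε) := by
  set a : Fin (n + 1) → ℝ := Fin.snoc (α := fun _ => ℝ) (fun _ => -(R + 1)) ε with ha
  set b : Fin (n + 1) → ℝ := fun _ => R + 1 with hb
  have haL : a (Fin.last n) = ε := by simp [ha]
  have haS : ∀ i : Fin n, a i.castSucc = -(R + 1) := fun i => by simp [ha]
  have hab : a ≤ b := fun i => by
    refine Fin.lastCases ?_ (fun j => ?_) i
    · rw [haL]; exact hεR.le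
    · rw [haS]; simp only [hb]; linarith
  have hU : ∀ x ∈ Icc a b, (WithLp.toLp 2 x : Space n) ∈ upperHalf n := fun x hx => by
    have := hx.1 (Fin.last n)
    rw [haL] at this
    exact lt_of_lt_of_le hε this
  have hcoord : ∀ (X : Space n) (i : Fin (n + 1)), X ∈ upperHalf n → R ≤ |X i| →
      ∀ j, Φ j X = 0 := fun X i hX hi j => hsupp j X hX (hi.trans (PiLp.norm_apply_le X i))
  let L : (Fin (n + 1) → ℝ) →L[ℝ] Space n :=
    ((PiLp.continuousLinearEquiv 2 ℝ (fun _ : Fin (n + 1) => ℝ)).symm : _ →L[ℝ] _)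
  have hL : ∀ x, L x = WithLp.toLp 2 x := fun x => rfl
  have hLs : ∀ i : Fin (n + 1), L (Pi.single i 1) = EuclideanSpace.single i 1 := fun i => rfl
  have hmsB : MeasurableSet (Icc a b) := measurableSet_Icc
  -- The fields vanish near such X, hence so does the divergence. This lets the box replace the
  -- whole region {y ≥ ε}.
  have hzero : ∀ X ∈ upperHalf n, R < ‖X‖ → ∑ i, pd i (Φ i) X = 0 := fun X hX hRX => by
    refine Finset.sum_eq_zero fun i _ => ?_
    have : Φ i =ᶠ[𝓝 X] fun _ => 0 := by
      filter_upwards [isOpen_upperHalf.mem_nhds hX,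
        (isOpen_lt continuous_const continuous_norm).mem_nhds hRX] with Y hY hRY
      exact hsupp i Y hY (le_of_lt hRY)
    simp [pd, this.fderiv_eq]
  have hset : ∀ X ∈ upperHalf n, {X | ε ≤ ht X}.indicator (fun X => ∑ i, pd i (Φ i) X) X
      = (WithLp.ofLp ⁻¹' Icc a b).indicator (fun X : Space n => ∑ i, pd i (Φ i) X) X :=
      fun X hX => by
    by_cases hb' : X ∈ WithLp.ofLp ⁻¹' Icc a b
    · have : ε ≤ ht X := by
        have := hb'.1 (Fin.last n)
        rwa [haL] at this
      rw [indicator_of_mem (by exact this), indicator_of_mem hb']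
    · rw [indicator_of_notMem hb']
      by_cases hε' : ε ≤ ht X
      · rw [indicator_of_mem (by exact hε')]
        refine hzero X hX ?_
        by_contra hle
        rw [not_lt] at hle
        have hc : ∀ i, |X i| ≤ R := fun i => (PiLp.norm_apply_le X i).trans hle
        refine hb' ⟨fun i => ?_, fun i => ?_⟩
        · refine Fin.lastCases ?_ (fun j => ?_) i
          · rw [haL]; exact hε'
          · rw [haS]; linarith [(abs_le.1 (hc j.castSucc)).1]
        · simp only [hb]
          linarith [(abs_le.1 (hc i)).2]
      · rw [indicator_of_notMem (by exact hε')]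
  have hpre : MeasurableSet ((WithLp.ofLp : Space n → _) ⁻¹' Icc a b) :=
    (PiLp.continuous_ofLp 2 _).measurable hmsB
  have hsub : (WithLp.ofLp : Space n → _) ⁻¹' Icc a b ⊆ upperHalf n := fun X hX => hU _ hX
  have hmp := PiLp.volume_preserving_toLp (Fin (n + 1))
  have hemb : MeasurableEmbedding (WithLp.toLp 2 : (Fin (n + 1) → ℝ) → Space n) :=
    (MeasurableEquiv.toLp 2 _).measurableEmbedding
  have key := integral_divergence_of_hasFDerivAt_off_countable' a b hab
    (fun i x => Φ i (WithLp.toLp 2 x)) (fun i x => (fderiv ℝ (Φ i) (WithLp.toLp 2 x)).comp L) ∅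
    countable_empty ?_ ?_ ?_
  · rw [setIntegral_congr_fun isOpen_upperHalf.measurableSet hset, setIntegral_indicator hpre,
      inter_eq_self_of_subset_right hsub, ← hmp.setIntegral_preimage_emb hemb]
    have e1 : (WithLp.toLp 2 : (Fin (n + 1) → ℝ) → Space n) ⁻¹' (WithLp.ofLp ⁻¹' Icc a b)
      = Icc a b := rfl
    rw [e1]
    simp only [ContinuousLinearMap.comp_apply, hLs] at key
    refine Eq.trans key ?_
    rw [Fin.sum_univ_castSucc, Finset.sum_eq_zero, zero_add]
    · have e2 : ∀ x ∈ Icc (a ∘ (Fin.last n).succAbove) (b ∘ (Fin.last n).succAbove),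
          Φ (Fin.last n) (WithLp.toLp 2 ((Fin.last n).insertNth (b (Fin.last n)) x)) = 0 :=
          fun x _ => by
        refine hcoord _ (Fin.last n) ?_ ?_ _
        · simp only [upperHalf, ht, Fin.insertNth_apply_same, mem_ofPred, hb]
          linarith
        · simp only [Fin.insertNth_apply_same, hb]
          rw [abs_of_pos (by linarith)]
          linarith
      rw [setIntegral_congr_fun measurableSet_Icc e2, integral_zero, zero_sub]
      congr 1
      have e3 : a ∘ (Fin.last n).succAbove = fun _ => -(R + 1) := by
        ext i; simp [haS]
      rw [e3, haL]
      refine setIntegral_congr_fun measurableSet_Icc fun x _ => ?_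
      simp only [Fin.insertNth_last']
      rfl
    · intro i _
      rw [sub_eq_zero]
      have e4 : ∀ x ∈ Icc (a ∘ i.castSucc.succAbove) (b ∘ i.castSucc.succAbove), ∀ z, R ≤ |z| →
          Φ i.castSucc (WithLp.toLp 2 (i.castSucc.insertNth z x)) = 0 := fun x hx z hz => by
        refine hcoord _ i.castSucc ?_ ?_ _
        · obtain ⟨j, hj⟩ := Fin.exists_succAbove_eq (Fin.castSucc_lt_last i).ne'
          have h1 := hx.1 j
          simp only [Function.comp, hj, haL] at h1
          have h2 : ht (WithLp.toLp 2 (i.castSucc.insertNth (α := fun _ => ℝ) z x) : Space n)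
              = x j := by
            simp only [ht, ← hj, Fin.insertNth_apply_succAbove]
          exact lt_of_lt_of_le hε (h1.trans h2.ge)
        · simpa using hz
      rw [setIntegral_congr_fun measurableSet_Icc fun x hx => e4 x hx (b i.castSucc) (by
          simp only [hb]; rw [abs_of_pos (by linarith)]; linarith),
        setIntegral_congr_fun measurableSet_Icc fun x hx => e4 x hx (a i.castSucc) (by
          rw [haS, abs_neg, abs_of_pos (by linarith)]; linarith)]
  · intro i x hx
    exact (ContinuousAt.comp (f := WithLp.toLp 2) (hΦ i _ (hU x hx)).continuousAt
      (PiLp.continuous_toLp 2 _).continuousAt).continuousWithinAt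
  · intro x hx i
    have hx' : x ∈ Icc a b := ⟨fun j => (hx.1 j (mem_univ j)).1.le, fun j =>
      (hx.1 j (mem_univ j)).2.le⟩
    exact (hΦ i _ (hU x hx')).hasFDerivAt.comp x L.hasFDerivAt
  · simp only [ContinuousLinearMap.comp_apply, hLs]
    have h1 : IntegrableOn (fun X => ∑ i, pd i (Φ i) X)
      ((WithLp.ofLp : Space n → _) ⁻¹' Icc a b) := hint.mono_set hsub
    exact (hmp.integrableOn_comp_preimage hemb).2 h1

/-- Let ε tend to 0 in `divergence_box`: the volume side converges because the divergence is
integrable, the flux because the vertical component extends continuously. The sign is that of the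
outward normal, which points down. -/
lemma divergence_upperHalf {Φ : Fin (n + 1) → Space n → ℝ}
    (hΦ : ∀ i, ∀ X ∈ upperHalf n, DifferentiableAt ℝ (Φ i) X) {R : ℝ} (hR : 0 < R)
    (hsupp : ∀ i, ∀ X ∈ upperHalf n, R ≤ ‖X‖ → Φ i X = 0)
    (hint : IntegrableOn (fun X => ∑ i, pd i (Φ i) X) (upperHalf n)) {F : Space n → ℝ}
    (hF : ContinuousOn F (closedUpperHalf n)) (hFΦ : EqOn F (Φ (Fin.last n)) (upperHalf n)) :
    ∫ X in upperHalf n, ∑ i, pd i (Φ i) X = -∫ x : EuclideanSpace ℝ (Fin n), F (pt x 0) := by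
  have hpt : ∀ (x : EuclideanSpace ℝ (Fin n)) (y : ℝ), 0 < y → pt x y ∈ upperHalf n :=
    fun x y hy => by simpa [upperHalf] using hy
  have hlim : ∀ x : EuclideanSpace ℝ (Fin n),
      Tendsto (fun y => F (pt x y)) (𝓝[>] 0) (𝓝 (F (pt x 0))) := fun x =>
    (hF (pt x 0) (by simp [closedUpperHalf])).tendsto.comp
      ((tendsto_pt_nhdsWithin x).mono_right (nhdsWithin_mono _ upperHalf_subset_closedUpperHalf))
  have h1 : Tendsto (fun ε : ℝ => ∫ X in upperHalf n,
      {X | ε ≤ ht X}.indicator (fun X => ∑ i, pd i (Φ i) X) X) (𝓝[>] 0)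
      (𝓝 (∫ X in upperHalf n, ∑ i, pd i (Φ i) X)) := by
    refine tendsto_integral_filter_of_dominated_convergence
      (fun X => ‖∑ i, pd i (Φ i) X‖) ?_ ?_ hint.norm ?_
    · exact Eventually.of_forall fun ε =>
        hint.1.indicator (measurableSet_le measurable_const continuous_ht.measurable)
    · exact Eventually.of_forall fun ε => Eventually.of_forall fun X =>
        norm_indicator_le_norm_self _ _
    · filter_upwards [ae_restrict_mem isOpen_upperHalf.measurableSet] with X hX
      refine tendsto_const_nhds.congr' ?_
      filter_upwards [mem_nhdsWithin_of_mem_nhds (gt_mem_nhds (show 0 < ht X from hX))] with ε hε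
      rw [indicator_of_mem (by exact hε.le)]
  set B := Icc (fun _ : Fin n => -(R + 1)) (fun _ => R + 1) with hB
  have h2 : Tendsto (fun ε : ℝ => ∫ x in B, Φ (Fin.last n) (pt (WithLp.toLp 2 x) ε)) (𝓝[>] 0)
      (𝓝 (∫ x in B, F (pt (WithLp.toLp 2 x) 0))) := by
    have hcpt : IsCompact ((fun z : (Fin n → ℝ) × ℝ => pt (WithLp.toLp 2 z.1) z.2) ''
        (B ×ˢ Icc 0 1)) := by
      refine (isCompact_Icc.prod isCompact_Icc).image ?_
      exact continuous_pt.comp (((PiLp.continuous_toLp 2 _).comp continuous_fst).prodMk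
        continuous_snd)
    obtain ⟨M, hM⟩ := hcpt.exists_bound_of_continuousOn (hF.mono (by
      rintro _ ⟨z, hz, rfl⟩
      simpa [closedUpperHalf] using hz.2.1))
    refine tendsto_integral_filter_of_dominated_convergence (fun _ => M) ?_ ?_
      (integrableOn_const (isCompact_Icc.measure_lt_top (μ := volume)).ne) ?_
    · filter_upwards [self_mem_nhdsWithin] with ε hε
      refine Continuous.aestronglyMeasurable ?_
      refine continuous_iff_continuousAt.2 fun x => ?_
      refine ContinuousAt.comp (f := fun x : Fin n → ℝ => pt (WithLp.toLp 2 x) ε)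
        (hΦ _ _ (hpt _ _ hε)).continuousAt ?_
      exact (continuous_pt.comp ((PiLp.continuous_toLp 2 _).prodMk
        continuous_const)).continuousAt
    · filter_upwards [Ioo_mem_nhdsGT (zero_lt_one (α := ℝ))] with ε hε
      filter_upwards [ae_restrict_mem measurableSet_Icc] with x hx
      rw [← hFΦ (hpt _ _ hε.1)]
      exact hM _ ⟨(x, ε), ⟨hx, hε.1.le, hε.2.le⟩, rfl⟩
    · refine Eventually.of_forall fun x => ?_
      refine (hlim _).congr' ?_
      filter_upwards [self_mem_nhdsWithin] with ε hε
      exact hFΦ (hpt _ _ hε)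
  have h3 : ∀ᶠ ε in 𝓝[>] (0 : ℝ), ∫ X in upperHalf n,
      {X | ε ≤ ht X}.indicator (fun X => ∑ i, pd i (Φ i) X) X
      = -∫ x in B, Φ (Fin.last n) (pt (WithLp.toLp 2 x) ε) := by
    filter_upwards [Ioo_mem_nhdsGT (show (0 : ℝ) < R + 1 by linarith)] with ε hε
    exact divergence_box hΦ hR hsupp hint hε.1 hε.2
  rw [tendsto_nhds_unique (h1.congr' h3) h2.neg, ← (PiLp.volume_preserving_toLp
    (Fin n)).integral_comp (MeasurableEquiv.toLp 2 _).measurableEmbedding]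
  congr 1
  -- Outside the box the boundary value of F is a limit of zeros, so the flux integral extends to
  -- all of ℝⁿ.
  refine setIntegral_eq_integral_of_forall_compl_eq_zero fun x hx => ?_
  refine tendsto_nhds_unique (hlim _) (tendsto_const_nhds.congr' ?_)
  filter_upwards [self_mem_nhdsWithin] with y hy
  rw [hFΦ (hpt _ _ hy), hsupp _ _ (hpt _ _ hy)]
  by_contra hlt
  rw [not_le] at hlt
  have hc : ∀ i : Fin n, |x i| ≤ R := fun i => by
    have := (PiLp.norm_apply_le (pt (WithLp.toLp 2 x) y) i.castSucc).trans hlt.le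
    simpa using this
  exact hx ⟨fun i => by linarith [(abs_le.1 (hc i)).1], fun i => by
    linarith [(abs_le.1 (hc i)).2]⟩

/-! ### Green's formula in half-balls -/

/-- The Euclidean product `∇ f · ∇ h`. -/
def gradDot (f h : Space n → ℝ) (X : Space n) : ℝ := ∑ i, pd i f X * pd i h X

section Green

variable {f h : Space n → ℝ} {x₀ : EuclideanSpace ℝ (Fin n)}

lemma gradDot_comm (f h : Space n → ℝ) : gradDot f h = gradDot h f := by
  ext X
  exact Finset.sum_congr rfl fun i _ => mul_comm _ _

/-- In terms of conormal derivatives the vertical part carries the weight y^(-b). This is where b <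
1 enters the integrability of the gradient term. -/
lemma weight_mul_gradDot (f h : Space n → ℝ) :
    EqOn (fun X => ht X ^ wexp s * gradDot f h X)
      (fun X => ht X ^ wexp s * ∑ i : Fin n, dx i f X * dx i h X
        + ht X ^ (-wexp s) * (conormal s f X * conormal s h X)) (upperHalf n) := fun X hX => by
  have hy : ht X ^ wexp s ≠ 0 := (Real.rpow_pos_of_pos hX _).ne'
  simp only [gradDot, Fin.sum_univ_castSucc, conormal, Real.rpow_neg (le_of_lt hX), dx, dy, pd]
  field_simp

lemma integrableOn_weight_mul_gradDot (hs₁ : -1 < wexp s) (hs₂ : wexp s < 1) (hf : RegOne s f)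
    (hh : RegOne s h) (c : Space n) (R : ℝ) :
    IntegrableOn (fun X => ht X ^ wexp s * gradDot f h X) (upperHalf n ∩ Metric.ball c R) := by
  rw [integrableOn_congr_fun ((weight_mul_gradDot f h).mono inter_subset_left)
    (isOpen_upperHalf.inter Metric.isOpen_ball).measurableSet]
  exact (integrableOn_ht_rpow_mul hs₁ c R (ContUpToBoundary.sum _ fun i _ =>
    (hf.dx i).mul (hh.dx i))).add
    (integrableOn_ht_rpow_mul (by linarith) c R (hf.conormal.mul hh.conormal))

/-- Δ_b is in divergence form, div(y^b∇h) = y^b Δ_b h: differentiating the weight produces the term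
(b/y)∂_y h. -/
lemma sum_pd_weight_mul (hf : ContDiffOn ℝ 1 f (upperHalf n)) (hh : ContDiffOn ℝ 2 h (upperHalf n))
    {X : Space n} (hX : X ∈ upperHalf n) :
    ∑ i, pd i (fun X => ht X ^ wexp s * (f X * pd i h X)) X
      = ht X ^ wexp s * (f X * lapB s h X) + ht X ^ wexp s * gradDot f h X := by
  have hw : DifferentiableAt ℝ (fun X : Space n => ht X ^ wexp s) X :=
    (hasFDerivAt_ht_rpow _ hX).differentiableAt
  have hdf := differentiableAt_of_contDiffOn hf one_ne_zero hX
  have hdh : ∀ i, DifferentiableAt ℝ (pd i h) X := fun i =>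
    differentiableAt_of_contDiffOn (contDiffOn_pd hh (k := 1) (by norm_num) i) one_ne_zero hX
  have e1 : ∀ i, pd i (fun X => ht X ^ wexp s * (f X * pd i h X)) X
      = ht X ^ wexp s * (f X * pd i (pd i h) X + pd i f X * pd i h X)
        + f X * pd i h X * pd i (fun X : Space n => ht X ^ wexp s) X := fun i => by
    rw [pd_mul hw (hdf.fun_mul (hdh i)), pd_mul hdf (hdh i)]
    ring
  have e2 : ∑ i, f X * pd i h X * pd i (fun X : Space n => ht X ^ wexp s) X
      = ht X ^ wexp s * (f X * (wexp s / ht X * dy h X)) := by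
    rw [Fin.sum_univ_castSucc, Finset.sum_eq_zero fun i _ => by
      rw [← dx_eq_pd i (fun X : Space n => ht X ^ wexp s), dx_ht_rpow _ hX, mul_zero], zero_add,
      ← dy_eq_pd (fun X : Space n => ht X ^ wexp s), dy_ht_rpow _ hX, Real.rpow_sub_one
        (ne_of_gt hX), dy_eq_pd]
    field_simp
  simp only [e1, Finset.sum_add_distrib, e2, ← Finset.mul_sum, lapB_eq_sum hh hX, gradDot]
  ring

/-- The radial cutoff whose radial derivative is `-η`. -/
def radialCutoff (η : ℝ → ℝ) (x₀ : EuclideanSpace ℝ (Fin n)) (X : Space n) : ℝ :=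
  ∫ t in Ioi (rad x₀ X), η t

lemma continuous_rad (x₀ : EuclideanSpace ℝ (Fin n)) : Continuous (rad x₀) := by
  unfold rad; fun_prop

lemma rad_pos {X : Space n} (hX : X ∈ upperHalf n) (x₀ : EuclideanSpace ℝ (Fin n)) :
    0 < rad x₀ X := by
  rw [rad, norm_pos_iff, sub_ne_zero]
  rintro rfl
  simp [upperHalf] at hX

lemma hasDerivAt_integral_Ioi {η : ℝ → ℝ} (hη : Continuous η) (hηc : HasCompactSupport η) (t : ℝ) :
    HasDerivAt (fun t => ∫ τ in Ioi t, η τ) (-η t) t := by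
  have hi : Integrable η := hη.integrable_of_hasCompactSupport hηc
  have h1 : (fun t => ∫ τ in Ioi t, η τ) = fun t => (∫ τ in Ioi (0 : ℝ), η τ)
      - ∫ τ in (0 : ℝ)..t, η τ := by
    ext t
    rw [← intervalIntegral.integral_Ioi_sub_Ioi' hi.integrableOn hi.integrableOn]
    ring
  rw [h1]
  exact (intervalIntegral.integral_hasDerivAt_right (hη.intervalIntegrable _ _)
    (hη.stronglyMeasurableAtFilter _ _) hη.continuousAt).const_sub _

lemma hasFDerivAt_rad {X : Space n} (hX : X ∈ upperHalf n) (x₀ : EuclideanSpace ℝ (Fin n)) :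
    HasFDerivAt (rad x₀) ((rad x₀ X)⁻¹ • innerSL ℝ (X - pt x₀ 0)) X := by
  have hne : X - pt x₀ 0 ≠ 0 := norm_pos_iff.1 (rad_pos hX x₀)
  have h1 : HasFDerivAt (fun X : Space n => ‖X - pt x₀ 0‖ ^ 2)
      (2 • innerSL ℝ (X - pt x₀ 0)) X := by
    have := (hasStrictFDerivAt_norm_sq (X - pt x₀ 0)).hasFDerivAt.comp X
      ((hasFDerivAt_id X).sub_const (pt x₀ 0))
    exact this.congr_fderiv (by ext; simp)
  have h2 := h1.sqrt (by positivity)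
  have h3 : (fun X : Space n => √(‖X - pt x₀ 0‖ ^ 2)) = rad x₀ := by
    ext X; simp [rad]
  rw [h3] at h2
  refine h2.congr_fderiv ?_
  ext v
  simp [rad]
  field_simp

lemma pd_radialCutoff {η : ℝ → ℝ} (hη : Continuous η) (hηc : HasCompactSupport η) {X : Space n}
    (hX : X ∈ upperHalf n) (x₀ : EuclideanSpace ℝ (Fin n)) :
    DifferentiableAt ℝ (radialCutoff η x₀) X ∧ ∀ i, pd i (radialCutoff η x₀) X
      = -(η (rad x₀ X) / rad x₀ X) * (X - pt x₀ 0) i := by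
  have h1 : HasFDerivAt (radialCutoff η x₀) _ X :=
    (hasDerivAt_integral_Ioi hη hηc (rad x₀ X)).comp_hasFDerivAt X (hasFDerivAt_rad hX x₀)
  refine ⟨h1.differentiableAt, fun i => ?_⟩
  rw [pd, h1.fderiv]
  simp only [smul_apply, smul_eq_mul, innerSL_apply_apply,
    EuclideanSpace.inner_single_right]
  simp
  ring

lemma radialCutoff_continuous {η : ℝ → ℝ} (hη : Continuous η) (hηc : HasCompactSupport η)
    (x₀ : EuclideanSpace ℝ (Fin n)) : Continuous (radialCutoff η x₀) :=
  (continuous_iff_continuousAt.2 fun t =>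
    (hasDerivAt_integral_Ioi hη hηc t).continuousAt).comp (continuous_rad x₀)

lemma integrable_mul_of_tsupport {η F : ℝ → ℝ} (hη : Continuous η) (hηc : HasCompactSupport η)
    (hη0 : tsupport η ⊆ Ioi 0) (hF : ContinuousOn F (Ioi 0)) :
    Integrable fun t => η t * F t := by
  have h1 : IntegrableOn (fun t => η t * F t) (tsupport η) :=
    (hη.continuousOn.mul (hF.mono hη0)).integrableOn_compact hηc
  refine (integrableOn_iff_integrable_of_support_subset fun t ht' => ?_).1 h1
  exact subset_tsupport _ fun h0 => ht' (by simp [h0])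

/-- The half-ball is not treated as a domain with corners. Instead the field χ(r) y^b f∇h is
integrated over the half-space, with a cutoff satisfying χ' = -η. Polar coordinates and
`integral_layer` turn the result into the desired identity at radius t tested against η(t); as all
terms are continuous in t, it holds at every radius. -/
theorem green_halfBall [NeZero n] (hs₁ : -1 < wexp s) (hs₂ : wexp s < 1) (hf : RegOne s f)
    (hh : RegOne s h) (hL : ContUpToBoundary (lapB s h)) {F H : Space n → ℝ}
    (hF : ContinuousOn F (closedUpperHalf n)) (hFf : EqOn F f (upperHalf n))
    (hH : ContinuousOn H (closedUpperHalf n)) (hHh : EqOn H (conormal s h) (upperHalf n))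
    (x₀ : EuclideanSpace ℝ (Fin n)) {r : ℝ} (hr : 0 < r) :
    capInt x₀ r (fun X => ht X ^ wexp s * (f X * euler x₀ h X))
      = r * ((∫ X in upperHalf n ∩ Metric.ball (pt x₀ 0) r, (ht X ^ wexp s * (f X * lapB s h X)
          + ht X ^ wexp s * gradDot f h X))
        + ∫ x in Metric.ball x₀ r, F (pt x 0) * H (pt x 0)) := by
  set q : Space n → ℝ := fun X => ht X ^ wexp s * (f X * lapB s h X)
    + ht X ^ wexp s * gradDot f h X with hq
  have hqi : ∀ R, IntegrableOn q (upperHalf n ∩ Metric.ball (pt x₀ 0) R) := fun R =>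
    (integrableOn_ht_rpow_mul hs₁ _ R (hf.cont.mul hL)).add
      (integrableOn_weight_mul_gradDot hs₁ hs₂ hf hh _ R)
  have hE : ContUpToBoundary (euler x₀ h) := hh.euler_cont hs₂.le x₀
  have hFHc : Continuous fun x : EuclideanSpace ℝ (Fin n) => F (pt x 0) * H (pt x 0) := by
    have hc : Continuous fun x : EuclideanSpace ℝ (Fin n) => pt x 0 :=
      continuous_pt.comp (continuous_id.prodMk continuous_const)
    exact (hF.comp_continuous hc fun x => by simp [closedUpperHalf]).mul
      (hH.comp_continuous hc fun x => by simp [closedUpperHalf])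
  have hball : ∀ R, {X : Space n | rad x₀ X < R} = Metric.ball (pt x₀ 0) R := fun R => by
    ext X; simp [rad, dist_eq_norm]
  have hball' : ∀ R, {x : EuclideanSpace ℝ (Fin n) | ‖x - x₀‖ < R} = Metric.ball x₀ R :=
    fun R => by ext X; simp [dist_eq_norm]
  have hrad0 : ∀ x : EuclideanSpace ℝ (Fin n), rad x₀ (pt x 0) = ‖x - x₀‖ := fun x => by
    rw [rad, EuclideanSpace.norm_eq, EuclideanSpace.norm_eq, Fin.sum_univ_castSucc]
    simp
  have hmsb : ∀ R, MeasurableSet (Metric.ball (pt x₀ 0) R : Set (Space n)) := fun R =>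
    Metric.isOpen_ball.measurableSet
  have hQ1 : ∀ R, IntegrableOn q {X | rad x₀ X < R} (volume.restrict (upperHalf n)) := fun R => by
    rw [hball, IntegrableOn, Measure.restrict_restrict (hmsb R), inter_comm]
    exact hqi R
  have hQ2 : ∀ R, IntegrableOn (fun x : EuclideanSpace ℝ (Fin n) => F (pt x 0) * H (pt x 0))
      {x | ‖x - x₀‖ < R} := fun R => by
    rw [hball']
    exact (hFHc.continuousOn.integrableOn_compact
      (isCompact_closedBall x₀ R)).mono_set Metric.ball_subset_closedBall
  have hcQ : Continuous fun R => ∫ X in {X | rad x₀ X < R}, q X ∂(volume.restrict (upperHalf n)) :=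
    continuous_setIntegral_lt (continuous_rad x₀).measurable hQ1 fun t => by
      refine le_antisymm ((Measure.restrict_apply_le _ _).trans ?_) (zero_le)
      have : {X : Space n | rad x₀ X = t} = Metric.sphere (pt x₀ 0) t := by
        ext X; simp [rad]
      rw [this, Measure.addHaar_sphere]
  have hcB : Continuous fun R => ∫ x in {x : EuclideanSpace ℝ (Fin n) | ‖x - x₀‖ < R},
      F (pt x 0) * H (pt x 0) :=
    continuous_setIntegral_lt (by fun_prop) hQ2 fun t => by
      have : {x : EuclideanSpace ℝ (Fin n) | ‖x - x₀‖ = t} = Metric.sphere x₀ t := by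
        ext X; simp
      -- Here n ≥ 1 is needed: in ℝ⁰ the sphere of radius zero is not null.
      rw [this, Measure.addHaar_sphere]
  have hcC := continuousOn_capInt_weight_mul hs₁ (hf.cont.mul hE) x₀
  have key : EqOn (fun t => ((∫ X in {X | rad x₀ X < t}, q X ∂(volume.restrict (upperHalf n)))
      + ∫ x in {x : EuclideanSpace ℝ (Fin n) | ‖x - x₀‖ < t}, F (pt x 0) * H (pt x 0))
      - t⁻¹ * capInt x₀ t (fun X => ht X ^ wexp s * (f X * euler x₀ h X))) 0 (Ioi 0) := by
    have hinv : ContinuousOn (fun t : ℝ => t⁻¹) (Ioi 0) :=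
      continuousOn_inv₀.mono fun t ht' => ne_of_gt ht'
    refine eqOn_zero_of_forall_integral_mul_eq_zero
      ((hcQ.add hcB).continuousOn.sub (hinv.mul hcC)) fun η hη1 hηc hη0 => ?_
    have hη : Continuous η := hη1.continuous
    obtain ⟨R, hR0, hR⟩ : ∃ R : ℝ, 0 < R ∧ ∀ t, R ≤ t → η t = 0 := by
      obtain ⟨R, hR⟩ := hηc.isCompact.bddAbove
      exact ⟨max R 0 + 1, by positivity, fun t ht' => image_eq_zero_of_notMem_tsupport fun h' => by
        linarith [hR h', le_max_left R 0]⟩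
    have hχ0 : ∀ X : Space n, R ≤ rad x₀ X → radialCutoff η x₀ X = 0 := fun X hX => by
      refine setIntegral_eq_zero_of_forall_eq_zero fun t ht' => hR t ?_
      exact hX.trans (le_of_lt ht')
    -- The cutoff has gradient -κ(r)(X - (x₀,0)), which turns ∇h into the dilation derivative. The
    -- quotient is continuous because η vanishes near 0.
    set κ : ℝ → ℝ := fun t => η t / t with hκ
    have hκc : Continuous κ := by
      refine continuous_iff_continuousAt.2 fun t => ?_
      by_cases h0 : t = 0
      · subst h0
        have : (0 : ℝ) ∉ tsupport η := fun h' => lt_irrefl (0 : ℝ) (hη0 h')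
        refine (continuousAt_const (y := (0 : ℝ))).congr ?_
        filter_upwards [(isClosed_tsupport η).isOpen_compl.mem_nhds this] with τ hτ
        simp [hκ, image_eq_zero_of_notMem_tsupport hτ]
      · exact hη.continuousAt.div continuousAt_id h0
    have hdiv : EqOn (fun X => ∑ i, pd i (fun X => radialCutoff η x₀ X
        * (ht X ^ wexp s * (f X * pd i h X))) X) (fun X => radialCutoff η x₀ X * q X
        - κ (rad x₀ X) * (ht X ^ wexp s * (f X * euler x₀ h X))) (upperHalf n) := fun X hX => by
      have hd : ∀ i, DifferentiableAt ℝ (fun X => ht X ^ wexp s * (f X * pd i h X)) X := fun i =>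
        (hasFDerivAt_ht_rpow _ hX).differentiableAt.mul
          ((differentiableAt_of_contDiffOn hf.contDiff two_ne_zero hX).mul
          (differentiableAt_of_contDiffOn (contDiffOn_pd hh.contDiff (k := 1) (by norm_num) i)
            one_ne_zero hX))
      have hp := pd_radialCutoff hη hηc hX x₀
      simp only [pd_mul hp.1 (hd _), Finset.sum_add_distrib, ← Finset.mul_sum, hp.2]
      rw [sum_pd_weight_mul (hf.contDiff.of_le (by norm_num)) hh.contDiff hX, euler,
        clm_apply_eq_sum, sub_eq_add_neg]
      congr 1
      simp only [Finset.mul_sum, ← Finset.sum_neg_distrib, pd, hκ]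
      exact Finset.sum_congr rfl fun i _ => by ring
    have hloc : ∀ {k : Space n → ℝ}, (∀ X, R ≤ rad x₀ X → k X = 0) →
        IntegrableOn k (upperHalf n ∩ Metric.ball (pt x₀ 0) R) → IntegrableOn k (upperHalf n) :=
        fun hk hi => by
      refine hi.of_forall_sdiff_eq_zero isOpen_upperHalf.measurableSet fun X hX => hk X ?_
      by_contra hlt
      rw [not_le] at hlt
      exact hX.2 ⟨hX.1, by rw [← hball]; exact hlt⟩
    have hχu : ContUpToBoundary (radialCutoff η x₀) :=
      ContUpToBoundary.of_continuous (radialCutoff_continuous hη hηc x₀)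
    have hi1 : IntegrableOn (fun X => radialCutoff η x₀ X * q X) (upperHalf n) := by
      refine hloc (fun X hX => by simp [hχ0 X hX]) ?_
      obtain ⟨M, -, hM⟩ := hχu.exists_bound (pt x₀ 0) R
      refine Integrable.bdd_mul (c := M) (hqi R)
        (radialCutoff_continuous hη hηc x₀).aestronglyMeasurable ?_
      filter_upwards [ae_restrict_mem (isOpen_upperHalf.inter
        Metric.isOpen_ball).measurableSet] with X hX
      exact hM X ⟨hX.1, Metric.ball_subset_closedBall hX.2⟩
    have hi2 : IntegrableOn (fun X => κ (rad x₀ X) * (ht X ^ wexp s * (f X * euler x₀ h X)))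
        (upperHalf n) := by
      refine hloc (fun X hX => by simp [hκ, hR _ hX]) ?_
      have h1 := integrableOn_ht_rpow_mul hs₁ (pt x₀ 0) R ((ContUpToBoundary.of_continuous
        (hκc.comp (continuous_rad x₀))).mul (hf.cont.mul hE))
      refine h1.congr_fun (fun X _ => ?_) (isOpen_upperHalf.inter Metric.isOpen_ball).measurableSet
      simp only [Function.comp]
      ring
    -- The support radius is enlarged by the norm of the centre because `divergence_upperHalf`
    -- measures it from the origin.
    have hdt := divergence_upperHalf (Φ := fun i X => radialCutoff η x₀ X
        * (ht X ^ wexp s * (f X * pd i h X))) (R := R + ‖pt x₀ 0‖)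
        (F := fun X => radialCutoff η x₀ X * (F X * H X)) ?_ (by positivity) ?_ ?_ ?_ ?_
    · have e1 := integral_layer (continuous_rad x₀).measurable hQ1 hη hηc
      have e2 := integral_layer (d := fun x : EuclideanSpace ℝ (Fin n) => ‖x - x₀‖) (by fun_prop)
        hQ2 hη hηc
      have e3 := setIntegral_eq_integral_capInt hi2 x₀
      have e4 : ∀ t ∈ Ioi (0 : ℝ), capInt x₀ t (fun X => κ (rad x₀ X)
          * (ht X ^ wexp s * (f X * euler x₀ h X)))
          = η t * (t⁻¹ * capInt x₀ t fun X => ht X ^ wexp s * (f X * euler x₀ h X)) :=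
          fun t ht' => by
        rw [capInt_mul_rad x₀ ht']
        simp only [hκ]
        ring
      have e5 : ∫ t in Ioi (0 : ℝ), η t * (t⁻¹ * capInt x₀ t fun X => ht X ^ wexp s
          * (f X * euler x₀ h X)) = ∫ t, η t * (t⁻¹ * capInt x₀ t fun X => ht X ^ wexp s
          * (f X * euler x₀ h X)) :=
        setIntegral_eq_integral_of_forall_compl_eq_zero fun t ht' => by
          rw [image_eq_zero_of_notMem_tsupport fun h' => ht' (hη0 h'), zero_mul]
      rw [setIntegral_congr_fun measurableSet_Ioi e4, e5] at e3
      rw [setIntegral_congr_fun isOpen_upperHalf.measurableSet hdiv, integral_sub hi1 hi2, e3]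
        at hdt
      simp only [radialCutoff, hrad0] at hdt
      rw [e2, e1] at hdt
      simp only [mul_sub, mul_add]
      have j1 := integrable_mul_of_tsupport hη hηc hη0 hcQ.continuousOn
      have j2 := integrable_mul_of_tsupport hη hηc hη0 hcB.continuousOn
      have j3 := integrable_mul_of_tsupport hη hηc hη0 (hinv.mul hcC)
      refine (integral_sub (j1.add j2) j3).trans ?_
      simp only [Pi.add_apply, Pi.mul_apply]
      rw [integral_add j1 j2]
      linarith
    · intro i X hX
      exact (pd_radialCutoff hη hηc hX x₀).1.mul ((hasFDerivAt_ht_rpow _ hX).differentiableAt.mul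
          ((differentiableAt_of_contDiffOn hf.contDiff two_ne_zero hX).mul
          (differentiableAt_of_contDiffOn (contDiffOn_pd hh.contDiff (k := 1) (by norm_num) i)
            one_ne_zero hX)))
    · intro i X _ hRX
      have : R ≤ rad x₀ X := by
        have := norm_sub_norm_le X (pt x₀ 0)
        simp only [rad]
        linarith
      simp [hχ0 X this]
    · rw [integrableOn_congr_fun hdiv isOpen_upperHalf.measurableSet]
      exact hi1.sub hi2
    · exact (radialCutoff_continuous hη hηc x₀).continuousOn.mul (hF.mul hH)
    · intro X hX
      simp only [hFf hX, hHh hX, conormal, dy_eq_pd]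
      ring
  have h1 := key (show r ∈ Ioi (0 : ℝ) from hr)
  simp only [Pi.zero_apply, hball, hball', Measure.restrict_restrict (hmsb r),
    inter_comm (Metric.ball (pt x₀ 0) r)] at h1
  rw [sub_eq_zero] at h1
  rw [h1, mul_inv_cancel_left₀ hr.ne']

end Green

/-! ### Differentiating integrals over half-balls -/

section Cap

variable {f h : Space n → ℝ} {x₀ : EuclideanSpace ℝ (Fin n)} {r : ℝ}

lemma capInt_add (hf : CapIntegrable x₀ r f) (hh : CapIntegrable x₀ r h) :
    capInt x₀ r (fun X => f X + h X) = capInt x₀ r f + capInt x₀ r h := by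
  unfold capInt
  rw [integral_add hf hh, mul_add]

lemma hasDerivAt_setIntegral_ball {q : Space n → ℝ}
    (hq : ∀ R, IntegrableOn q (upperHalf n ∩ Metric.ball (pt x₀ 0) R))
    (hc : ContinuousOn (fun t => capInt x₀ t q) (Ioi 0)) (hr : 0 < r) :
    HasDerivAt (fun t => ∫ X in upperHalf n ∩ Metric.ball (pt x₀ 0) t, q X) (capInt x₀ r q) r := by
  have h1 : IntervalIntegrable (fun t => capInt x₀ t q) volume 0 r := by
    rw [intervalIntegrable_iff_integrableOn_Ioo_of_le hr.le]
    exact (setIntegral_ball_eq_integral_capInt hr (hq r)).1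
  have h2 := intervalIntegral.integral_hasDerivAt_right h1
    (hc.stronglyMeasurableAtFilter isOpen_Ioi r hr) (hc.continuousAt (Ioi_mem_nhds hr))
  refine h2.congr_of_eventuallyEq ?_
  filter_upwards [Ioi_mem_nhds hr] with t ht'
  exact (setIntegral_ball_eq_integral_capInt ht' (hq t)).2

lemma capIntegrable_weight_mul_gradDot (hs₁ : -1 < wexp s) (hs₂ : wexp s < 1) (hf : RegOne s f)
    (hh : RegOne s h) (x₀ : EuclideanSpace ℝ (Fin n)) (hr : 0 < r) :
    CapIntegrable x₀ r fun X => ht X ^ wexp s * gradDot f h X := by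
  rw [capIntegrable_congr hr (weight_mul_gradDot f h)]
  exact (capIntegrable_weight_mul hs₁ (ContUpToBoundary.sum _ fun i _ =>
    (hf.dx i).mul (hh.dx i)) x₀ hr).add
    (capIntegrable_weight_mul (by linarith) (hf.conormal.mul hh.conormal) x₀ hr)

lemma continuousOn_capInt_weight_mul_gradDot (hs₁ : -1 < wexp s) (hs₂ : wexp s < 1)
    (hf : RegOne s f) (hh : RegOne s h) (x₀ : EuclideanSpace ℝ (Fin n)) :
    ContinuousOn (fun t => capInt x₀ t fun X => ht X ^ wexp s * gradDot f h X) (Ioi 0) := by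
  have c1 : ContUpToBoundary fun X => ∑ i : Fin n, dx i f X * dx i h X :=
    ContUpToBoundary.sum _ fun i _ => (hf.dx i).mul (hh.dx i)
  have c2 := hf.conormal.mul hh.conormal
  refine ((continuousOn_capInt_weight_mul hs₁ c1 x₀).add
    (continuousOn_capInt_weight_mul (show -1 < -wexp s by linarith) c2 x₀)).congr fun t ht' => ?_
  rw [capInt_congr ht' (weight_mul_gradDot f h), capInt_add (capIntegrable_weight_mul hs₁ c1 x₀ ht')
    (capIntegrable_weight_mul (by linarith) c2 x₀ ht')]
  rfl

/-- The tangential Dirichlet form on the half-sphere of radius `r`. -/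
def capDirichlet (s : ℝ) (x₀ : EuclideanSpace ℝ (Fin n)) (r : ℝ) (f h : Space n → ℝ) : ℝ :=
  r ^ 2 * capAvg (wexp s) x₀ r (gradDot f h)
    - capAvg (wexp s) x₀ r fun X => euler x₀ f X * euler x₀ h X

lemma capDirichlet_comm (f h : Space n → ℝ) :
    capDirichlet s x₀ r f h = capDirichlet s x₀ r h f := by
  simp only [capDirichlet, gradDot_comm f h, mul_comm (euler x₀ f _)]

lemma euler_sq_le (f : Space n → ℝ) (X : Space n) :
    euler x₀ f X ^ 2 ≤ rad x₀ X ^ 2 * gradDot f f X := by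
  have h1 : rad x₀ X ^ 2 = ∑ i, (X - pt x₀ 0) i ^ 2 := by
    rw [rad, EuclideanSpace.norm_sq_eq]
    simp
  rw [euler, clm_apply_eq_sum, h1]
  refine (Finset.sum_mul_sq_le_sq_mul_sq _ _ _).trans (le_of_eq ?_)
  simp only [gradDot, sq]
  rfl

lemma integrableOn_weight_mul_gradDot_sphere (hs₁ : -1 < wexp s) (hs₂ : wexp s < 1)
    (hf : RegOne s f) (hh : RegOne s h) (x₀ : EuclideanSpace ℝ (Fin n)) (hr : 0 < r) :
    IntegrableOn (fun ω : Metric.sphere (0 : Space n) 1 =>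
      ht (ω : Space n) ^ wexp s * gradDot f h (pt x₀ 0 + r • (ω : Space n))) (upperSphere n)
      (volume : Measure (Space n)).toSphere := by
  refine IntegrableOn.congr_fun ((capIntegrable_weight_mul_gradDot hs₁ hs₂ hf hh x₀ hr).const_mul
    (r ^ wexp s)⁻¹) (fun ω hω => ?_) isOpen_upperSphere.measurableSet
  simp only [weight_add_smul (wexp s) x₀ hr hω]
  have := (Real.rpow_pos_of_pos hr (wexp s)).ne'
  field_simp

lemma capDirichlet_eq (hs₁ : -1 < wexp s) (hs₂ : wexp s < 1) (hf : RegOne s f) (hh : RegOne s h)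
    (x₀ : EuclideanSpace ℝ (Fin n)) (hr : 0 < r) :
    capDirichlet s x₀ r f h = capAvg (wexp s) x₀ r
      fun X => rad x₀ X ^ 2 * gradDot f h X - euler x₀ f X * euler x₀ h X := by
  have h1 := (integrableOn_weight_mul_gradDot_sphere hs₁ hs₂ hf hh x₀ hr).const_mul (r ^ 2)
  have h2 := integrableOn_weight_mul hs₁ ((hf.euler_cont hs₂.le x₀).mul
    (hh.euler_cont hs₂.le x₀)) x₀ hr
  rw [capDirichlet]
  unfold capAvg
  rw [← integral_const_mul, ← integral_sub h1 h2]
  congr 1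
  ext ω
  simp only [rad_add_smul x₀ hr]
  ring

/-- By Cauchy-Schwarz r²|∇f|² dominates the squared dilation derivative pointwise; the difference is
r² times the squared tangential gradient. -/
lemma capDirichlet_self_nonneg (hs₁ : -1 < wexp s) (hs₂ : wexp s < 1) (hf : RegOne s f)
    (x₀ : EuclideanSpace ℝ (Fin n)) (hr : 0 < r) : 0 ≤ capDirichlet s x₀ r f f := by
  rw [capDirichlet_eq hs₁ hs₂ hf hf x₀ hr]
  refine capAvg_nonneg hr fun X _ => ?_
  have := euler_sq_le (x₀ := x₀) f X
  rw [← sq]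
  linarith

/-- Integration by parts on half-spheres. -/
theorem capAvg_mul_lapB [NeZero n] (hs₁ : -1 < wexp s) (hs₂ : wexp s < 1) (hf : RegOne s f)
    (hh : RegOne s h) (hL : ContUpToBoundary (lapB s h))
    (hD : ContUpToBoundary (euler x₀ (euler x₀ h))) {H : Space n → ℝ}
    (hH : ContinuousOn H (closedUpperHalf n)) (hHh : EqOn H (conormal s h) (upperHalf n))
    (hH0 : ∀ x, H (pt x 0) = 0) (hr : 0 < r) :
    r ^ 2 * capAvg (wexp s) x₀ r (fun X => f X * lapB s h X)
      - capAvg (wexp s) x₀ r (fun X => f X * euler x₀ (euler x₀ h) X)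
      - (n + wexp s - 1) * capAvg (wexp s) x₀ r (fun X => f X * euler x₀ h X)
      = -capDirichlet s x₀ r f h := by
  obtain ⟨F, hF, hFf⟩ := hf.cont
  set q : Space n → ℝ := fun X => ht X ^ wexp s * (f X * lapB s h X)
    + ht X ^ wexp s * gradDot f h X with hq
  have hE := hh.euler_cont hs₂.le x₀
  have hEf := hf.euler_cont hs₂.le x₀
  have hE1 : ContDiffOn ℝ 1 (euler x₀ h) (upperHalf n) :=
    contDiffOn_euler hh.contDiff (by norm_num) x₀
  have hf1 : ContDiffOn ℝ 1 f (upperHalf n) := hf.contDiff.of_le (by norm_num)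
  have hqi : ∀ R, IntegrableOn q (upperHalf n ∩ Metric.ball (pt x₀ 0) R) := fun R =>
    (integrableOn_ht_rpow_mul hs₁ _ R (hf.cont.mul hL)).add
      (integrableOn_weight_mul_gradDot hs₁ hs₂ hf hh _ R)
  have hcap : ∀ t ∈ Ioi (0 : ℝ), capInt x₀ t q
      = capInt x₀ t (fun X => ht X ^ wexp s * (f X * lapB s h X))
        + capInt x₀ t (fun X => ht X ^ wexp s * gradDot f h X) := fun t ht' =>
    capInt_add (capIntegrable_weight_mul hs₁ (hf.cont.mul hL) x₀ ht')
      (capIntegrable_weight_mul_gradDot hs₁ hs₂ hf hh x₀ ht')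
  have hqc : ContinuousOn (fun t => capInt x₀ t q) (Ioi 0) :=
    ((continuousOn_capInt_weight_mul hs₁ (hf.cont.mul hL) x₀).add
      (continuousOn_capInt_weight_mul_gradDot hs₁ hs₂ hf hh x₀)).congr hcap
  -- With zero Neumann datum, Green's formula reads P(t)Y(t) = t I(t), where P = t^(n+b), Y is the
  -- average of f times the dilation derivative of h, and I is the solid integral. The formula on
  -- half-spheres is its derivative in t.
  have hgreen : ∀ t ∈ Ioi (0 : ℝ), t ^ ((n : ℝ) + wexp s)
      * capAvg (wexp s) x₀ t (fun X => f X * euler x₀ h X)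
      = t * ∫ X in upperHalf n ∩ Metric.ball (pt x₀ 0) t, q X := fun t ht' => by
    rw [← capInt_weight_mul _ _ ht', green_halfBall hs₁ hs₂ hf hh hL hF hFf hH hHh x₀ ht']
    simp only [hH0, mul_zero, integral_zero, add_zero]
    rfl
  have hprod : EqOn (euler x₀ fun X => f X * euler x₀ h X)
      (fun X => euler x₀ f X * euler x₀ h X + f X * euler x₀ (euler x₀ h) X) (upperHalf n) :=
    fun X hX => by
      rw [euler_mul (differentiableAt_of_contDiffOn hf1 one_ne_zero hX)
        (differentiableAt_of_contDiffOn hE1 one_ne_zero hX)]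
      ring
  have hc1 := hEf.mul hE
  have hc2 := hf.cont.mul hD
  have hY := hasDerivAt_capAvg (x₀ := x₀) hs₁ hr (hf.cont.mul hE) (hf1.mul hE1)
    ((hc1.add hc2).congr hprod)
  have hl := ((hasDerivAt_id r).rpow_const (p := (n : ℝ) + wexp s) (Or.inl hr.ne')).mul hY
  have hr' := (hasDerivAt_id r).mul (hasDerivAt_setIntegral_ball hqi hqc hr)
  have heq := hl.unique (hr'.congr_of_eventuallyEq (by
    filter_upwards [Ioi_mem_nhds hr] with t ht'
    exact hgreen t ht'))
  have hQ := hgreen r hr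
  rw [hcap r hr, capInt_weight_mul _ _ hr, capInt_weight_mul _ _ hr] at heq
  simp only [id_eq] at heq
  rw [capAvg_congr hr hprod, capAvg_add hs₁ hr hc1 hc2, Real.rpow_sub_one hr.ne'] at heq
  have hp : 0 < r ^ ((n : ℝ) + wexp s) := Real.rpow_pos_of_pos hr _
  have hP : r ^ ((n : ℝ) + wexp s) / r ≠ 0 := by positivity
  rw [capDirichlet]
  set I := ∫ X in upperHalf n ∩ Metric.ball (pt x₀ 0) r, q X
  set P := r ^ ((n : ℝ) + wexp s)
  -- The solid integral left by the product rule is eliminated with the undifferentiated identity,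
  -- which lowers the coefficient n+b to n+b-1.
  have hI : I = P / r * capAvg (wexp s) x₀ r (fun X => f X * euler x₀ h X) := by
    field_simp
    linarith
  rw [hI] at heq
  refine mul_left_cancel₀ hP ?_
  field_simp
  field_simp at heq
  linarith

end Cap

/-! ### Boundary values -/

lemma boundary_unique {F G : Space n → ℝ} (hF : ContinuousOn F (closedUpperHalf n))
    (hG : ContinuousOn G (closedUpperHalf n)) (h : EqOn F G (upperHalf n))
    (x : EuclideanSpace ℝ (Fin n)) : F (pt x 0) = G (pt x 0) := by
  have hlim : ∀ {K : Space n → ℝ}, ContinuousOn K (closedUpperHalf n) →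
      Tendsto (fun y => K (pt x y)) (𝓝[>] 0) (𝓝 (K (pt x 0))) := fun hK =>
    (hK (pt x 0) (by simp [closedUpperHalf])).tendsto.comp
      ((tendsto_pt_nhdsWithin x).mono_right (nhdsWithin_mono _ upperHalf_subset_closedUpperHalf))
  refine tendsto_nhds_unique ((hlim hF).congr' ?_) (hlim hG)
  filter_upwards [self_mem_nhdsWithin] with y hy
  exact h (by simpa [upperHalf] using hy)

lemma boundary_eq_of_tendsto {F w : Space n → ℝ} (hF : ContinuousOn F (closedUpperHalf n))
    (h : EqOn F w (upperHalf n)) {x : EuclideanSpace ℝ (Fin n)} {l : ℝ}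
    (hl : Tendsto (fun y => w (pt x y)) (𝓝[>] 0) (𝓝 l)) : F (pt x 0) = l := by
  refine tendsto_nhds_unique (((hF (pt x 0) (by simp [closedUpperHalf])).tendsto.comp
      ((tendsto_pt_nhdsWithin x).mono_right
        (nhdsWithin_mono _ upperHalf_subset_closedUpperHalf))).congr' ?_) hl
  filter_upwards [self_mem_nhdsWithin] with y hy
  exact h (by simpa [upperHalf] using hy)

/-- The boundary values of a function are differentiable along the boundary, with the boundary
values of its horizontal derivatives as derivatives. -/
lemma hasDerivAt_boundary {k K : Space n → ℝ} {K' : Fin n → Space n → ℝ}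
    (hk : ContDiffOn ℝ 1 k (upperHalf n)) (hK : ContinuousOn K (closedUpperHalf n))
    (hKk : EqOn K k (upperHalf n)) (hK' : ∀ i, ContinuousOn (K' i) (closedUpperHalf n))
    (hKk' : ∀ i, EqOn (K' i) (dx i k) (upperHalf n)) (x v : EuclideanSpace ℝ (Fin n)) (t : ℝ) :
    HasDerivAt (fun t : ℝ => K (pt (x + t • v) 0)) (∑ i, v i * K' i (pt (x + t • v) 0)) t := by
  -- The height is |z.1| so that everything is continuous on all of ℝ × ℝ. The fundamental theorem
  -- of calculus holds on horizontal lines at nonzero height and passes to the limit at height 0.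
  have hcp : Continuous fun z : ℝ × ℝ => pt (x + z.2 • v) |z.1| :=
    continuous_pt.comp ((by fun_prop : Continuous fun z : ℝ × ℝ => x + z.2 • v).prodMk
      (by fun_prop))
  have hmem : ∀ z : ℝ × ℝ, pt (x + z.2 • v) |z.1| ∈ closedUpperHalf n := fun z => by
    simp [closedUpperHalf]
  have hc1 : Continuous fun z : ℝ × ℝ => K (pt (x + z.2 • v) |z.1|) := hK.comp_continuous hcp hmem
  have hc2 : Continuous fun z : ℝ × ℝ => ∑ i, v i * K' i (pt (x + z.2 • v) |z.1|) :=
    continuous_finsetSum _ fun i _ => continuous_const.mul ((hK' i).comp_continuous hcp hmem)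
  have hpos : ∀ y : ℝ, y ≠ 0 → ∀ τ : ℝ, K (pt (x + τ • v) |y|) - K (pt (x + (0 : ℝ) • v) |y|)
      = ∫ σ in (0 : ℝ)..τ, ∑ i, v i * K' i (pt (x + σ • v) |y|) := fun y hy τ => by
    have hU : ∀ σ : ℝ, pt (x + σ • v) |y| ∈ upperHalf n := fun σ => by simpa [upperHalf] using hy
    rw [intervalIntegral.integral_eq_sub_of_hasDerivAt (f := fun σ => K (pt (x + σ • v) |y|))]
    · intro σ _
      have hline : HasDerivAt (fun σ : ℝ => pt (x + σ • v) |y|) (pt v 0) σ := by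
        have : (fun σ : ℝ => pt (x + σ • v) |y|) = fun σ : ℝ => pt x |y| + σ • pt v 0 := by
          ext σ i
          refine Fin.lastCases ?_ (fun j => ?_) i <;> simp
        rw [this]
        simpa using ((hasDerivAt_id σ).smul_const (pt v 0)).const_add (pt x |y|)
      have h1 := (differentiableAt_of_contDiffOn hk one_ne_zero
        (hU σ)).hasFDerivAt.comp_hasDerivAt σ hline
      have h2 : (fun σ : ℝ => K (pt (x + σ • v) |y|)) = k ∘ fun σ : ℝ => pt (x + σ • v) |y| := by
        ext σ
        exact hKk (hU σ)
      rw [h2]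
      refine h1.congr_deriv ?_
      rw [clm_apply_eq_sum, Fin.sum_univ_castSucc]
      simp [hKk' _ (hU σ), dx]
    · exact (hc2.comp (continuous_const.prodMk continuous_id)).intervalIntegrable _ _
  have hzero : ∀ τ : ℝ, K (pt (x + τ • v) |0|) - K (pt (x + (0 : ℝ) • v) |0|)
      = ∫ σ in (0 : ℝ)..τ, ∑ i, v i * K' i (pt (x + σ • v) |0|) := fun τ => by
    have hl : Continuous fun y : ℝ => K (pt (x + τ • v) |y|) - K (pt (x + (0 : ℝ) • v) |y|) :=
      (hc1.comp (continuous_id.prodMk continuous_const)).sub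
        (hc1.comp (continuous_id.prodMk continuous_const))
    have hrr : Continuous fun y : ℝ => ∫ σ in (0 : ℝ)..τ, ∑ i, v i * K' i (pt (x + σ • v) |y|) :=
      intervalIntegral.continuous_parametric_intervalIntegral_of_continuous'
        (f := fun y σ => ∑ i, v i * K' i (pt (x + σ • v) |y|)) hc2 0 τ
    refine tendsto_nhds_unique ((hl.tendsto 0).mono_left (nhdsWithin_le_nhds (s := {0}ᶜ)))
      (((hrr.tendsto 0).mono_left (nhdsWithin_le_nhds (s := {0}ᶜ))).congr' ?_)
    filter_upwards [self_mem_nhdsWithin] with y hy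
    exact (hpos y hy τ).symm
  simp only [abs_zero] at hzero
  have hc3 : Continuous fun σ : ℝ => ∑ i, v i * K' i (pt (x + σ • v) 0) := by
    simpa [Function.comp_def] using hc2.comp (continuous_const.prodMk continuous_id : Continuous fun σ : ℝ =>
      ((0 : ℝ), σ))
  have h3 : (fun τ : ℝ => K (pt (x + τ • v) 0)) = fun τ => (∫ σ in (0 : ℝ)..τ,
      ∑ i, v i * K' i (pt (x + σ • v) 0)) + K (pt (x + (0 : ℝ) • v) 0) := by
    ext τ
    rw [← hzero τ]; ring
  rw [h3]
  exact (intervalIntegral.integral_hasDerivAt_right (hc3.intervalIntegrable _ _)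
    (hc3.stronglyMeasurableAtFilter _ _) hc3.continuousAt).add_const _

/-- The vertical part y^(1-b) · y^b∂_y k vanishes at y = 0 because b < 1, so only horizontal
dilation survives on the boundary. -/
lemma euler_boundary {k E : Space n → ℝ} (hs₂ : wexp s < 1) (hk : RegOne s k)
    {x₀ : EuclideanSpace ℝ (Fin n)} {K' : Fin n → Space n → ℝ}
    (hE : ContinuousOn E (closedUpperHalf n)) (hEk : EqOn E (euler x₀ k) (upperHalf n))
    (hK' : ∀ i, ContinuousOn (K' i) (closedUpperHalf n))
    (hKk' : ∀ i, EqOn (K' i) (dx i k) (upperHalf n)) (x : EuclideanSpace ℝ (Fin n)) :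
    E (pt x 0) = ∑ i, (x i - x₀ i) * K' i (pt x 0) := by
  obtain ⟨H, hH, hHk⟩ := hk.conormal
  have h1 := boundary_unique (G := fun X => ∑ i : Fin n, (X i.castSucc - x₀ i) * K' i X
    + ht X ^ (1 - wexp s) * H X) hE ?_ (fun X hX => ?_) x
  · simpa [Real.zero_rpow (show 1 - wexp s ≠ 0 by linarith)] using h1
  · refine (continuousOn_finsetSum _ fun i _ => ContinuousOn.mul (by fun_prop) (hK' i)).add
      (ContinuousOn.mul ?_ hH)
    exact (continuous_ht.rpow_const fun _ => Or.inr (by linarith)).continuousOn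
  · simp only [hEk hX, hHk hX, fun i => hKk' i hX, euler_eq_sum, conormal]
    rw [← mul_assoc, ht_rpow_mul_ht_rpow hX]
    simp

/-- A datum that vanishes on the whole boundary has vanishing horizontal derivatives there. The
remaining term in `conormal_euler` carries y^(1+b), which tends to 0 since b > -1. -/
lemma conormal_euler_boundary {k H E : Space n → ℝ} (hs₁ : -1 < wexp s) (hk : RegTwo s k)
    {x₀ : EuclideanSpace ℝ (Fin n)} (hH : ContinuousOn H (closedUpperHalf n))
    (hHk : EqOn H (conormal s k) (upperHalf n)) (hH0 : ∀ x, H (pt x 0) = 0)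
    (hE : ContinuousOn E (closedUpperHalf n))
    (hEk : EqOn E (conormal s (euler x₀ k)) (upperHalf n)) (x : EuclideanSpace ℝ (Fin n)) :
    E (pt x 0) = 0 := by
  choose H' hH' hHk' using fun i => (hk.dx i).conormal
  obtain ⟨L, hL, hLk⟩ := hk.lap.sub (ContUpToBoundary.sum Finset.univ fun i _ => (hk.dx i).dx i)
  have hcc : ContDiffOn ℝ 1 (conormal s k) (upperHalf n) :=
    (contDiffOn_ht_rpow _).mul (contDiffOn_pd hk.regOne.contDiff (by norm_num) _)
  have hcomm : ∀ i, EqOn (H' i) (dx i (conormal s k)) (upperHalf n) := fun i X hX => by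
    have h1 : dx i (conormal s k) X = dx i (fun X => ht X ^ wexp s * dy k X) X := rfl
    have h2 := pd_mul (hasFDerivAt_ht_rpow (wexp s) hX).differentiableAt
      (differentiableAt_of_contDiffOn (contDiffOn_pd hk.regOne.contDiff (k := 1) (by norm_num)
        (Fin.last n)) one_ne_zero hX) i.castSucc
    have h3 := dx_ht_rpow (wexp s) hX i
    rw [dx_eq_pd] at h3
    rw [h3, mul_zero, add_zero] at h2
    rw [hHk' i hX, h1]
    refine Eq.trans ?_ h2.symm
    exact congrArg _ (pd_comm hk.regOne.contDiff _ _ hX)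
  have hH'0 : ∀ i x, H' i (pt x 0) = 0 := fun i x => by
    have h1 := hasDerivAt_boundary hcc hH hHk hH' hcomm x (EuclideanSpace.single i 1) 0
    simp only [hH0] at h1
    have h2 := h1.unique (hasDerivAt_const _ _)
    simpa [Finset.sum_ite_eq] using h2
  have h1 := boundary_unique (G := fun X => ∑ i : Fin n, (X i.castSucc - x₀ i) * H' i X
    + ht X ^ (1 + wexp s) * L X + (1 - wexp s) * H X) hE ?_ (fun X hX => ?_) x
  · simpa [Real.zero_rpow (show 1 + wexp s ≠ 0 by linarith), hH'0, hH0] using h1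
  · refine ((continuousOn_finsetSum _ fun i _ => ContinuousOn.mul (by fun_prop) (hH' i)).add
      (ContinuousOn.mul ?_ hL)).add (continuousOn_const.mul hH)
    exact (continuous_ht.rpow_const fun _ => Or.inr (by linarith)).continuousOn
  · simp only [hEk hX, hLk hX, hHk hX, fun i => hHk' i hX, conormal_euler hk.regOne.contDiff x₀ hX]

/-! ### Differentiating integrals over balls -/

/-- Rescaling to the unit ball reduces the claim to differentiation under the integral, so only
derivatives along rays are required. -/
lemma hasDerivAt_setIntegral_ball_of_ray {x₀ : EuclideanSpace ℝ (Fin n)}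
    {φ ψ : EuclideanSpace ℝ (Fin n) → ℝ} (hφ : Continuous φ) (hψ : Continuous ψ)
    (h : ∀ z (t : ℝ), 0 < t → HasDerivAt (fun t : ℝ => φ (x₀ + t • z)) (t⁻¹ * ψ (x₀ + t • z)) t)
    {r : ℝ} (hr : 0 < r) :
    HasDerivAt (fun t => ∫ x in Metric.ball x₀ t, φ x)
      (r⁻¹ * (n * (∫ x in Metric.ball x₀ r, φ x) + ∫ x in Metric.ball x₀ r, ψ x)) r := by
  have hscale : ∀ {k : EuclideanSpace ℝ (Fin n) → ℝ}, ∀ t : ℝ, 0 < t →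
      ∫ x in Metric.ball x₀ t, k x = t ^ n * ∫ z in Metric.ball 0 1, k (x₀ + t • z) := by
    intro k t ht'
    have h1 := Measure.setIntegral_comp_smul_of_pos (volume : Measure (EuclideanSpace ℝ (Fin n)))
      (fun z => k (x₀ + z)) (Metric.ball 0 1) ht'
    have h2 : (x₀ + ·) ⁻¹' (Metric.ball x₀ t) = Metric.ball 0 t := by
      ext z; simp
    rw [h1, ← (measurePreserving_add_left volume x₀).setIntegral_preimage_emb
      (measurableEmbedding_addLeft x₀), h2, smul_unitBall_of_pos ht']
    simp only [finrank_euclideanSpace_fin, smul_eq_mul]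
    rw [mul_inv_cancel_left₀ (by positivity)]
  have hb : ∃ M, ∀ t ∈ Ioo (r / 2) (2 * r), ∀ z ∈ Metric.ball (0 : EuclideanSpace ℝ (Fin n)) 1,
      |t⁻¹ * ψ (x₀ + t • z)| ≤ M := by
    have hc : ContinuousOn (fun w : ℝ × EuclideanSpace ℝ (Fin n) => w.1⁻¹ * ψ (x₀ + w.1 • w.2))
        (Icc (r / 2) (2 * r) ×ˢ Metric.closedBall 0 1) := by
      refine ContinuousOn.mul (continuousOn_fst.inv₀ fun w hw => ?_)
        (hψ.comp (by fun_prop)).continuousOn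
      have := hw.1.1
      linarith
    obtain ⟨M, hM⟩ := (isCompact_Icc.prod (isCompact_closedBall 0 1)).exists_bound_of_continuousOn hc
    exact ⟨M, fun t ht' z hz => hM (t, z) ⟨Ioo_subset_Icc_self ht',
      Metric.ball_subset_closedBall hz⟩⟩
  obtain ⟨M, hM⟩ := hb
  have hcont : ∀ {k : EuclideanSpace ℝ (Fin n) → ℝ}, Continuous k → ∀ t : ℝ,
      Continuous fun z => k (x₀ + t • z) := fun hk t => hk.comp (by fun_prop)
  have hd := (hasDerivAt_integral_of_dominated_loc_of_deriv_le
    (μ := volume.restrict (Metric.ball (0 : EuclideanSpace ℝ (Fin n)) 1)) (x₀ := r)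
    (s := Ioo (r / 2) (2 * r)) (F := fun t z => φ (x₀ + t • z))
    (F' := fun t z => t⁻¹ * ψ (x₀ + t • z)) (bound := fun _ => M)
    (Ioo_mem_nhds (by linarith) (by linarith))
    (Eventually.of_forall fun t => (hcont hφ t).aestronglyMeasurable)
    (((hcont hφ r).continuousOn.integrableOn_compact (isCompact_closedBall 0 1)).mono_set
      Metric.ball_subset_closedBall)
    ((hcont hψ r).aestronglyMeasurable.const_mul _) ?_
    (integrableOn_const measure_ball_lt_top.ne) ?_).2
  · have h1 := (hasDerivAt_pow n r).mul hd
    refine (h1.congr_of_eventuallyEq ?_).congr_deriv ?_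
    · filter_upwards [Ioi_mem_nhds hr] with t ht'
      exact hscale t ht'
    · rw [hscale r hr, hscale r hr, integral_const_mul]
      -- The power rule involves the truncated difference n - 1, so dimension zero is separate.
      rcases n with _ | n
      · simp
      · simp only [Nat.add_sub_cancel, pow_succ]
        push_cast
        field_simp
  · filter_upwards [ae_restrict_mem Metric.isOpen_ball.measurableSet] with z hz t ht'
    exact hM t ht' z hz
  · exact Eventually.of_forall fun z t ht' => h z t (by linarith [ht'.1])

/-! ### The dilation field as a gradient -/

section HalfRadSq

variable {x₀ : EuclideanSpace ℝ (Fin n)}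

/-- The potential `r² / 2` of the dilation field. -/
def halfRadSq (x₀ : EuclideanSpace ℝ (Fin n)) (X : Space n) : ℝ := 1 / 2 * rad x₀ X ^ 2

lemma fderiv_halfRadSq (x₀ : EuclideanSpace ℝ (Fin n)) (X : Space n) :
    HasFDerivAt (halfRadSq x₀) (innerSL ℝ (X - pt x₀ 0)) X := by
  have h1 := ((hasStrictFDerivAt_norm_sq (X - pt x₀ 0)).hasFDerivAt.comp X
      ((hasFDerivAt_id X).sub_const (pt x₀ 0))).const_mul (1 / 2 : ℝ)
  exact h1.congr_fderiv (by ext; simp)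

lemma pd_halfRadSq (x₀ : EuclideanSpace ℝ (Fin n)) (i : Fin (n + 1)) :
    pd i (halfRadSq x₀) = fun X => (X - pt x₀ 0) i := by
  ext X
  simp [pd, (fderiv_halfRadSq x₀ X).fderiv, EuclideanSpace.inner_single_right]

lemma dy_halfRadSq (x₀ : EuclideanSpace ℝ (Fin n)) : dy (halfRadSq x₀) = ht := by
  rw [dy_eq_pd, pd_halfRadSq]
  ext X
  simp [ht]

lemma contDiff_halfRadSq (x₀ : EuclideanSpace ℝ (Fin n)) {k : WithTop ℕ∞} :
    ContDiff ℝ k (halfRadSq x₀) := by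
  unfold halfRadSq rad
  exact contDiff_const.mul ((contDiff_norm_sq ℝ).comp (contDiff_id.sub contDiff_const))

lemma conormal_halfRadSq (x₀ : EuclideanSpace ℝ (Fin n)) :
    EqOn (conormal s (halfRadSq x₀)) (fun X => ht X ^ (1 + wexp s)) (upperHalf n) := fun X hX => by
  simp only [conormal, dy_halfRadSq]
  rw [Real.rpow_add hX, Real.rpow_one, mul_comm]

lemma continuousOn_ht_rpow_one_add (hs₁ : -1 < wexp s) :
    ContinuousOn (fun X : Space n => ht X ^ (1 + wexp s)) (closedUpperHalf n) :=
  (continuous_ht.rpow_const fun _ => Or.inr (by linarith)).continuousOn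

lemma lapB_halfRadSq (x₀ : EuclideanSpace ℝ (Fin n)) :
    EqOn (lapB s (halfRadSq x₀)) (fun _ => (n : ℝ) + 1 + wexp s) (upperHalf n) := fun X hX => by
  have h1 : ∀ i, pd i (pd i (halfRadSq x₀)) X = 1 := fun i => by
    rw [pd_halfRadSq]
    have : HasFDerivAt (fun X : Space n => (X - pt x₀ 0) i)
        (EuclideanSpace.proj i : Space n →L[ℝ] ℝ) X := by
      have h2 := (EuclideanSpace.proj i : Space n →L[ℝ] ℝ).hasFDerivAt.comp X
        ((hasFDerivAt_id X).sub_const (pt x₀ 0))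
      exact h2.congr_fderiv (by ext; simp)
    rw [pd, this.fderiv]
    simp
  rw [lapB_eq_sum (contDiff_halfRadSq x₀).contDiffOn hX]
  have hy : ht X ≠ 0 := ne_of_gt hX
  simp only [h1, dy_halfRadSq]
  simp [hy]

lemma regOne_halfRadSq (hs₁ : -1 < wexp s) (x₀ : EuclideanSpace ℝ (Fin n)) :
    RegOne s (halfRadSq x₀) where
  contDiff := (contDiff_halfRadSq x₀).contDiffOn
  cont := ContUpToBoundary.of_continuous (contDiff_halfRadSq x₀ (k := 0)).continuous
  dx i := by
    rw [dx_eq_pd, pd_halfRadSq]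
    exact ContUpToBoundary.of_continuous (by fun_prop)
  conormal := (ContUpToBoundary.of_continuousOn (continuousOn_ht_rpow_one_add hs₁)).congr
    (conormal_halfRadSq x₀)

lemma euler_halfRadSq (x₀ : EuclideanSpace ℝ (Fin n)) (X : Space n) :
    euler x₀ (halfRadSq x₀) X = rad x₀ X ^ 2 := by
  rw [euler, (fderiv_halfRadSq x₀ X).fderiv, innerSL_apply_apply, real_inner_self_eq_norm_sq, rad]

lemma gradDot_halfRadSq (f : Space n → ℝ) (x₀ : EuclideanSpace ℝ (Fin n)) (X : Space n) :
    gradDot f (halfRadSq x₀) X = euler x₀ f X := by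
  rw [euler, clm_apply_eq_sum]
  simp only [gradDot, pd_halfRadSq]
  exact Finset.sum_congr rfl fun i _ => mul_comm _ _

/-- The divergence theorem in a half-ball for the field `y ^ b f (X - (x₀, 0))`. -/
lemma rad_mul_capInt [NeZero n] (hs₁ : -1 < wexp s) (hs₂ : wexp s < 1) {f : Space n → ℝ}
    (hf : RegOne s f) (x₀ : EuclideanSpace ℝ (Fin n)) {r : ℝ} (hr : 0 < r) :
    r * capInt x₀ r (fun X => ht X ^ wexp s * f X)
      = ∫ X in upperHalf n ∩ Metric.ball (pt x₀ 0) r,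
        ht X ^ wexp s * ((n + 1 + wexp s) * f X + euler x₀ f X) := by
  obtain ⟨F, hF, hFf⟩ := hf.cont
  -- Green's formula with h = r²/2: its gradient is the dilation field, Δ_b h is the constant n+1+b,
  -- and its conormal derivative y^(1+b) vanishes on the boundary.
  have h := green_halfBall hs₁ hs₂ hf (regOne_halfRadSq hs₁ x₀)
    ((ContUpToBoundary.of_continuous continuous_const).congr (lapB_halfRadSq x₀)) hF hFf
    (continuousOn_ht_rpow_one_add hs₁) (conormal_halfRadSq x₀).symm x₀ hr
  have e1 : (fun X : Space n => ht X ^ wexp s * (f X * euler x₀ (halfRadSq x₀) X))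
      = fun X => rad x₀ X ^ 2 * (ht X ^ wexp s * f X) := by
    ext X
    rw [euler_halfRadSq]
    ring
  rw [e1, capInt_mul_rad x₀ hr (fun t => t ^ 2)] at h
  simp only [ht_pt, Real.zero_rpow (show 1 + wexp s ≠ 0 by linarith), mul_zero, integral_zero,
    add_zero] at h
  have e2 : r * capInt x₀ r (fun X => ht X ^ wexp s * f X) = ∫ X in upperHalf n ∩
      Metric.ball (pt x₀ 0) r, (ht X ^ wexp s * (f X * lapB s (halfRadSq x₀) X)
        + ht X ^ wexp s * gradDot f (halfRadSq x₀) X) := by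
    refine mul_left_cancel₀ hr.ne' (Eq.trans ?_ h)
    ring
  rw [e2]
  refine setIntegral_congr_fun (isOpen_upperHalf.inter Metric.isOpen_ball).measurableSet
    fun X hX => ?_
  simp only [gradDot_halfRadSq, lapB_halfRadSq x₀ hX.1]
  ring

end HalfRadSq

/-! ### Scaled derivatives and averages -/

/-- The derivative `a w + (X - (x₀, 0)) · ∇ w` of the rescalings of `w` of homogeneity `-a`. -/
def scaleD (a : ℝ) (x₀ : EuclideanSpace ℝ (Fin n)) (w : Space n → ℝ) (X : Space n) : ℝ :=
  a * w X + euler x₀ w X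

/-- The operator `r² Δ_b`. -/
def lapR (s : ℝ) (x₀ : EuclideanSpace ℝ (Fin n)) (w : Space n → ℝ) (X : Space n) : ℝ :=
  rad x₀ X ^ 2 * lapB s w X

/-- The half-sphere average of `f h` for the rescalings of homogeneity `-a`. -/
def scaledAvg (s a : ℝ) (x₀ : EuclideanSpace ℝ (Fin n)) (f h : Space n → ℝ) (r : ℝ) : ℝ :=
  r ^ (2 * a) * capAvg (wexp s) x₀ r fun X => f X * h X

/-- The weighted normal derivative of `h` vanishes on the boundary. -/
def NeumannZero (s : ℝ) (h : Space n → ℝ) : Prop :=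
  ∃ H : Space n → ℝ, ContinuousOn H (closedUpperHalf n) ∧ EqOn H (conormal s h) (upperHalf n) ∧
    ∀ x, H (pt x 0) = 0

section Scale

variable {a : ℝ} {x₀ : EuclideanSpace ℝ (Fin n)} {f h : Space n → ℝ} {r : ℝ}

lemma scaledAvg_comm : scaledAvg s a x₀ f h = scaledAvg s a x₀ h f := by
  ext r
  simp only [scaledAvg, mul_comm (f _)]

lemma scaledAvg_congr {f' h' : Space n → ℝ} (hr : 0 < r) (hf : EqOn f f' (upperHalf n))
    (hh : EqOn h h' (upperHalf n)) : scaledAvg s a x₀ f h r = scaledAvg s a x₀ f' h' r := by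
  unfold scaledAvg
  rw [capAvg_congr hr]
  exact fun X hX => by simp only [hf hX, hh hX]

lemma scaledAvg_self_nonneg (hr : 0 < r) (f : Space n → ℝ) : 0 ≤ scaledAvg s a x₀ f f r :=
  mul_nonneg (Real.rpow_nonneg hr.le _) (capAvg_nonneg hr fun X _ => mul_self_nonneg (f X))

/-- The factor r^(2a) contributes 2a⟨f,h⟩; giving a to each factor turns the dilation derivative
into `scaleD`. -/
lemma hasDerivAt_scaledAvg (hs₁ : -1 < wexp s) (hr : 0 < r) (hf : ContUpToBoundary f)
    (hh : ContUpToBoundary h) (hf1 : ContDiffOn ℝ 1 f (upperHalf n))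
    (hh1 : ContDiffOn ℝ 1 h (upperHalf n)) (hfD : ContUpToBoundary (scaleD a x₀ f))
    (hhD : ContUpToBoundary (scaleD a x₀ h)) :
    HasDerivAt (scaledAvg s a x₀ f h)
      (r⁻¹ * (scaledAvg s a x₀ (scaleD a x₀ f) h r + scaledAvg s a x₀ f (scaleD a x₀ h) r)) r := by
  have hc1 := hfD.mul hh
  have hc2 := hf.mul hhD
  have hc0 := (hf.mul hh).const_mul (-(2 * a))
  have hprod : EqOn (euler x₀ fun X => f X * h X) (fun X => (scaleD a x₀ f X * h X
      + f X * scaleD a x₀ h X) + -(2 * a) * (f X * h X)) (upperHalf n) := fun X hX => by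
    rw [euler_mul (differentiableAt_of_contDiffOn hf1 one_ne_zero hX)
      (differentiableAt_of_contDiffOn hh1 one_ne_zero hX)]
    simp only [scaleD]
    ring
  have h1 := hasDerivAt_capAvg (x₀ := x₀) hs₁ hr (hf.mul hh) (hf1.mul hh1)
    (((hc1.add hc2).add hc0).congr hprod)
  rw [capAvg_congr hr hprod, capAvg_add hs₁ hr (hc1.add hc2) hc0, capAvg_add hs₁ hr hc1 hc2,
    capAvg_const_mul] at h1
  refine (((hasDerivAt_id r).rpow_const (p := 2 * a) (Or.inl hr.ne')).mul h1).congr_deriv ?_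
  simp only [id_eq, scaledAvg]
  rw [Real.rpow_sub_one hr.ne']
  field_simp
  ring

lemma regOne_lapR {g : Space n → ℝ} (hs₁ : -1 < wexp s) (hg : RegOne s g) :
    RegOne s fun X => rad x₀ X ^ 2 * g X := by
  refine (((regOne_halfRadSq hs₁ x₀).const_mul 2).mul hg).congr fun X _ => ?_
  simp only [halfRadSq]
  ring

/-- The operator r²Δ_b is homogeneous of degree zero: the 2 from differentiating r² is the 2 in
`lapB_euler`. -/
lemma scaleD_lapR (hh : ContDiffOn ℝ 3 h (upperHalf n))
    (hL : ContDiffOn ℝ 1 (lapB s h) (upperHalf n)) :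
    EqOn (scaleD a x₀ (lapR s x₀ h)) (lapR s x₀ (scaleD a x₀ h)) (upperHalf n) := fun X hX => by
  have e0 : lapR s x₀ h = fun X => 2 * halfRadSq x₀ X * lapB s h X := by
    ext X
    simp only [lapR, halfRadSq]
    ring
  have hd := differentiableAt_of_contDiffOn hL one_ne_zero hX
  have e1 : euler x₀ (lapR s x₀ h) X = rad x₀ X ^ 2 * (2 * lapB s h X + euler x₀ (lapB s h) X) := by
    rw [e0, euler_mul ((fderiv_halfRadSq x₀ X).differentiableAt.const_mul 2) hd,
      euler_const_mul 2 (fderiv_halfRadSq x₀ X).differentiableAt, euler_halfRadSq, halfRadSq]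
    ring
  have hh2 : ContDiffOn ℝ 2 h (upperHalf n) := hh.of_le (by norm_num)
  have e2 : lapB s (scaleD a x₀ h) X = a * lapB s h X + (2 * lapB s h X
      + euler x₀ (lapB s h) X) := by
    have h1 := lapB_add_eqOn (s := s) (contDiffOn_const (c := a) |>.mul hh2)
      (contDiffOn_euler hh (k := 2) (by norm_num) x₀) hX
    have h2 := lapB_const_mul_eqOn (s := s) a hh2 hX
    have h3 := lapB_euler (s := s) hh x₀ hX
    simp only at h1 h2 h3
    unfold scaleD
    rw [h1, h2, h3]
  simp only [scaleD, e1]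
  simp only [lapR]
  rw [e2]
  ring

lemma RegThree.scaleD (hs₁ : -1 < wexp s) (hs₂ : wexp s < 1) (hf : RegThree s f) :
    RegTwo s (scaleD a x₀ f) :=
  (hf.regTwo.const_mul a).add (hf.euler hs₁.le hs₂.le x₀)

lemma RegTwo.scaleD (hs₁ : -1 < wexp s) (hs₂ : wexp s < 1) (hf : RegTwo s f) :
    RegOne s (scaleD a x₀ f) :=
  (hf.regOne.const_mul a).add (hf.euler hs₁.le hs₂.le x₀)

lemma RegOne.scaleD (hs₂ : wexp s < 1) (hf : RegOne s f) : ContUpToBoundary (scaleD a x₀ f) :=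
  (hf.cont.const_mul a).add (hf.euler_cont hs₂.le x₀)

lemma NeumannZero.scaleD (hs₁ : -1 < wexp s) (hs₂ : wexp s < 1) (hh : RegTwo s h)
    (h0 : NeumannZero s h) : NeumannZero s (scaleD a x₀ h) := by
  obtain ⟨H, hH, hHh, hH0⟩ := h0
  obtain ⟨E, hE, hEh⟩ := (hh.euler hs₁.le hs₂.le x₀).conormal
  refine ⟨fun X => a * H X + E X, (continuousOn_const.mul hH).add hE, fun X hX => ?_, fun x => ?_⟩
  · have h1 := conormal_add_eqOn (s := s) (contDiffOn_const (c := a) |>.mul hh.regOne.contDiff)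
      (hh.euler hs₁.le hs₂.le x₀).contDiff two_ne_zero hX
    have h2 := conormal_const_mul_eqOn (s := s) a hh.regOne.contDiff two_ne_zero hX
    simp only at h1 h2
    simp only [hHh hX, hEh hX]
    unfold FracLaneEmden.scaleD
    rw [h1, h2]
  · simp only [hH0, mul_zero, zero_add]
    exact conormal_euler_boundary hs₁ hh hH hHh hH0 hE hEh x

/-- This is `capAvg_mul_lapB` with the dilation derivative written as D - a: the coefficients are
those of (D-a)² + (n+b-1)(D-a). -/
lemma scaledAvg_lapR [NeZero n] (hs₁ : -1 < wexp s) (hs₂ : wexp s < 1) (hf : RegOne s f)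
    (hh : RegTwo s h) (h0 : NeumannZero s h) (hr : 0 < r) :
    scaledAvg s a x₀ f (lapR s x₀ h) r - scaledAvg s a x₀ f (scaleD a x₀ (scaleD a x₀ h)) r
      - (n + wexp s - 1 - 2 * a) * scaledAvg s a x₀ f (scaleD a x₀ h) r
      + a * (n + wexp s - 1 - a) * scaledAvg s a x₀ f h r
      = -(r ^ (2 * a) * capDirichlet s x₀ r f h) := by
  obtain ⟨H, hH, hHh, hH0⟩ := h0
  have hE := hh.euler hs₁.le hs₂.le x₀
  have hEE := hE.euler_cont hs₂.le x₀
  have h1 := capAvg_mul_lapB (x₀ := x₀) hs₁ hs₂ hf hh.regOne hh.lap hEE hH hHh hH0 hr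
  have c0 := hf.cont.mul hh.regOne.cont
  have c1 := hf.cont.mul hE.cont
  have c2 := hf.cont.mul hEE
  have e1 : capAvg (wexp s) x₀ r (fun X => f X * scaleD a x₀ h X)
      = a * capAvg (wexp s) x₀ r (fun X => f X * h X)
        + capAvg (wexp s) x₀ r (fun X => f X * euler x₀ h X) := by
    rw [← capAvg_const_mul, ← capAvg_add hs₁ hr (c0.const_mul a) c1]
    refine capAvg_congr hr fun X _ => ?_
    simp only [scaleD]
    ring
  have e2 : capAvg (wexp s) x₀ r (fun X => f X * scaleD a x₀ (scaleD a x₀ h) X)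
      = a ^ 2 * capAvg (wexp s) x₀ r (fun X => f X * h X)
        + 2 * a * capAvg (wexp s) x₀ r (fun X => f X * euler x₀ h X)
        + capAvg (wexp s) x₀ r (fun X => f X * euler x₀ (euler x₀ h) X) := by
    rw [← capAvg_const_mul, ← capAvg_const_mul, ← capAvg_add hs₁ hr (c0.const_mul _)
      (c1.const_mul _), ← capAvg_add hs₁ hr ((c0.const_mul _).add (c1.const_mul _)) c2]
    refine capAvg_congr hr fun X hX => ?_
    have h2 : euler x₀ (scaleD a x₀ h) X = a * euler x₀ h X + euler x₀ (euler x₀ h) X := by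
      unfold scaleD
      rw [euler_add, euler_const_mul]
      · exact differentiableAt_of_contDiffOn hh.regOne.contDiff two_ne_zero hX
      · exact (differentiableAt_of_contDiffOn hh.regOne.contDiff two_ne_zero hX).const_mul a
      · exact differentiableAt_of_contDiffOn hE.contDiff two_ne_zero hX
    simp only [scaleD] at h2 ⊢
    rw [h2]
    ring
  have e3 : capAvg (wexp s) x₀ r (fun X => f X * lapR s x₀ h X)
      = r ^ 2 * capAvg (wexp s) x₀ r (fun X => f X * lapB s h X) := by
    rw [← capAvg_mul_rad_sq hr]
    refine capAvg_congr hr fun X _ => ?_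
    simp only [lapR]
    ring
  simp only [scaledAvg, e1, e2, e3]
  rw [← mul_neg, ← h1]
  ring

end Scale

/-! ### The volume part of the energy -/

section Energy

variable {p κ a : ℝ} {x₀ : EuclideanSpace ℝ (Fin n)} {u : Space n → ℝ} {r : ℝ}

lemma continuous_boundary {F : Space n → ℝ} (hF : ContinuousOn F (closedUpperHalf n)) :
    Continuous fun x : EuclideanSpace ℝ (Fin n) => F (pt x 0) :=
  hF.comp_continuous (continuous_pt.comp (continuous_id.prodMk continuous_const))
    fun x => by simp [closedUpperHalf]

lemma IsExtensionSolution.continuous_traceDensity (hp : 1 < p)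
    (hu : IsExtensionSolution n s p κ u) : Continuous (traceDensity p u) :=
  (continuous_boundary hu.cont).abs.rpow_const fun _ => Or.inr (by linarith)

lemma IsExtensionSolution.neumannZero (hu : IsExtensionSolution n s p κ u) : NeumannZero s u := by
  obtain ⟨H, hH, hHu⟩ := hu.reg_conormal_dx [] (by simp)
  exact ⟨H, hH, hHu, fun x => boundary_eq_of_tendsto hH hHu (hu.neumann x)⟩

lemma bulkDensity_eq (s : ℝ) (u : Space n → ℝ) :
    bulkDensity s u = fun X => ht X ^ wexp s * (1 / 2 * (lapB s u X * lapB s u X)) := by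
  ext X
  simp only [bulkDensity, sq_abs, wexp]
  ring

/-- The derivative is first a half-sphere integral; `rad_mul_capInt` makes it a solid one,
comparable with those in Green's formula. -/
lemma IsExtensionSolution.hasDerivAt_bulk [NeZero n] (hs₁ : -1 < wexp s) (hs₂ : wexp s < 1)
    (hu : IsExtensionSolution n s p κ u) (x₀ : EuclideanSpace ℝ (Fin n)) (hr : 0 < r) :
    HasDerivAt (fun t => ∫ X in upperHalf n ∩ Metric.ball (pt x₀ 0) t, bulkDensity s u X)
      (r⁻¹ * ∫ X in upperHalf n ∩ Metric.ball (pt x₀ 0) r, ht X ^ wexp s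
        * ((n + 1 + wexp s) / 2 * lapB s u X ^ 2 + lapB s u X * euler x₀ (lapB s u) X)) r := by
  have hg := hu.regThree.lap
  have hf : RegOne s fun X => 1 / 2 * (lapB s u X * lapB s u X) := (hg.mul hg).const_mul _
  have h1 := hasDerivAt_setIntegral_ball (x₀ := x₀)
    (fun R => integrableOn_ht_rpow_mul hs₁ (pt x₀ 0) R hf.cont)
    (continuousOn_capInt_weight_mul hs₁ hf.cont x₀) hr
  rw [bulkDensity_eq]
  refine h1.congr_deriv ?_
  rw [← mul_right_inj' hr.ne', rad_mul_capInt hs₁ hs₂ hf x₀ hr, mul_inv_cancel_left₀ hr.ne']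
  refine setIntegral_congr_fun (isOpen_upperHalf.inter Metric.isOpen_ball).measurableSet
    fun X hX => ?_
  have hd := differentiableAt_of_contDiffOn hg.contDiff two_ne_zero hX.1
  have e1 : euler x₀ (fun X => 1 / 2 * (lapB s u X * lapB s u X)) X
      = lapB s u X * euler x₀ (lapB s u) X := by
    rw [euler_const_mul _ (hd.fun_mul hd), euler_mul hd hd]
    ring
  simp only [e1]
  ring

lemma IsExtensionSolution.hasDerivAt_trace (hs₂ : wexp s < 1) (hp : 1 < p)
    (hu : IsExtensionSolution n s p κ u) {E : Space n → ℝ}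
    (hE : ContinuousOn E (closedUpperHalf n)) (hEu : EqOn E (euler x₀ u) (upperHalf n))
    (hr : 0 < r) :
    HasDerivAt (fun t => ∫ x in Metric.ball x₀ t, traceDensity p u x)
      (r⁻¹ * (n * (∫ x in Metric.ball x₀ r, traceDensity p u x)
        + ∫ x in Metric.ball x₀ r, (p + 1) * (|u (pt x 0)| ^ (p - 1) * u (pt x 0)) * E (pt x 0)))
      r := by
  have hreg := hu.regThree.regTwo.regOne
  choose K' hK' hKk' using hreg.dx
  have hc := continuous_boundary hu.cont
  refine hasDerivAt_setIntegral_ball_of_ray (hu.continuous_traceDensity hp)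
    (ψ := fun x => (p + 1) * (|u (pt x 0)| ^ (p - 1) * u (pt x 0)) * E (pt x 0)) ?_
    (fun z t ht' => ?_) hr
  · exact (continuous_const.mul ((hc.abs.rpow_const fun _ => Or.inr (by linarith)).mul hc)).mul
      (continuous_boundary hE)
  · have h1 := hasDerivAt_boundary (hreg.contDiff.of_le (by norm_num)) hu.cont (fun _ _ => rfl)
      hK' hKk' x₀ z t
    have h2 := (hasDerivAt_abs_rpow (u (pt (x₀ + t • z) 0)) (show 1 < p + 1 by linarith)).comp t h1
    refine h2.congr_deriv ?_
    rw [euler_boundary hs₂ hreg hE hEu hK' hKk']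
    have e1 : p + 1 - 2 = p - 1 := by ring
    simp only [e1, PiLp.add_apply, PiLp.smul_apply, smul_eq_mul, add_sub_cancel_left, mul_assoc,
      ← Finset.mul_sum]
    field_simp

/-- Differentiating the solid integrals under dilation produces ∫ y^b Δ_b u Δ_b(Du) minus the flux
of the nonlinearity against Du. Green's second identity converts this to half-sphere integrals. -/
theorem IsExtensionSolution.hasDerivAt_volume_energy [NeZero n] (hs₁ : -1 < wexp s)
    (hs₂ : wexp s < 1) (hp : 1 < p) (ha : a = 2 * s / (p - 1))
    (hu : IsExtensionSolution n s p κ u) (x₀ : EuclideanSpace ℝ (Fin n)) (hr : 0 < r) :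
    HasDerivAt (fun t => t ^ (2 * s * ((p + 1) / (p - 1)) - (n : ℝ)) *
      ((∫ X in upperHalf n ∩ Metric.ball (pt x₀ 0) t, bulkDensity s u X)
        - κ / (p + 1) * ∫ x in Metric.ball x₀ t, traceDensity p u x))
      (r⁻¹ * (scaledAvg s a x₀ (scaleD a x₀ (scaleD a x₀ u)) (lapR s x₀ u) r
        + 2 * scaledAvg s a x₀ (scaleD a x₀ u) (lapR s x₀ u) r
        - scaledAvg s a x₀ (scaleD a x₀ u) (lapR s x₀ (scaleD a x₀ u)) r)) r := by
  have hp1 : p - 1 ≠ 0 := by linarith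
  have hpp : p + 1 ≠ 0 := by linarith
  have hγ : 2 * s * ((p + 1) / (p - 1)) - (n : ℝ) = 2 * a + 2 * s - n := by
    rw [ha]; field_simp; ring
  -- Equivalently ap = a + 2s: the dilations scale |u|^(p-1)u exactly as y^b∂_yΔ_b u.
  have hap : a * (p + 1) = 2 * a + 2 * s := by
    rw [ha]; field_simp; ring
  have hu3 := hu.regThree
  have hg := hu3.lap
  have hw := hu3.scaleD (a := a) (x₀ := x₀) hs₁ hs₂
  have hEr := hu3.regTwo.euler hs₁.le hs₂.le x₀
  obtain ⟨E, hE, hEu⟩ := hEr.cont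
  obtain ⟨G, hG, hGg⟩ := hg.cont
  obtain ⟨H, hH, hHg⟩ := hg.conormal
  obtain ⟨H1, hH1, hH1w, hH10⟩ := hu.neumannZero.scaleD (a := a) (x₀ := x₀) hs₁ hs₂ hu3.regTwo
  have hHb : ∀ x, H (pt x 0) = κ * (|u (pt x 0)| ^ (p - 1) * u (pt x 0)) := fun x =>
    boundary_eq_of_tendsto hH hHg (hu.nonlinear x)
  have hzero : EqOn (lapB s (lapB s u)) (fun _ => 0) (upperHalf n) := hu.eqn
  have hWc : ContinuousOn (fun X => a * u X + E X) (closedUpperHalf n) :=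
    (continuousOn_const.mul hu.cont).add hE
  have hWu : EqOn (fun X => a * u X + E X) (scaleD a x₀ u) (upperHalf n) := fun X hX => by
    simp only [scaleD, hEu hX]
  have hms := (isOpen_upperHalf.inter (Metric.isOpen_ball (x := pt x₀ 0) (ε := r))).measurableSet
  -- Green's formula for Δ_b u and Du in both orders; the gradient terms cancel in the difference.
  -- In `gA` the flat term vanishes since Du has zero Neumann datum. In `gB` the volume term
  -- vanishes since Δ_b²u = 0, and the flat term carries the nonlinearity.
  have gA := green_halfBall hs₁ hs₂ hg hw.regOne hw.lap hG hGg hH1 hH1w x₀ hr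
  have gB := green_halfBall hs₁ hs₂ hw.regOne hg
    ((ContUpToBoundary.of_continuous continuous_const).congr hzero) hWc hWu hH hHg x₀ hr
  have hiL := integrableOn_ht_rpow_mul hs₁ (pt x₀ 0) r (hg.cont.mul hw.lap)
  have hiG := integrableOn_weight_mul_gradDot hs₁ hs₂ hg hw.regOne (pt x₀ 0) r
  simp only [hH10, mul_zero, integral_zero, add_zero] at gA
  rw [integral_add hiL hiG] at gA
  rw [setIntegral_congr_fun (g := fun X => ht X ^ wexp s * gradDot (lapB s u) (scaleD a x₀ u) X)
    hms fun X hX => by simp only [hzero hX.1, mul_zero, zero_add, gradDot_comm (scaleD a x₀ u)]]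
    at gB
  have hgD : ContUpToBoundary (euler x₀ (lapB s u)) := hg.euler_cont hs₂.le x₀
  have hwD := hw.regOne.euler_cont hs₂.le x₀
  have hi2 := integrableOn_ht_rpow_mul hs₁ (pt x₀ 0) r (hg.cont.mul hg.cont)
  have hi3 := integrableOn_ht_rpow_mul hs₁ (pt x₀ 0) r (hg.cont.mul hgD)
  have hlapw : EqOn (lapB s (scaleD a x₀ u)) (fun X => (a + 2) * lapB s u X
      + euler x₀ (lapB s u) X) (upperHalf n) := fun X hX => by
    have h1 := lapB_add_eqOn (s := s) (contDiffOn_const (c := a) |>.mul hu3.regTwo.regOne.contDiff)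
      hEr.contDiff hX
    have h2 := lapB_const_mul_eqOn (s := s) a hu3.regTwo.regOne.contDiff hX
    have h3 := lapB_euler (s := s) hu3.regTwo.contDiff x₀ hX
    simp only at h1 h2 h3
    unfold scaleD
    rw [h1, h2, h3]
    ring
  set B := ∫ X in upperHalf n ∩ Metric.ball (pt x₀ 0) r, bulkDensity s u X with hB
  set T := ∫ x in Metric.ball x₀ r, traceDensity p u x with hT
  set I2 := ∫ X in upperHalf n ∩ Metric.ball (pt x₀ 0) r, ht X ^ wexp s
    * (lapB s u X * lapB s u X) with hI2
  set I3 := ∫ X in upperHalf n ∩ Metric.ball (pt x₀ 0) r, ht X ^ wexp s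
    * (lapB s u X * euler x₀ (lapB s u) X) with hI3
  set Tψ := ∫ x in Metric.ball x₀ r, (|u (pt x 0)| ^ (p - 1) * u (pt x 0)) * E (pt x 0) with hTψ
  have eB : B = 1 / 2 * I2 := by
    rw [hB, bulkDensity_eq, hI2, ← integral_const_mul]
    congr 1
    ext X
    ring
  have eL : ∫ X in upperHalf n ∩ Metric.ball (pt x₀ 0) r, ht X ^ wexp s
      * (lapB s u X * lapB s (scaleD a x₀ u) X) = (a + 2) * I2 + I3 := by
    rw [hI2, hI3, ← integral_const_mul, ← integral_add (hi2.const_mul _) hi3]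
    refine setIntegral_congr_fun hms fun X hX => ?_
    simp only [hlapw hX.1]
    ring
  have eD : ∫ X in upperHalf n ∩ Metric.ball (pt x₀ 0) r, ht X ^ wexp s
        * ((n + 1 + wexp s) / 2 * lapB s u X ^ 2 + lapB s u X * euler x₀ (lapB s u) X)
      = (n + 1 + wexp s) / 2 * I2 + I3 := by
    rw [hI2, hI3, ← integral_const_mul, ← integral_add (hi2.const_mul _) hi3]
    congr 1
    ext X
    ring
  have hub : Continuous fun x : EuclideanSpace ℝ (Fin n) => |u (pt x 0)| ^ (p - 1) * u (pt x 0) :=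
    ((continuous_boundary hu.cont).abs.rpow_const fun _ => Or.inr (by linarith)).mul
      (continuous_boundary hu.cont)
  have hball : ∀ {k : EuclideanSpace ℝ (Fin n) → ℝ}, Continuous k →
      IntegrableOn k (Metric.ball x₀ r) := fun hk =>
    (hk.continuousOn.integrableOn_compact (isCompact_closedBall x₀ r)).mono_set
      Metric.ball_subset_closedBall
  have eT : ∫ x in Metric.ball x₀ r, (a * u (pt x 0) + E (pt x 0)) * H (pt x 0)
      = κ * (a * T + Tψ) := by
    have hiT : IntegrableOn (fun x => a * traceDensity p u x) (Metric.ball x₀ r) :=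
      (hball (hu.continuous_traceDensity hp)).const_mul a
    have hiE : IntegrableOn (fun x => |u (pt x 0)| ^ (p - 1) * u (pt x 0) * E (pt x 0))
      (Metric.ball x₀ r) := hball (hub.mul (continuous_boundary hE))
    rw [hT, hTψ, ← integral_const_mul, ← integral_add hiT hiE, ← integral_const_mul]
    congr 1
    ext x
    have e1 : traceDensity p u x = |u (pt x 0)| ^ (p - 1) * u (pt x 0) * u (pt x 0) := by
      rw [traceDensity, show p + 1 = (p - 1) + (2 : ℕ) by push_cast; ring,
        Real.rpow_add_natCast' (abs_nonneg _) (by push_cast; linarith), sq_abs]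
      ring
    rw [hHb, e1]
    ring
  have eT' : ∫ x in Metric.ball x₀ r, (p + 1) * (|u (pt x 0)| ^ (p - 1) * u (pt x 0)) * E (pt x 0)
      = (p + 1) * Tψ := by
    rw [hTψ, ← integral_const_mul]
    congr 1
    ext x
    ring
  rw [eL, capInt_weight_mul _ _ hr] at gA
  rw [eT, capInt_weight_mul _ _ hr] at gB
  have hd := ((hasDerivAt_id r).rpow_const (p := 2 * s * ((p + 1) / (p - 1)) - (n : ℝ))
    (Or.inl hr.ne')).mul ((hu.hasDerivAt_bulk hs₁ hs₂ x₀ hr).sub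
      ((hu.hasDerivAt_trace hs₂ hp hE hEu hr).const_mul (κ / (p + 1))))
  refine hd.congr_deriv ?_
  rw [eD, eT']
  simp only [id_eq, Pi.sub_apply]
  rw [← hB, ← hT, eB, hγ, Real.rpow_sub_one hr.ne']
  have cw : ContUpToBoundary fun X => lapB s u X * scaleD a x₀ u X := hg.cont.mul hw.regOne.cont
  have e1 : capAvg (wexp s) x₀ r (fun X => scaleD a x₀ (scaleD a x₀ u) X * lapR s x₀ u X)
      = r ^ 2 * (a * capAvg (wexp s) x₀ r (fun X => lapB s u X * scaleD a x₀ u X)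
        + capAvg (wexp s) x₀ r (fun X => lapB s u X * euler x₀ (scaleD a x₀ u) X)) := by
    rw [← capAvg_const_mul, ← capAvg_add hs₁ hr (cw.const_mul a) (hg.cont.mul hwD),
      ← capAvg_mul_rad_sq hr]
    refine capAvg_congr hr fun X _ => ?_
    simp only [lapR]
    conv_lhs => rw [scaleD]
    ring
  have e2 : capAvg (wexp s) x₀ r (fun X => scaleD a x₀ u X * lapR s x₀ u X)
      = r ^ 2 * capAvg (wexp s) x₀ r (fun X => lapB s u X * scaleD a x₀ u X) := by
    rw [← capAvg_mul_rad_sq hr]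
    refine capAvg_congr hr fun X _ => ?_
    simp only [lapR]
    ring
  have e3 : capAvg (wexp s) x₀ r (fun X => scaleD a x₀ u X * lapR s x₀ (scaleD a x₀ u) X)
      = r ^ 2 * ((a + 2) * capAvg (wexp s) x₀ r (fun X => lapB s u X * scaleD a x₀ u X)
        + capAvg (wexp s) x₀ r (fun X => scaleD a x₀ u X * euler x₀ (lapB s u) X)) := by
    rw [← capAvg_const_mul, ← capAvg_add hs₁ hr (cw.const_mul _) (hw.regOne.cont.mul hgD),
      ← capAvg_mul_rad_sq hr]
    refine capAvg_congr hr fun X hX => ?_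
    simp only [lapR, hlapw hX]
    ring
  simp only [scaledAvg, e1, e2, e3]
  set A1 := capAvg (wexp s) x₀ r (fun X => lapB s u X * euler x₀ (scaleD a x₀ u) X)
  set A2 := capAvg (wexp s) x₀ r (fun X => scaleD a x₀ u X * euler x₀ (lapB s u) X)
  set A3 := capAvg (wexp s) x₀ r (fun X => lapB s u X * scaleD a x₀ u X)
  set I4 := ∫ X in upperHalf n ∩ Metric.ball (pt x₀ 0) r, ht X ^ wexp s
    * gradDot (lapB s u) (scaleD a x₀ u) X
  -- Both exponents total 2a+3 because b = 3-2s.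
  have hpow : r ^ (2 * a + 2 * s - n) * r ^ ((n : ℝ) + wexp s) = r ^ (2 * a) * r ^ 2 * r := by
    rw [← Real.rpow_add hr, mul_assoc, ← pow_succ, ← Real.rpow_natCast, ← Real.rpow_add hr]
    congr 1
    simp only [wexp]
    push_cast
    ring
  have hdiff : r ^ ((n : ℝ) + wexp s) * (A1 - A2) = r * ((a + 2) * I2 + I3 - κ * (a * T + Tψ)) := by
    linarith
  have hmain : r ^ (2 * a) * r ^ 2 * (A1 - A2)
      = r ^ (2 * a + 2 * s - n) * ((a + 2) * I2 + I3 - κ * (a * T + Tψ)) := by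
    refine mul_left_cancel₀ hr.ne' ?_
    calc r * (r ^ (2 * a) * r ^ 2 * (A1 - A2))
        = (r ^ (2 * a) * r ^ 2 * r) * (A1 - A2) := by ring
      _ = r ^ (2 * a + 2 * s - n) * (r ^ ((n : ℝ) + wexp s) * (A1 - A2)) := by rw [← hpow]; ring
      _ = _ := by rw [hdiff]; ring
  have hb : wexp s = 3 - 2 * s := rfl
  -- For I2, half of (2a+2s-n) + (n+1+b) is a+2; for T, 2a+2s = a(p+1).
  have hsum : (2 * a + 2 * s - n) * (1 / 2 * I2 - κ / (p + 1) * T)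
      + ((n + 1 + wexp s) / 2 * I2 + I3 - κ / (p + 1) * (n * T + (p + 1) * Tψ))
      = (a + 2) * I2 + I3 - κ * (a * T + Tψ) := by
    have h1 : κ / (p + 1) * (2 * a + 2 * s) = κ * a := by
      rw [← hap]; field_simp
    have h2 : κ / (p + 1) * (p + 1) = κ := by field_simp
    rw [hb]
    linear_combination (-T) * h1 + (-Tψ) * h2
  rw [← hsum] at hmain
  field_simp
  field_simp at hmain
  linarith

end Energy

/-! ### The terms of the energy -/

section Terms

variable {p κ a : ℝ} {x₀ : EuclideanSpace ℝ (Fin n)} {f h u : Space n → ℝ} {r : ℝ}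

/-- The tangential Dirichlet form for the rescalings of homogeneity `-a`. -/
def scaledDirichlet (s a : ℝ) (x₀ : EuclideanSpace ℝ (Fin n)) (f h : Space n → ℝ) (r : ℝ) : ℝ :=
  r ^ (2 * a) * capDirichlet s x₀ r f h

lemma scaledDirichlet_comm : scaledDirichlet s a x₀ f h = scaledDirichlet s a x₀ h f := by
  ext r
  simp only [scaledDirichlet, capDirichlet_comm f h]

lemma scaledDirichlet_eq [NeZero n] (hs₁ : -1 < wexp s) (hs₂ : wexp s < 1) (hf : RegOne s f)
    (hh : RegTwo s h) (h0 : NeumannZero s h) (hr : 0 < r) :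
    scaledDirichlet s a x₀ f h r = -scaledAvg s a x₀ f (lapR s x₀ h) r
      + scaledAvg s a x₀ f (scaleD a x₀ (scaleD a x₀ h)) r
      + (n + wexp s - 1 - 2 * a) * scaledAvg s a x₀ f (scaleD a x₀ h) r
      - a * (n + wexp s - 1 - a) * scaledAvg s a x₀ f h r := by
  have := scaledAvg_lapR (a := a) (x₀ := x₀) hs₁ hs₂ hf hh h0 hr
  rw [scaledDirichlet]
  linarith

/-- The gradient product is not differentiated directly. `scaledDirichlet_eq` replaces the form by
averages, the product rule applies to each, and the result is folded back, since D commutes with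
r²Δ_b and Dh keeps zero Neumann datum. -/
lemma hasDerivAt_scaledDirichlet [NeZero n] (hs₁ : -1 < wexp s) (hs₂ : wexp s < 1)
    (hf : RegTwo s f) (hh : RegThree s h) (h0 : NeumannZero s h) (hr : 0 < r) :
    HasDerivAt (scaledDirichlet s a x₀ f h)
      (r⁻¹ * (scaledDirichlet s a x₀ (scaleD a x₀ f) h r
        + scaledDirichlet s a x₀ f (scaleD a x₀ h) r)) r := by
  have hf1 := hf.regOne
  have hfD := hf.scaleD (a := a) (x₀ := x₀) hs₁ hs₂
  have hhD := hh.scaleD (a := a) (x₀ := x₀) hs₁ hs₂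
  have hhDD := hhD.scaleD (a := a) (x₀ := x₀) hs₁ hs₂
  have hl : RegOne s (lapR s x₀ h) := regOne_lapR hs₁ hh.lap
  have hc : ∀ {g : Space n → ℝ}, RegOne s g → ContDiffOn ℝ 1 g (upperHalf n) := fun hg =>
    hg.contDiff.of_le (by norm_num)
  have hlD : EqOn (scaleD a x₀ (lapR s x₀ h)) (lapR s x₀ (scaleD a x₀ h)) (upperHalf n) :=
    scaleD_lapR hh.regTwo.contDiff (hc hh.lap)
  have d0 := hasDerivAt_scaledAvg hs₁ hr hf1.cont hl.cont (hc hf1) (hc hl) hfD.cont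
    (hl.scaleD (a := a) (x₀ := x₀) hs₂)
  rw [scaledAvg_congr (f := f) hr (fun _ _ => rfl) hlD] at d0
  have d1 := hasDerivAt_scaledAvg hs₁ hr hf1.cont hhDD.cont (hc hf1) (hc hhDD) hfD.cont
    (hhDD.scaleD (a := a) (x₀ := x₀) hs₂)
  have d2 := hasDerivAt_scaledAvg hs₁ hr hf1.cont hhD.regOne.cont (hc hf1) (hc hhD.regOne)
    hfD.cont hhDD.cont
  have d3 := hasDerivAt_scaledAvg hs₁ hr hf1.cont hh.regTwo.regOne.cont (hc hf1)
    (hc hh.regTwo.regOne) hfD.cont hhD.regOne.cont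
  have hd := ((d0.neg.add d1).add (d2.const_mul (n + wexp s - 1 - 2 * a))).sub
    (d3.const_mul (a * (n + wexp s - 1 - a)))
  refine (hd.congr_of_eventuallyEq ?_).congr_deriv ?_
  · filter_upwards [lt_mem_nhds hr] with t ht'
    exact scaledDirichlet_eq hs₁ hs₂ hf1 hh.regTwo h0 ht'
  · rw [scaledDirichlet_eq hs₁ hs₂ hfD hh.regTwo h0 hr, scaledDirichlet_eq hs₁ hs₂ hf1 hhD
      (h0.scaleD hs₁ hs₂ hh.regTwo) hr]
    ring

lemma dr_eq (x₀ : EuclideanSpace ℝ (Fin n)) (u : Space n → ℝ) (X : Space n) :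
    dr x₀ u X = (rad x₀ X)⁻¹ * euler x₀ u X := by
  rw [dr, map_smul, smul_eq_mul, euler]

lemma norm_gradient_sq (u : Space n → ℝ) (X : Space n) :
    ‖gradient u X‖ ^ 2 = gradDot u u X := by
  rw [EuclideanSpace.norm_sq_eq, gradDot]
  refine Finset.sum_congr rfl fun i _ => ?_
  have h1 : gradient u X i = pd i u X := by
    have h2 := InnerProductSpace.toDual_symm_apply (𝕜 := ℝ) (x := EuclideanSpace.single i (1 : ℝ))
      (y := fderiv ℝ u X)
    rw [EuclideanSpace.inner_single_right] at h2
    simpa [gradient, pd] using h2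
  rw [h1, Real.norm_eq_abs, sq_abs, sq]

lemma massDensity_eq (s : ℝ) (u : Space n → ℝ) :
    massDensity s u = fun X => ht X ^ wexp s * (u X * u X) := by
  ext X
  simp only [massDensity, wexp, sq]

lemma homDensity_eq (ha : a = 2 * s / (p - 1)) (x₀ : EuclideanSpace ℝ (Fin n))
    (u : Space n → ℝ) : homDensity s p x₀ u = fun X => (rad x₀ X)⁻¹ ^ 2
      * (ht X ^ wexp s * (scaleD a x₀ u X * scaleD a x₀ u X)) := by
  ext X
  simp only [homDensity, wexp, scaleD, dr_eq, ha]
  ring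

lemma tanDensity_eq (s : ℝ) (x₀ : EuclideanSpace ℝ (Fin n)) (u : Space n → ℝ) :
    tanDensity s x₀ u = fun X => ht X ^ wexp s * gradDot u u X
      + -(rad x₀ X)⁻¹ ^ 2 * (ht X ^ wexp s * (euler x₀ u X * euler x₀ u X)) := by
  ext X
  simp only [tanDensity, wexp, dr_eq, norm_gradient_sq, sq_abs]
  ring

lemma CapIntegrable.mul_rad (hf : CapIntegrable x₀ r f) (hr : 0 < r) (k : ℝ → ℝ) :
    CapIntegrable x₀ r fun X => k (rad x₀ X) * f X := by
  simp only [CapIntegrable, rad_add_smul x₀ hr]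
  exact hf.const_mul (k r)

lemma capIntegrable_massDensity (hs₁ : -1 < wexp s) (hu : ContUpToBoundary u) (hr : 0 < r) :
    CapIntegrable x₀ r (massDensity s u) := by
  rw [massDensity_eq]
  exact capIntegrable_weight_mul hs₁ (hu.mul hu) x₀ hr

lemma capIntegrable_homDensity (hs₁ : -1 < wexp s) (hs₂ : wexp s < 1) (hu : RegOne s u)
    (hr : 0 < r) : CapIntegrable x₀ r (homDensity s p x₀ u) := by
  have hw := hu.scaleD (a := 2 * s / (p - 1)) (x₀ := x₀) hs₂
  rw [homDensity_eq rfl]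
  exact (capIntegrable_weight_mul hs₁ (hw.mul hw) x₀ hr).mul_rad hr fun t => t⁻¹ ^ 2

lemma capIntegrable_rad_mul_euler_sq (hs₁ : -1 < wexp s) (hs₂ : wexp s < 1) (hu : RegOne s u)
    (hr : 0 < r) : CapIntegrable x₀ r fun X =>
      -(rad x₀ X)⁻¹ ^ 2 * (ht X ^ wexp s * (euler x₀ u X * euler x₀ u X)) := by
  have hw := hu.euler_cont hs₂.le x₀
  exact (capIntegrable_weight_mul hs₁ (hw.mul hw) x₀ hr).mul_rad hr fun t => -t⁻¹ ^ 2

lemma capIntegrable_tanDensity (hs₁ : -1 < wexp s) (hs₂ : wexp s < 1) (hu : RegOne s u)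
    (hr : 0 < r) : CapIntegrable x₀ r (tanDensity s x₀ u) := by
  rw [tanDensity_eq]
  exact (capIntegrable_weight_mul_gradDot hs₁ hs₂ hu hu x₀ hr).add
    (capIntegrable_rad_mul_euler_sq hs₁ hs₂ hu hr)

/-- The free exponent e covers the same density with different powers of r: here 0 in the energy and
1 in `massTerm`. -/
lemma rpow_mul_capInt_massDensity (hr : 0 < r) (e : ℝ) :
    r ^ (e - n - wexp s + 2 * a) * capInt x₀ r (massDensity s u)
      = r ^ e * scaledAvg s a x₀ u u r := by
  rw [massDensity_eq, capInt_weight_mul _ _ hr, scaledAvg, ← mul_assoc, ← mul_assoc,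
    ← Real.rpow_add hr, ← Real.rpow_add hr]
  congr 2
  ring

lemma rpow_mul_capInt_homDensity (ha : a = 2 * s / (p - 1)) (hr : 0 < r) (e : ℝ) :
    r ^ (e - n - wexp s + 2 * a + 2) * capInt x₀ r (homDensity s p x₀ u)
      = r ^ e * scaledAvg s a x₀ (scaleD a x₀ u) (scaleD a x₀ u) r := by
  rw [homDensity_eq ha, capInt_mul_rad x₀ hr (fun t => t⁻¹ ^ 2), capInt_weight_mul _ _ hr,
    scaledAvg, inv_pow, ← Real.rpow_natCast, ← Real.rpow_neg hr.le, ← mul_assoc, ← mul_assoc,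
    ← mul_assoc, ← Real.rpow_add hr, ← Real.rpow_add hr, ← Real.rpow_add hr]
  congr 2
  push_cast
  ring

lemma rpow_mul_capInt_tanDensity (hs₁ : -1 < wexp s) (hs₂ : wexp s < 1) (hu : RegOne s u)
    (hr : 0 < r) (e : ℝ) :
    r ^ (e - n - wexp s + 2 * a + 2) * capInt x₀ r (tanDensity s x₀ u)
      = r ^ e * scaledDirichlet s a x₀ u u r := by
  have h1 : r ^ (e - n - wexp s + 2 * a + 2) * r ^ ((n : ℝ) + wexp s)
      = r ^ e * r ^ (2 * a) * r ^ 2 := by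
    rw [← Real.rpow_natCast, ← Real.rpow_add hr, ← Real.rpow_add hr, ← Real.rpow_add hr]
    congr 1
    push_cast
    ring
  rw [tanDensity_eq, capInt_add (capIntegrable_weight_mul_gradDot hs₁ hs₂ hu hu x₀ hr)
    (capIntegrable_rad_mul_euler_sq hs₁ hs₂ hu hr), capInt_mul_rad x₀ hr (fun t => -t⁻¹ ^ 2),
    capInt_weight_mul _ _ hr, capInt_weight_mul _ _ hr, scaledDirichlet, capDirichlet]
  set G := capAvg (wexp s) x₀ r (gradDot u u)
  set K := capAvg (wexp s) x₀ r fun X => euler x₀ u X * euler x₀ u X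
  calc _ = r ^ (e - n - wexp s + 2 * a + 2) * r ^ ((n : ℝ) + wexp s) * (G - r⁻¹ ^ 2 * K) := by ring
    _ = _ := by
      rw [h1]
      field_simp

lemma massTerm_eq (ha : a = 2 * s / (p - 1)) (hr : 0 < r) :
    massTerm s p x₀ u r = r * scaledAvg s a x₀ u u r := by
  have h := rpow_mul_capInt_massDensity (s := s) (a := a) (x₀ := x₀) (u := u) hr 1
  rw [Real.rpow_one] at h
  rw [← h, massTerm]
  congr 2
  rw [ha, wexp]
  ring

lemma homTerm_eq (ha : a = 2 * s / (p - 1)) (hr : 0 < r) :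
    homTerm s p x₀ u r = r ^ (-2 : ℝ) * scaledAvg s a x₀ (scaleD a x₀ u) (scaleD a x₀ u) r := by
  rw [← rpow_mul_capInt_homDensity ha hr, homTerm]
  congr 2
  rw [ha, wexp]
  ring

lemma tanTerm_eq (hs₁ : -1 < wexp s) (hs₂ : wexp s < 1) (hp : 1 < p) (ha : a = 2 * s / (p - 1))
    (hu : RegOne s u) (hr : 0 < r) : tanTerm s p x₀ u r = r * scaledDirichlet s a x₀ u u r := by
  have hp1 : p - 1 ≠ 0 := by linarith
  have h := rpow_mul_capInt_tanDensity (a := a) (x₀ := x₀) hs₁ hs₂ hu hr 1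
  rw [Real.rpow_one] at h
  rw [← h, tanTerm]
  congr 2
  rw [ha, wexp]
  field_simp
  ring

lemma hasDerivAt_massTerm (hs₁ : -1 < wexp s) (hs₂ : wexp s < 1) (ha : a = 2 * s / (p - 1))
    (hu : RegOne s u) (hr : 0 < r) : HasDerivAt (massTerm s p x₀ u)
      (scaledAvg s a x₀ u u r + 2 * scaledAvg s a x₀ u (scaleD a x₀ u) r) r := by
  have hc := hu.contDiff.of_le (m := 1) (by norm_num)
  have hw := hu.scaleD (a := a) (x₀ := x₀) hs₂
  have hd := (hasDerivAt_id r).mul (hasDerivAt_scaledAvg hs₁ hr hu.cont hu.cont hc hc hw hw)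
  refine (hd.congr_of_eventuallyEq ?_).congr_deriv ?_
  · filter_upwards [lt_mem_nhds hr] with t ht'
    exact massTerm_eq ha ht'
  · rw [scaledAvg_comm (f := scaleD a x₀ u), id_eq, mul_inv_cancel_left₀ hr.ne']
    ring

lemma hasDerivAt_homTerm (hs₁ : -1 < wexp s) (hs₂ : wexp s < 1) (ha : a = 2 * s / (p - 1))
    (hu : RegTwo s u) (hr : 0 < r) : HasDerivAt (homTerm s p x₀ u)
      (2 / r ^ 3 * (scaledAvg s a x₀ (scaleD a x₀ u) (scaleD a x₀ (scaleD a x₀ u)) r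
        - scaledAvg s a x₀ (scaleD a x₀ u) (scaleD a x₀ u) r)) r := by
  have hw := hu.scaleD (a := a) (x₀ := x₀) hs₁ hs₂
  have hc := hw.contDiff.of_le (m := 1) (by norm_num)
  have hw2 := hw.scaleD (a := a) (x₀ := x₀) hs₂
  have hd := ((hasDerivAt_id r).rpow_const (p := -2) (Or.inl hr.ne')).mul
    (hasDerivAt_scaledAvg hs₁ hr hw.cont hw.cont hc hc hw2 hw2)
  refine (hd.congr_of_eventuallyEq ?_).congr_deriv ?_
  · filter_upwards [lt_mem_nhds hr] with t ht'
    exact homTerm_eq ha ht'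
  · rw [scaledAvg_comm (f := scaleD a x₀ (scaleD a x₀ u)), id_eq, Real.rpow_sub_one hr.ne',
      Real.rpow_neg hr.le, Real.rpow_two]
    field_simp
    ring

lemma hasDerivAt_tanTerm [NeZero n] (hs₁ : -1 < wexp s) (hs₂ : wexp s < 1) (hp : 1 < p)
    (ha : a = 2 * s / (p - 1)) (hu : RegThree s u) (h0 : NeumannZero s u) (hr : 0 < r) :
    HasDerivAt (tanTerm s p x₀ u) (scaledDirichlet s a x₀ u u r
      + 2 * scaledDirichlet s a x₀ (scaleD a x₀ u) u r) r := by
  have hd := (hasDerivAt_id r).mul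
    (hasDerivAt_scaledDirichlet (a := a) (x₀ := x₀) hs₁ hs₂ hu.regTwo hu h0 hr)
  refine (hd.congr_of_eventuallyEq ?_).congr_deriv ?_
  · filter_upwards [lt_mem_nhds hr] with t ht'
    exact tanTerm_eq hs₁ hs₂ hp ha hu.regTwo.regOne ht'
  · rw [scaledDirichlet_comm (f := u) (h := scaleD a x₀ u), id_eq, mul_inv_cancel_left₀ hr.ne']
    ring

end Terms

/-! ### Monotonicity -/

section Monotonicity

variable {p κ a : ℝ} {x₀ : EuclideanSpace ℝ (Fin n)} {u : Space n → ℝ} {r : ℝ}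

lemma IsExtensionSolution.energyDefined [NeZero n] (hs₁ : -1 < wexp s) (hs₂ : wexp s < 1)
    (hp : 1 < p) (hu : IsExtensionSolution n s p κ u) (x₀ : EuclideanSpace ℝ (Fin n))
    (hr : 0 < r) : EnergyDefined s p r x₀ u where
  bulk := by
    have hg := hu.regThree.lap.cont
    rw [bulkDensity_eq]
    exact integrableOn_ht_rpow_mul hs₁ (pt x₀ 0) r ((hg.mul hg).const_mul _)
  trace := ((hu.continuous_traceDensity hp).continuousOn.integrableOn_compact
    (isCompact_closedBall x₀ r)).mono_set Metric.ball_subset_closedBall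
  mass := capIntegrable_massDensity hs₁ hu.regThree.regTwo.regOne.cont hr
  hom := capIntegrable_homDensity hs₁ hs₂ hu.regThree.regTwo.regOne hr
  tan := capIntegrable_tanDensity hs₁ hs₂ hu.regThree.regTwo.regOne hr
  diff_mass := (hasDerivAt_massTerm hs₁ hs₂ rfl hu.regThree.regTwo.regOne hr).differentiableAt
  diff_hom := (hasDerivAt_homTerm hs₁ hs₂ rfl hu.regThree.regTwo hr).differentiableAt
  diff_tan := (hasDerivAt_tanTerm hs₁ hs₂ hp rfl hu.regThree hu.neumannZero hr).differentiableAt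

lemma IsExtensionSolution.energy_eq [NeZero n] (hs₁ : -1 < wexp s) (hs₂ : wexp s < 1)
    (hp : 1 < p) (ha : a = 2 * s / (p - 1)) (hu : IsExtensionSolution n s p κ u)
    (x₀ : EuclideanSpace ℝ (Fin n)) (hr : 0 < r) :
    energy s p κ r x₀ u = r ^ (2 * s * ((p + 1) / (p - 1)) - (n : ℝ)) *
        ((∫ X in upperHalf n ∩ Metric.ball (pt x₀ 0) r, bulkDensity s u X)
          - κ / (p + 1) * ∫ x in Metric.ball x₀ r, traceDensity p u x)
      + a * (n + wexp s - 1 - a) * scaledAvg s a x₀ u u r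
      + a * (n + wexp s - 1 - a) * scaledAvg s a x₀ u (scaleD a x₀ u) r
      - scaledAvg s a x₀ (scaleD a x₀ u) (scaleD a x₀ u) r
      + scaledAvg s a x₀ (scaleD a x₀ u) (scaleD a x₀ (scaleD a x₀ u)) r
      + scaledDirichlet s a x₀ u u r + scaledDirichlet s a x₀ (scaleD a x₀ u) u r := by
  have hp1 : p - 1 ≠ 0 := by linarith
  have hu3 := hu.regThree
  -- Since (p+2s-1)/(p-1) = 1+a, this constant is minus half of a(n+b-1-a), the zero-order
  -- coefficient in `scaledAvg_lapR`.
  have e1 : s / (p - 1) * ((p + 2 * s - 1) / (p - 1) - n - wexp s)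
      = -(a * (n + wexp s - 1 - a)) / 2 := by
    rw [ha]
    field_simp
    ring
  have e2 : r ^ (-3 + 2 * s + 4 * s / (p - 1) - (n : ℝ)) * capInt x₀ r (massDensity s u)
      = scaledAvg s a x₀ u u r := by
    have h := rpow_mul_capInt_massDensity (s := s) (a := a) (x₀ := x₀) (u := u) hr 0
    rw [Real.rpow_zero, one_mul] at h
    rw [← h]
    congr 2
    rw [ha, wexp]
    ring
  have e3 : r ^ (2 * s * ((p + 1) / (p - 1)) - (n : ℝ) - 1) * capInt x₀ r (tanDensity s x₀ u)
      = scaledDirichlet s a x₀ u u r := by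
    have h := rpow_mul_capInt_tanDensity (a := a) (x₀ := x₀) hs₁ hs₂ hu3.regTwo.regOne hr 0
    rw [Real.rpow_zero, one_mul] at h
    rw [← h]
    congr 2
    rw [ha, wexp]
    field_simp
    ring
  rw [energy, e1, mul_assoc (-(a * (n + wexp s - 1 - a)) / 2), e2, mul_assoc (1 / 2 : ℝ) _
    (capInt _ _ _), e3, (hasDerivAt_massTerm hs₁ hs₂ ha hu3.regTwo.regOne hr).deriv,
    (hasDerivAt_homTerm hs₁ hs₂ ha hu3.regTwo hr).deriv,
    (hasDerivAt_tanTerm hs₁ hs₂ hp ha hu3 hu.neumannZero hr).deriv]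
  field_simp
  ring

/-- The derivative of ⟨Du,D²u⟩ contains ⟨Du,D³u⟩, which cancels against the one inside -⟨Du,LDu⟩.
The Dirichlet terms pairing with u cancel, while T(Du,Du) appears twice. Among the averages, the
mixed ones cancel and only the squares remain. -/
theorem IsExtensionSolution.hasDerivAt_energy [NeZero n] (hs₁ : -1 < wexp s) (hs₂ : wexp s < 1)
    (hp : 1 < p) (ha : a = 2 * s / (p - 1)) (hu : IsExtensionSolution n s p κ u)
    (x₀ : EuclideanSpace ℝ (Fin n)) (hr : 0 < r) :
    HasDerivAt (fun t => energy s p κ t x₀ u)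
      (r⁻¹ * (2 * scaledAvg s a x₀ (scaleD a x₀ (scaleD a x₀ u)) (scaleD a x₀ (scaleD a x₀ u)) r
        + 2 * ((n + wexp s - 1) * (1 + a) - 2 * a - a ^ 2)
          * scaledAvg s a x₀ (scaleD a x₀ u) (scaleD a x₀ u) r
        + 2 * scaledDirichlet s a x₀ (scaleD a x₀ u) (scaleD a x₀ u) r)) r := by
  have hu3 := hu.regThree
  have h0 := hu.neumannZero
  have hw := hu3.scaleD (a := a) (x₀ := x₀) hs₁ hs₂
  have hw2 := hw.scaleD (a := a) (x₀ := x₀) hs₁ hs₂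
  have hw3 := hw2.scaleD (a := a) (x₀ := x₀) hs₂
  have hu1 := hu3.regTwo.regOne
  have hc : ∀ {g : Space n → ℝ}, RegOne s g → ContDiffOn ℝ 1 g (upperHalf n) := fun hg =>
    hg.contDiff.of_le (by norm_num)
  have dV := hu.hasDerivAt_volume_energy hs₁ hs₂ hp ha x₀ hr
  have d00 := hasDerivAt_scaledAvg hs₁ hr hu1.cont hu1.cont (hc hu1) (hc hu1)
    hw.regOne.cont hw.regOne.cont
  have d01 := hasDerivAt_scaledAvg hs₁ hr hu1.cont hw.regOne.cont (hc hu1) (hc hw.regOne)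
    hw.regOne.cont hw2.cont
  have d11 := hasDerivAt_scaledAvg hs₁ hr hw.regOne.cont hw.regOne.cont (hc hw.regOne)
    (hc hw.regOne) hw2.cont hw2.cont
  have d12 := hasDerivAt_scaledAvg hs₁ hr hw.regOne.cont hw2.cont (hc hw.regOne) (hc hw2)
    hw2.cont hw3
  have dD0 := hasDerivAt_scaledDirichlet (a := a) (x₀ := x₀) hs₁ hs₂ hu3.regTwo hu3 h0 hr
  have dD1 := hasDerivAt_scaledDirichlet (a := a) (x₀ := x₀) hs₁ hs₂ hw hu3 h0 hr
  have hd := (((((dV.add (d00.const_mul (a * (n + wexp s - 1 - a)))).add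
    (d01.const_mul (a * (n + wexp s - 1 - a)))).sub d11).add d12).add dD0).add dD1
  refine (hd.congr_of_eventuallyEq ?_).congr_deriv ?_
  · filter_upwards [lt_mem_nhds hr] with t ht'
    exact hu.energy_eq hs₁ hs₂ hp ha x₀ ht'
  have E20 := scaledDirichlet_eq (a := a) (x₀ := x₀) hs₁ hs₂ hw2 hu3.regTwo h0 hr
  have E10 := scaledDirichlet_eq (a := a) (x₀ := x₀) hs₁ hs₂ hw.regOne hu3.regTwo h0 hr
  have E11 := scaledDirichlet_eq (a := a) (x₀ := x₀) hs₁ hs₂ hw.regOne hw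
    (h0.scaleD hs₁ hs₂ hu3.regTwo) hr
  rw [scaledDirichlet_comm (f := u) (h := scaleD a x₀ u)]
  set w1 := scaleD a x₀ u
  set w2 := scaleD a x₀ w1
  rw [scaledAvg_comm (f := w1) (h := u)] at E10 ⊢
  rw [scaledAvg_comm (f := w2) (h := w1)] at E20 ⊢
  rw [scaledAvg_comm (f := w2) (h := u)] at E20
  -- The weights are those of ⟨Du,Lu⟩, ⟨D²u,Lu⟩ and ⟨Du,LDu⟩ in the derivative of the volume part.
  linear_combination r⁻¹ * (2 * E10 + E20 - E11)

end Monotonicity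

end FracLaneEmden

end

/-! ### Positivity of the coefficient and conclusion -/

open FracLaneEmden in
theorem theorem2p1 (n : ℕ) (hn : 1 ≤ n) (s p : ℝ) (hs₁ : 1 < s) (hs₂ : s < 2) (hp : 1 < p)
    (hcond : (n : ℝ) > (p + 4 * s - 1) / (p + 2 * s - 1) + 2 * s / (p - 1)
      - FracLaneEmden.wexp s) :
    ∃ C : ℝ, 0 < C ∧
      ∀ (κ : ℝ) (u : FracLaneEmden.Space n → ℝ), FracLaneEmden.IsExtensionSolution n s p κ u →
        ∀ x₀ : EuclideanSpace ℝ (Fin n),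
          (∀ r : ℝ, 0 < r → FracLaneEmden.EnergyDefined s p r x₀ u) ∧
          MonotoneOn (fun r : ℝ => FracLaneEmden.energy s p κ r x₀ u) (Ioi 0) ∧
          ∀ r : ℝ, 0 < r →
            DifferentiableAt ℝ (fun t : ℝ => FracLaneEmden.energy s p κ t x₀ u) r ∧
            C * (r ^ (4 * s / (p - 1) + 2 * s - 2 - (n : ℝ))
                * FracLaneEmden.capInt x₀ r (FracLaneEmden.homDensity s p x₀ u))
              ≤ deriv (fun t : ℝ => FracLaneEmden.energy s p κ t x₀ u) r := by
  have : NeZero n := ⟨by omega⟩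
  have hb₁ : -1 < wexp s := by rw [wexp]; linarith
  have hb₂ : wexp s < 1 := by rw [wexp]; linarith
  have hp1 : 0 < p - 1 := by linarith
  obtain ⟨a, ha⟩ : ∃ a, a = 2 * s / (p - 1) := ⟨_, rfl⟩
  have ha0 : 0 < a := by rw [ha]; positivity
  -- The bracket equals (1+a)(n+b-a) - (1+2a), and the fraction in the hypothesis is (1+2a)/(1+a),
  -- so positivity is the hypothesis multiplied by 1+a.
  have hC : 0 < 2 * ((n + wexp s - 1) * (1 + a) - 2 * a - a ^ 2) := by
    have h1 : (p + 4 * s - 1) / (p + 2 * s - 1) = (1 + 2 * a) / (1 + a) := by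
      have : p + 2 * s - 1 ≠ 0 := by linarith
      have : 1 + a ≠ 0 := by linarith
      have h2 : a * (p - 1) = 2 * s := by rw [ha]; field_simp
      rw [div_eq_div_iff ‹_› ‹_›]
      linear_combination -h2
    rw [h1, ← ha] at hcond
    have h3 : (1 + 2 * a) / (1 + a) < n + wexp s - a := by linarith
    rw [div_lt_iff₀ (by linarith)] at h3
    nlinarith
  refine ⟨_, hC, fun κ u hu x₀ => ?_⟩
  have hpow : ∀ r : ℝ, 0 < r → r ^ (4 * s / (p - 1) + 2 * s - 2 - (n : ℝ))
      * capInt x₀ r (homDensity s p x₀ u)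
        = r⁻¹ * scaledAvg s a x₀ (scaleD a x₀ u) (scaleD a x₀ u) r := fun r hr => by
    rw [← Real.rpow_neg_one, ← rpow_mul_capInt_homDensity ha hr]
    congr 2
    rw [ha, wexp]
    ring
  have hder := fun (r : ℝ) (hr : 0 < r) => hu.hasDerivAt_energy hb₁ hb₂ hp ha x₀ hr
  have hle : ∀ r : ℝ, 0 < r → 2 * ((n + wexp s - 1) * (1 + a) - 2 * a - a ^ 2)
      * (r ^ (4 * s / (p - 1) + 2 * s - 2 - (n : ℝ)) * capInt x₀ r (homDensity s p x₀ u))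
        ≤ deriv (fun t : ℝ => energy s p κ t x₀ u) r := fun r hr => by
    have hw := hu.regThree.scaleD (a := a) (x₀ := x₀) hb₁ hb₂
    have h1 := scaledAvg_self_nonneg (s := s) (a := a) (x₀ := x₀) hr
      (scaleD a x₀ (scaleD a x₀ u))
    have h2 : 0 ≤ scaledDirichlet s a x₀ (scaleD a x₀ u) (scaleD a x₀ u) r :=
      mul_nonneg (Real.rpow_nonneg hr.le _) (capDirichlet_self_nonneg hb₁ hb₂ hw.regOne x₀ hr)
    rw [(hder r hr).deriv, hpow r hr, mul_left_comm]
    -- The square of D²u and the Dirichlet form of Du are nonnegative and are dropped.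
    exact mul_le_mul_of_nonneg_left (by linarith) (inv_nonneg.2 hr.le)
  refine ⟨fun r hr => hu.energyDefined hb₁ hb₂ hp x₀ hr, ?_,
    fun r hr => ⟨(hder r hr).differentiableAt, hle r hr⟩⟩
  refine monotoneOn_of_deriv_nonneg (convex_Ioi 0)
    (fun r hr => (hder r hr).continuousAt.continuousWithinAt)
    (fun r hr => (hder r (interior_subset hr)).differentiableAt.differentiableWithinAt)
    fun r hr => ?_
  have hr' : (0 : ℝ) < r := interior_subset hr
  refine (mul_nonneg hC.le ?_).trans (hle r hr')
  rw [hpow r hr']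
  exact mul_nonneg (inv_nonneg.2 hr'.le) (scaledAvg_self_nonneg hr' _)
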